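/- Conventions. Partitions are identified with their Young diagrams, $(i,j)\in\lambda$ being the cell in row $i$ (rows numbered downwards) and column $j$. Let $\mu\subset\lambda$ be partitions. A \emph{$\lambda$-Dyck path} is a sequence $D=(u_0,\dots,u_m)$ of cells of $\lambda$ in which every step $u_l-u_{l-1}$ is $(-1,0)$ (an up step) or $(0,1)$ (a down step); $\mathrm{Dyck}_\lambda(s,t)$ is the set of those with $u_0=s$ and $u_m=t$. For $0<l<m$, the cell $u_l$ is a \emph{peak} (resp. \emph{valley}) of $D$ if the step into $u_l$ is an up (resp. down) step and the step out of $u_l$ is a down (resp. up) step; $\mathcal V(D)$ is the set of valleys. A peak $u$ is \emph{$\lambda$-high} if $u+(1,1)\in\lambda$. For $\lambda$-Dyck paths write $D_1<D_2$ if $D_1\cap D_2=\emptyset$ and for every $u\in D_1$ there is an integer $a\ge 0$ with $u-(a,a)\in D_2$. The \emph{Kreiman outer decomposition} of $\lambda/\mu$ is the (unique up to order) sequence $L_1,\dots,L_k$ of pairwise disjoint nonempty $\lambda$-Dyck paths with union $\lambda/\mu$ such that each $L_i$ starts at the southmost cell $s_i$ of a column of $\lambda$ and ends at the eastmost cell $t_i$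 of a row of $\lambda$. Let $P$ be the poset $\{L_1,\dots,L_k\}$ ordered by $<$. A \emph{rank function} on $P$ is a map $r:P\to\mathbb N$ with $r(x)=0$ for $x$ minimal and $r(y)=r(x)+1$ whenever $y$ covers $x$; it is unique if it exists, and $P$ is then called \emph{ranked}. An \emph{excited move} replaces, in a set $D\subset\lambda$ of cells, a cell $(i,j)\in D$ with $(i+1,j),(i,j+1),(i+1,j+1)\notin D$ and $(i+1,j+1)\in\lambda$ by $(i+1,j+1)$. An \emph{excited diagram} of $\lambda/\mu$ is a set obtained from $\mu$ by a finite (possibly empty) sequence of excited moves, and a \emph{pleasant diagram} of $\lambda/\mu$ is a subset of $\lambda\setminus D$ for some excited diagram $D$ of $\lambda/\mu$. Let $p(\lambda/\mu)$ be the number of pleasant diagrams. For $1\le i,j\le k$ with $\mathrm{Dyck}_\lambda(s_i,t_j)\neq\emptyset$, let $L_\lambda(s_i,t_j)$ be the lowest path in $\mathrm{Dyck}_\lambda(s_i,t_j)$, that is, the path $L$ such that for every $D\in\mathrm{Dyck}_\lambda(s_i,t_j)$ and every $u\in L$ there is an integer $a\ge 0$ with $u-(a,a)\in D$. It is a skew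 shape, namely $\lambda/\nu$ with $\nu=\lambda\setminus L_\lambda(s_i,t_j)$. If $\mathrm{Dyck}_\lambda(s_i,t_j)=\emptyset$, put $p(L_\lambda(s_i,t_j))=0$. Theorem. Let $L_1,\dots,L_k$ be the Kreiman outer decomposition of $\lambda/\mu$. Suppose that $P$ is ranked, with $r_i$ the rank of $L_i$, and that whenever $L_i<L_j$, the first step of $L_j$ is an up step, the last step of $L_j$ is a down step, and every peak of $L_j$ is $\lambda$-high. Then \[ \sum_{(D_1,\dots,D_k)} q^{\sum_{i=1}^k|\mathcal V(D_i)|} = q^{-\sum_{i=1}^k r_i}\,\det\bigl(F_\lambda(s_i,t_j;q)\bigr)_{i,j=1}^k, \qquad F_\lambda(s,t;q)=\sum_{D\in\mathrm{Dyck}_\lambda(s,t)}q^{|\mathcal V(D)|}, \] where the sum on the left is over all tuples with $D_i\in\mathrm{Dyck}_\lambda(s_i,t_i)$ for all $i$ and $D_i<D_j$ whenever $L_i<L_j$ (that is, over $D_1<\dots<D_k$ if $L_1<\dots<L_k$). The identity holds for every nonzero element $q$ of every field; in particular it holds for an indeterminate $q$. Moreover, \[ p(\lambda/\mu)=2^{\sum_{i=1}^k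 r_i}\,\det\bigl(p(L_\lambda(s_i,t_j))\bigr)_{i,j=1}^k . \] -/

import Mathlib

namespace SkewDyck

/-- A cell `(i, j)` is the cell in row `i` and column `j`; rows and columns are numbered from `0`,
rows grow downwards (south) and columns to the right (east), as in `YoungDiagram`. -/
abbrev Cell : Type := ℕ × ℕ

/-- `(u, v)` is an up step: `v - u = (-1, 0)`. -/
def UpStep (u v : Cell) : Prop := v.1 + 1 = u.1 ∧ v.2 = u.2

/-- `(u, v)` is a down step: `v - u = (0, 1)`. -/
def DownStep (u v : Cell) : Prop := v.1 = u.1 ∧ v.2 = u.2 + 1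

/-- A sequence of cells of `lam` all of whose steps are up steps or down steps. -/
def IsDyckPath (lam : YoungDiagram) (D : List Cell) : Prop :=
  (∀ u ∈ D, u ∈ lam) ∧ D.IsChain (fun u v => UpStep u v ∨ DownStep u v)

/-- `D` is a `lam`-Dyck path with first cell `s` and last cell `t`. -/
def IsDyckPathFromTo (lam : YoungDiagram) (s t : Cell) (D : List Cell) : Prop :=
  IsDyckPath lam D ∧ D.head? = some s ∧ D.getLast? = some t

/-- `u` is a peak of `D`: it is entered by an up step and left by a down step. -/
def IsPeak (D : List Cell) (u : Cell) : Prop :=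
  ∃ a b, [a, u, b] <:+: D ∧ UpStep a u ∧ DownStep u b

/-- `u` is a valley of `D`: it is entered by a down step and left by an up step. -/
def IsValley (D : List Cell) (u : Cell) : Prop :=
  ∃ a b, [a, u, b] <:+: D ∧ DownStep a u ∧ UpStep u b

open Classical in
/-- The set of valleys of `D`. -/
noncomputable def valleys (D : List Cell) : Finset Cell :=
  D.toFinset.filter (IsValley D)

/-- Every peak `u` of `D` is a `lam`-high peak: `u + (1, 1)` is a cell of `lam`. -/
def AllPeaksHigh (lam : YoungDiagram) (D : List Cell) : Prop :=
  ∀ u, IsPeak D u → (u.1 + 1, u.2 + 1) ∈ lam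

/-- For every cell `u` of `D₁` there is an integer `k ≥ 0` such that `u - (k, k)` is in `D₂`. -/
def DiagonallyBelow (D₁ D₂ : List Cell) : Prop :=
  ∀ u ∈ D₁, ∃ k : ℕ, ∃ v ∈ D₂, v.1 + k = u.1 ∧ v.2 + k = u.2

/-- The relation `D₁ ≤ D₂`. -/
def WeaklyBelow (D₁ D₂ : List Cell) : Prop :=
  DiagonallyBelow D₁ D₂ ∧ ∀ u, u ∈ D₁ → u ∈ D₂ → IsPeak D₁ u ∧ IsValley D₂ u

/-- The relation `D₁ < D₂`. -/
def StrictlyBelow (D₁ D₂ : List Cell) : Prop :=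
  WeaklyBelow D₁ D₂ ∧ List.Disjoint D₁ D₂

/-- Along a Dyck path the content `column - row` increases strictly, so cells do not repeat. -/
theorem IsDyckPath.nodup {lam : YoungDiagram} {D : List Cell} (h : IsDyckPath lam D) :
    D.Nodup := by
  have h2 : D.IsChain (fun u v : Cell => (u.2 : ℤ) - u.1 < (v.2 : ℤ) - v.1) := by
    refine h.2.imp ?_
    rintro u v (⟨h1, h2⟩ | ⟨h1, h2⟩) <;> omega
  have : IsTrans Cell (fun u v : Cell => (u.2 : ℤ) - u.1 < (v.2 : ℤ) - v.1) :=
    ⟨fun _ _ _ => lt_trans⟩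
  refine (List.isChain_iff_pairwise.1 h2).imp ?_
  rintro u v huv rfl
  exact lt_irrefl _ huv

theorem finite_isDyckPath (lam : YoungDiagram) : {D | IsDyckPath lam D}.Finite := by
  refine (Set.finite_range
    (fun l : {l : List {u // u ∈ lam.cells} // l.Nodup} => l.1.map Subtype.val)).subset ?_
  intro D hD
  have hnd := IsDyckPath.nodup hD
  lift D to List {u // u ∈ lam.cells} using fun u hu => (YoungDiagram.mem_cells u).2 (hD.1 u hu)
  exact ⟨⟨D, hnd.of_map _⟩, rfl⟩

/-- The set `Dyck_lam(s, t)` of `lam`-Dyck paths from `s` to `t`. -/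
noncomputable def dyckPaths (lam : YoungDiagram) (s t : Cell) : Finset (List Cell) :=
  Set.Finite.toFinset (s := {D | IsDyckPathFromTo lam s t D})
    ((finite_isDyckPath lam).subset fun _ h => h.1)

theorem mem_dyckPaths {lam : YoungDiagram} {s t : Cell} {D : List Cell} :
    D ∈ dyckPaths lam s t ↔ IsDyckPathFromTo lam s t D := by
  simp [dyckPaths]

/-- The valley generating function `F_lam(s, t; q)`. -/
noncomputable def valleyGF {K : Type*} [Field K] (lam : YoungDiagram) (s t : Cell) (q : K) : K :=
  ∑ D ∈ dyckPaths lam s t, q ^ (valleys D).card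

/-- `L` is the lowest path in `Dyck_lam(s, t)`. -/
def IsLowestPath (lam : YoungDiagram) (s t : Cell) (L : List Cell) : Prop :=
  L ∈ dyckPaths lam s t ∧ ∀ D ∈ dyckPaths lam s t, DiagonallyBelow L D

/-- `L 0, …, L (k - 1)` is a Kreiman outer decomposition of `lam / mu` with
`s i` and `t i` the first and the last cell of `L i`. -/
structure IsKreimanDecomposition (lam mu : YoungDiagram) {k : ℕ} (L : Fin k → List Cell)
    (s t : Fin k → Cell) : Prop where
  path : ∀ i, IsDyckPathFromTo lam (s i) (t i) (L i)
  /-- The first cell is the southmost cell of a column of `lam`. -/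
  south : ∀ i, ((s i).1 + 1, (s i).2) ∉ lam
  /-- The last cell is the eastmost cell of a row of `lam`. -/
  east : ∀ i, ((t i).1, (t i).2 + 1) ∉ lam
  disjoint : ∀ i j, i ≠ j → List.Disjoint (L i) (L j)
  cover : ∀ u, (∃ i, u ∈ L i) ↔ u ∈ lam ∧ u ∉ mu

/-- `r` is a rank function of the strict order `lt`: it vanishes on minimal elements and
increases by exactly `1` along covering relations. -/
def IsRankFunction {α : Type*} (lt : α → α → Prop) (r : α → ℕ) : Prop :=
  (∀ x, (∀ y, ¬ lt y x) → r x = 0) ∧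
  ∀ x y, lt x y → (∀ z, ¬ (lt x z ∧ lt z y)) → r y = r x + 1

/-- The first step of `D` is an up step. -/
def FirstStepUp (D : List Cell) : Prop := ∃ u v, [u, v] <+: D ∧ UpStep u v

/-- The last step of `D` is a down step. -/
def LastStepDown (D : List Cell) : Prop := ∃ u v, [u, v] <:+ D ∧ DownStep u v

/-- `D'` arises from `D` by an excited move inside `lam`. -/
def ExcitedMove (lam : YoungDiagram) (D D' : Finset Cell) : Prop :=
  ∃ i j : ℕ, (i, j) ∈ D ∧ (i + 1, j) ∉ D ∧ (i, j + 1) ∉ D ∧ (i + 1, j + 1) ∉ D ∧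
    (i + 1, j + 1) ∈ lam ∧ D' = insert (i + 1, j + 1) (D.erase (i, j))

/-- `D` is an excited diagram of `lam / mu`, where `mu` is given by its set of cells. -/
def IsExcitedDiagram (lam : YoungDiagram) (mu : Finset Cell) (D : Finset Cell) : Prop :=
  Relation.ReflTransGen (ExcitedMove lam) mu D

open Classical in
/-- The set of pleasant diagrams of `lam / mu`, where `mu` is given by its set of cells:
the subsets of `lam \ D` for the excited diagrams `D` of `lam / mu`. -/
noncomputable def pleasantDiagrams (lam : YoungDiagram) (mu : Finset Cell) :
    Finset (Finset Cell) :=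
  lam.cells.powerset.filter fun P => ∃ D, IsExcitedDiagram lam mu D ∧ P ⊆ lam.cells \ D

/-- The number `p(lam / mu)` of pleasant diagrams. -/
noncomputable def pleasantCount (lam : YoungDiagram) (mu : Finset Cell) : ℕ :=
  (pleasantDiagrams lam mu).card

open Classical in
/-- The number `p(L_lam(s, t))` of pleasant diagrams of the lowest path `L = L_lam(s, t)`, viewed
as the skew shape `lam / nu` with `nu = lam \ L` (when `s` is the southmost cell of a column and
`t` the eastmost cell of a row, `L` is a segment of the rim of `lam` and `nu` is a partition). It is `0` if there is no path from `s` to `t`. -/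
noncomputable def lowestPathPleasantCount (lam : YoungDiagram) (s t : Cell) : ℕ :=
  if h : ∃ L, IsLowestPath lam s t L then
    pleasantCount lam (lam.cells \ h.choose.toFinset)
  else 0

open Classical in
/-- The tuples of paths `D i ∈ Dyck_lam(s i, t i)` with `D i < D j` whenever `L i < L j`
(if `L 0 < L 1 < ⋯` this says `D 0 < D 1 < ⋯`). -/
noncomputable def nonintersectingTuples (lam : YoungDiagram) {k : ℕ} (L : Fin k → List Cell)
    (s t : Fin k → Cell) : Finset (Fin k → List Cell) :=
  (Fintype.piFinset fun i => dyckPaths lam (s i) (t i)).filter fun D =>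
    ∀ i j, StrictlyBelow (L i) (L j) → StrictlyBelow (D i) (D j)

end SkewDyck

/-!
A path is described by the function assigning to the content `column - row` of each of its cells the
row of the cell. A Kreiman outer decomposition becomes a path system (`IsPathSystem`): the content
intervals of its paths form a laminar family, and the order `<` on the paths is strict inclusion of
these intervals (`Nested`), whose covering relation is a forest.

*First identity.* Write `q = (q - 1) + 1` at every valley, so that each valley is either kept or
skipped with weight `q - 1`. Then `F(s, t; q)` counts marked paths, and the Lindström–Gessel–Viennot
involution turns the determinant into a sum over families of marked paths without common vertices
(`det_valleyGF_eq_sum_pathFamilies`). Such families join `s i` to `t i` (`perm_eq_one`), and the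
paths of a nested pair are weakly ordered: they may only meet where a skipped valley of the upper
path touches a peak or an end of the lower path. Summing over the marks, every contact of a covering
pair has weight `1 - q⁻¹` (`det_valleyGF_eq_systemSum`).

The contacts are removed by switches. If the path `j` may touch the paths covered by it but not the
one covering it, then exchanging these two rules divides the sum by `q` (`systemSum_switch`). With
the other paths fixed, the path `j` runs in a region that meets each diagonal in an interval. In
such a region the paths have the same generating function by raisable valleys as by lowerable peaks
(`sum_prod_valley_eq_sum_prod_peak`), since both sides count traces of paths on sets of contents.
The hypotheses on `L j` ensure that, when `j` is strictly above the paths covered by it, it starts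
with an up step, ends with a down step and can be lowered at all its peaks, so that it has one more
peak than valleys; this is the factor `q`. Switching each path as many times as its rank, in a
suitable order, forbids all contacts and gives the factor `q ^ ∑ r i` (`det_valleyGF`).

*Second identity.* The excited diagrams are the complements of the strictly ordered families of
paths, an excited move being the raising of a path at a valley (`isExcitedDiagram_iff`). For every
pleasant diagram there is a unique strictly ordered family such that the diagram contains the
valleys of the family and is contained in its set of cells. Hence with `N` cells in the skew shape
the number of pleasant diagrams is the sum of `2 ^ (N - v)` over the strictly ordered families, `v`
being the number of valleys (`pleasantCount_eq_sum`). Applied to the shape itself and to its lowest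
paths, this reduces the second identity to the first one at `q = 1 / 2`.
-/

namespace SkewDyck

/-! ### Paths as height functions on contents -/

/-- The content `column - row` of a cell. It increases by one along every step of a path. -/
def content (u : Cell) : ℤ := (u.2 : ℤ) - u.1

/-- The position with content `c` and row `r` is a cell of `lam`. -/
def OnDiag (lam : YoungDiagram) (c r : ℤ) : Prop :=
  ∃ u ∈ lam, content u = c ∧ (u.1 : ℤ) = r

/-- The cell with content `c` and row `r` (for `0 ≤ r` and `0 ≤ r + c`). -/
def cellAt (c r : ℤ) : Cell := (r.toNat, (r + c).toNat)

theorem cellAt_content (u : Cell) : cellAt (content u) u.1 = u := by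
  ext <;> simp [cellAt, content]

theorem content_cellAt {c r : ℤ} (h : 0 ≤ r) (h' : 0 ≤ r + c) : content (cellAt c r) = c := by
  simp only [cellAt, content]; omega

theorem cell_ext {u v : Cell} (h : content u = content v) (h' : (u.1 : ℤ) = v.1) : u = v := by
  rw [← cellAt_content u, ← cellAt_content v, h, h']

theorem OnDiag.row_nonneg {lam : YoungDiagram} {c r : ℤ} (h : OnDiag lam c r) : 0 ≤ r := by
  obtain ⟨u, -, -, rfl⟩ := h; positivity

theorem OnDiag.col_nonneg {lam : YoungDiagram} {c r : ℤ} (h : OnDiag lam c r) : 0 ≤ r + c := by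
  obtain ⟨u, -, rfl, rfl⟩ := h; simp [content]

theorem OnDiag.cellAt_mem {lam : YoungDiagram} {c r : ℤ} (h : OnDiag lam c r) :
    cellAt c r ∈ lam := by
  obtain ⟨u, hu, rfl, rfl⟩ := h; rwa [cellAt_content]

theorem onDiag_content {lam : YoungDiagram} {u : Cell} :
    OnDiag lam (content u) u.1 ↔ u ∈ lam :=
  ⟨fun h => by simpa [cellAt_content] using h.cellAt_mem, fun h => ⟨u, h, rfl, rfl⟩⟩

/-- Diagrams are closed under moving up and to the left. -/
theorem OnDiag.of_le {lam : YoungDiagram} {c r c' r' : ℤ} (h : OnDiag lam c r) (h0 : 0 ≤ r')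
    (h1 : 0 ≤ r' + c') (h2 : r' ≤ r) (h3 : r' + c' ≤ r + c) : OnDiag lam c' r' := by
  obtain ⟨⟨i, j⟩, hu, rfl, rfl⟩ := h
  refine ⟨(r'.toNat, (r' + c').toNat), lam.up_left_mem ?_ ?_ hu, ?_, ?_⟩ <;>
    simp only [content] at * <;> omega

/-- `h` describes a path from row `α` on the diagonal of content `a` to row `β` on the diagonal
of content `b`: `h c` is the row of its cell of content `c`. Outside `[a, b]` the value is `0`, so
that a path is determined by its function. -/
structure IsWalk (a b α β : ℤ) (h : ℤ → ℤ) : Prop where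
  le : a ≤ b
  start : h a = α
  finish : h b = β
  out : ∀ c, c < a ∨ b < c → h c = 0
  step : ∀ c, a ≤ c → c < b → h (c + 1) = h c ∨ h (c + 1) = h c - 1

/-- The function `h` describes a `lam`-Dyck path from `s` to `t`. -/
structure IsPath (lam : YoungDiagram) (s t : Cell) (h : ℤ → ℤ) : Prop extends
    IsWalk (content s) (content t) s.1 t.1 h where
  mem : ∀ c, content s ≤ c → c ≤ content t → OnDiag lam c (h c)

/-- The path `h` on `[a, b]` has a valley at content `c`. -/
def ValleyAt (a b : ℤ) (h : ℤ → ℤ) (c : ℤ) : Prop :=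
  a < c ∧ c < b ∧ h (c - 1) = h c ∧ h (c + 1) = h c - 1

/-- The path `h` on `[a, b]` has a peak at content `c`. -/
def PeakAt (a b : ℤ) (h : ℤ → ℤ) (c : ℤ) : Prop :=
  a < c ∧ c < b ∧ h (c - 1) = h c + 1 ∧ h (c + 1) = h c

open Classical in
/-- The contents at which the path `h` on `[a, b]` has a valley. -/
noncomputable def valleySet (a b : ℤ) (h : ℤ → ℤ) : Finset ℤ :=
  (Finset.Ioo a b).filter (ValleyAt a b h)

open Classical in
/-- The contents at which the path `h` on `[a, b]` has a peak. -/
noncomputable def peakSet (a b : ℤ) (h : ℤ → ℤ) : Finset ℤ :=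
  (Finset.Ioo a b).filter (PeakAt a b h)

theorem mem_valleySet {a b : ℤ} {h : ℤ → ℤ} {c : ℤ} : c ∈ valleySet a b h ↔ ValleyAt a b h c := by
  simp only [valleySet, Finset.mem_filter, Finset.mem_Ioo, and_iff_right_iff_imp]
  exact fun h => ⟨h.1, h.2.1⟩

theorem mem_peakSet {a b : ℤ} {h : ℤ → ℤ} {c : ℤ} : c ∈ peakSet a b h ↔ PeakAt a b h c := by
  simp only [peakSet, Finset.mem_filter, Finset.mem_Ioo, and_iff_right_iff_imp]
  exact fun h => ⟨h.1, h.2.1⟩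

open Classical in
/-- The function describing a path given as a list of cells: it sends `c` to the row of the cell of
content `c`, and to `0` if there is none. -/
noncomputable def rowFn (D : List Cell) (c : ℤ) : ℤ :=
  if h : ∃ u ∈ D, content u = c then (h.choose.1 : ℤ) else 0

section ListPath

variable {lam : YoungDiagram} {s t : Cell} {D : List Cell}

theorem IsDyckPathFromTo.content_getElem (hD : IsDyckPathFromTo lam s t D) (l : ℕ)
    (hl : l < D.length) : content D[l] = content s + l := by
  obtain ⟨⟨-, hc⟩, hs, -⟩ := hD
  induction l with
  | zero =>
    rw [List.head?_eq_getElem?, List.getElem?_eq_getElem hl] at hs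
    simp [Option.some.inj hs]
  | succ l ih =>
    have h1 := ih (by omega)
    have h2 := List.isChain_iff_getElem.1 hc l hl
    simp only [UpStep, DownStep, content] at *
    push_cast
    omega

theorem IsDyckPathFromTo.length_pos (hD : IsDyckPathFromTo lam s t D) : 0 < D.length := by
  obtain ⟨-, hs, -⟩ := hD
  cases D <;> simp_all

theorem IsDyckPathFromTo.length (hD : IsDyckPathFromTo lam s t D) :
    content t = content s + (D.length : ℤ) - 1 := by
  have hp := hD.length_pos
  have h1 := hD.content_getElem (D.length - 1) (by omega)
  have ht := hD.2.2
  rw [List.getLast?_eq_getElem?, List.getElem?_eq_getElem (by omega)] at ht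
  rw [Option.some.inj ht] at h1
  omega

theorem IsDyckPathFromTo.mem_iff (hD : IsDyckPathFromTo lam s t D) (u : Cell) :
    u ∈ D ↔ ∃ (l : ℕ) (h : l < D.length), D[l] = u ∧ content u = content s + l := by
  rw [List.mem_iff_getElem]
  constructor
  · rintro ⟨l, h, rfl⟩; exact ⟨l, h, rfl, hD.content_getElem l h⟩
  · rintro ⟨l, h, rfl, -⟩; exact ⟨l, h, rfl⟩

theorem IsDyckPathFromTo.content_inj (hD : IsDyckPathFromTo lam s t D) {u v : Cell} (hu : u ∈ D)
    (hv : v ∈ D) (h : content u = content v) : u = v := by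
  obtain ⟨l, hl, rfl, h1⟩ := (hD.mem_iff u).1 hu
  obtain ⟨m, hm, rfl, h2⟩ := (hD.mem_iff v).1 hv
  have : l = m := by omega
  subst this; rfl

theorem IsDyckPathFromTo.rowFn_content (hD : IsDyckPathFromTo lam s t D) {u : Cell} (hu : u ∈ D) :
    rowFn D (content u) = u.1 := by
  have h : ∃ v ∈ D, content v = content u := ⟨u, hu, rfl⟩
  rw [rowFn, dif_pos h, hD.content_inj h.choose_spec.1 hu h.choose_spec.2]

theorem IsDyckPathFromTo.rowFn_getElem (hD : IsDyckPathFromTo lam s t D) (l : ℕ)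
    (hl : l < D.length) : rowFn D (content s + l) = D[l].1 := by
  rw [← hD.content_getElem l hl, hD.rowFn_content (List.getElem_mem hl)]

theorem IsDyckPathFromTo.mem_iff_rowFn (hD : IsDyckPathFromTo lam s t D) (u : Cell) :
    u ∈ D ↔ content s ≤ content u ∧ content u ≤ content t ∧ rowFn D (content u) = u.1 := by
  have hlen := hD.length
  constructor
  · intro hu
    obtain ⟨l, hl, -, h1⟩ := (hD.mem_iff u).1 hu
    exact ⟨by omega, by omega, hD.rowFn_content hu⟩
  · rintro ⟨h1, h2, h3⟩
    have hl : (content u - content s).toNat < D.length := by omega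
    have h4 := hD.content_getElem _ hl
    have h5 := hD.rowFn_getElem _ hl
    have h6 : content s + ((content u - content s).toNat : ℤ) = content u := by omega
    rw [h6] at h4 h5
    rw [← cell_ext h4 (h5.symm.trans h3)]
    exact List.getElem_mem hl

theorem IsDyckPathFromTo.isPath (hD : IsDyckPathFromTo lam s t D) : IsPath lam s t (rowFn D) := by
  have hlen := hD.length
  have hpos := hD.length_pos
  have hs : s ∈ D := List.mem_of_head? hD.2.1
  have ht : t ∈ D := List.mem_of_getLast? hD.2.2
  refine ⟨⟨by omega, hD.rowFn_content hs, hD.rowFn_content ht, ?_, ?_⟩, ?_⟩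
  · intro c hc
    rw [rowFn, dif_neg]
    rintro ⟨u, hu, rfl⟩
    have := (hD.mem_iff_rowFn u).1 hu
    omega
  · intro c h1 h2
    obtain ⟨l, rfl⟩ : ∃ l : ℕ, c = content s + l := ⟨(c - content s).toNat, by omega⟩
    have hl : l + 1 < D.length := by omega
    have h3 := List.isChain_iff_getElem.1 hD.1.2 l hl
    have h4 := hD.rowFn_getElem l (by omega)
    have h5 := hD.rowFn_getElem (l + 1) hl
    push_cast at h5
    rw [← add_assoc] at h5
    rw [h4, h5]
    simp only [UpStep, DownStep] at h3
    omega
  · intro c h1 h2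
    obtain ⟨l, rfl⟩ : ∃ l : ℕ, c = content s + l := ⟨(c - content s).toNat, by omega⟩
    have hl : l < D.length := by omega
    rw [hD.rowFn_getElem l hl, ← hD.content_getElem l hl, onDiag_content]
    exact hD.1.1 _ (List.getElem_mem hl)

theorem rowFn_injOn : Set.InjOn rowFn {D | IsDyckPathFromTo lam s t D} := by
  intro D hD E hE h
  have hD' := IsDyckPathFromTo.length hD
  have hE' := IsDyckPathFromTo.length hE
  refine List.ext_getElem (by omega) fun l h1 h2 => ?_
  refine cell_ext ?_ ?_
  · rw [IsDyckPathFromTo.content_getElem hD, IsDyckPathFromTo.content_getElem hE]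
  · rw [← IsDyckPathFromTo.rowFn_getElem hD l h1, ← IsDyckPathFromTo.rowFn_getElem hE l h2, h]

/-- Every function describing a `lam`-Dyck path comes from a list of cells. -/
theorem IsPath.exists_list {h : ℤ → ℤ} (hh : IsPath lam s t h) :
    ∃ D, IsDyckPathFromTo lam s t D ∧ rowFn D = h := by
  have hle := hh.le
  set n := (content t - content s).toNat with hn
  let D : List Cell :=
    (List.range (n + 1)).map fun l : ℕ => cellAt (content s + l) (h (content s + l))
  have hlen : D.length = n + 1 := by simp [D]
  have hget : ∀ l (hl : l < D.length), D[l] = cellAt (content s + l) (h (content s + l)) := by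
    intro l hl; simp [D]
  have hon : ∀ l : ℕ, l < n + 1 → OnDiag lam (content s + l) (h (content s + l)) := fun l hl =>
    hh.mem _ (by omega) (by omega)
  have hD : IsDyckPathFromTo lam s t D := by
    refine ⟨⟨?_, ?_⟩, ?_, ?_⟩
    · intro u hu
      obtain ⟨l, hl, rfl⟩ := List.mem_iff_getElem.1 hu
      rw [hget]
      exact (hon l (by omega)).cellAt_mem
    · refine List.isChain_iff_getElem.2 fun l hl => ?_
      rw [hget, hget]
      have h1 := hon l (by omega)
      have h2 := hon (l + 1) (by omega)
      have h3 := hh.step (content s + l) (by omega) (by omega)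
      have := h1.row_nonneg; have := h1.col_nonneg
      have := h2.row_nonneg; have := h2.col_nonneg
      push_cast at *
      rw [← add_assoc] at *
      simp only [UpStep, DownStep, cellAt]
      omega
    · rw [List.head?_eq_getElem?, List.getElem?_eq_getElem (by omega), hget]
      simp only [Nat.cast_zero, add_zero, hh.start, cellAt_content]
    · rw [List.getLast?_eq_getElem?, List.getElem?_eq_getElem (by omega), hget]
      have : content s + ((D.length - 1 : ℕ) : ℤ) = content t := by omega
      rw [this, hh.finish, cellAt_content]
  refine ⟨D, hD, ?_⟩
  funext c
  by_cases hc : content s ≤ c ∧ c ≤ content t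
  · obtain ⟨l, rfl⟩ : ∃ l : ℕ, c = content s + l := ⟨(c - content s).toNat, by omega⟩
    have hl : l < D.length := by omega
    have := (hon l (by omega)).row_nonneg
    rw [hD.rowFn_getElem l hl, hget]
    simp only [cellAt]; omega
  · rw [hD.isPath.out c (by omega), hh.out c (by omega)]

theorem IsDyckPathFromTo.triple_infix (hD : IsDyckPathFromTo lam s t D) {x u y : Cell}
    (hx : x ∈ D) (hu : u ∈ D) (hy : y ∈ D) (h1 : content x + 1 = content u)
    (h2 : content u + 1 = content y) : [x, u, y] <:+: D := by
  obtain ⟨l, hl, rfl, e1⟩ := (hD.mem_iff x).1 hx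
  obtain ⟨m, hm, rfl, e2⟩ := (hD.mem_iff u).1 hu
  obtain ⟨p, hp, rfl, e3⟩ := (hD.mem_iff y).1 hy
  obtain rfl : m = l + 1 := by omega
  obtain rfl : p = l + 2 := by omega
  rw [List.infix_iff_getElem?]
  refine ⟨l, by simp; omega, fun i hi => ?_⟩
  simp only [List.length_cons, List.length_nil] at hi
  interval_cases i
  · simp
  · simp [add_comm]
  · simp [add_comm]

theorem IsDyckPathFromTo.isValley_iff (hD : IsDyckPathFromTo lam s t D) {u : Cell} (hu : u ∈ D) :
    IsValley D u ↔ ValleyAt (content s) (content t) (rowFn D) (content u) := by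
  constructor
  · rintro ⟨x, y, hi, h1, h2⟩
    have hx : x ∈ D := hi.subset (by simp)
    have hy : y ∈ D := hi.subset (by simp)
    have ex : content x = content u - 1 := by simp only [content, DownStep, UpStep] at *; omega
    have ey : content y = content u + 1 := by simp only [content, DownStep, UpStep] at *; omega
    have hx' := (hD.mem_iff_rowFn x).1 hx
    have hy' := (hD.mem_iff_rowFn y).1 hy
    have hu' := (hD.mem_iff_rowFn u).1 hu
    rw [ex] at hx'; rw [ey] at hy'
    simp only [UpStep, DownStep] at *
    refine ⟨?_, ?_, ?_, ?_⟩ <;> omega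
  · rintro ⟨h1, h2, h3, h4⟩
    have hp := hD.isPath
    have m1 := hp.mem (content u - 1) (by omega) (by omega)
    have m2 := hp.mem (content u + 1) (by omega) (by omega)
    have c1 := content_cellAt m1.row_nonneg m1.col_nonneg
    have c2 := content_cellAt m2.row_nonneg m2.col_nonneg
    have hu' := ((hD.mem_iff_rowFn u).1 hu).2.2
    have := m1.row_nonneg; have := m2.row_nonneg
    have := m1.col_nonneg; have := m2.col_nonneg
    refine ⟨_, _, hD.triple_infix (x := cellAt (content u - 1) (rowFn D (content u - 1)))
      (y := cellAt (content u + 1) (rowFn D (content u + 1))) ?_ hu ?_ ?_ ?_, ?_, ?_⟩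
    · rw [hD.mem_iff_rowFn, c1]; refine ⟨by omega, by omega, ?_⟩; simp [cellAt]; omega
    · rw [hD.mem_iff_rowFn, c2]; refine ⟨by omega, by omega, ?_⟩; simp [cellAt]; omega
    · rw [c1]; ring
    · rw [c2]
    · simp only [DownStep, cellAt, content] at *; omega
    · simp only [UpStep, cellAt, content] at *; omega

theorem IsDyckPathFromTo.isPeak_cellAt (hD : IsDyckPathFromTo lam s t D) {c : ℤ}
    (hc : PeakAt (content s) (content t) (rowFn D) c) : IsPeak D (cellAt c (rowFn D c)) := by
  obtain ⟨h1, h2, h3, h4⟩ := hc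
  have hp := hD.isPath
  have m0 := hp.mem c (by omega) (by omega)
  have m1 := hp.mem (c - 1) (by omega) (by omega)
  have m2 := hp.mem (c + 1) (by omega) (by omega)
  have c0 := content_cellAt m0.row_nonneg m0.col_nonneg
  have c1 := content_cellAt m1.row_nonneg m1.col_nonneg
  have c2 := content_cellAt m2.row_nonneg m2.col_nonneg
  have := m0.row_nonneg; have := m0.col_nonneg
  have := m1.row_nonneg; have := m2.row_nonneg
  have := m1.col_nonneg; have := m2.col_nonneg
  refine ⟨_, _, hD.triple_infix (x := cellAt (c - 1) (rowFn D (c - 1)))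
      (y := cellAt (c + 1) (rowFn D (c + 1))) ?_ ?_ ?_ ?_ ?_, ?_, ?_⟩
  · rw [hD.mem_iff_rowFn, c1]; refine ⟨by omega, by omega, ?_⟩; simp [cellAt]; omega
  · rw [hD.mem_iff_rowFn, c0]; refine ⟨by omega, by omega, ?_⟩; simp [cellAt]; omega
  · rw [hD.mem_iff_rowFn, c2]; refine ⟨by omega, by omega, ?_⟩; simp [cellAt]; omega
  · rw [c1, c0]; ring
  · rw [c2, c0]
  · simp only [UpStep, cellAt]; omega
  · simp only [DownStep, cellAt]; omega

theorem IsDyckPathFromTo.card_valleys (hD : IsDyckPathFromTo lam s t D) :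
    (valleys D).card = (valleySet (content s) (content t) (rowFn D)).card := by
  classical
  refine Finset.card_bij (fun u _ => content u) ?_ ?_ ?_
  · intro u hu
    simp only [valleys, Finset.mem_filter, List.mem_toFinset] at hu
    exact mem_valleySet.2 ((hD.isValley_iff hu.1).1 hu.2)
  · intro u hu v hv h
    simp only [valleys, Finset.mem_filter, List.mem_toFinset] at hu hv
    exact hD.content_inj hu.1 hv.1 h
  · intro c hc
    have hc := mem_valleySet.1 hc
    have m := hD.isPath.mem c hc.1.le hc.2.1.le
    have hcc := content_cellAt m.row_nonneg m.col_nonneg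
    have hr : ((cellAt c (rowFn D c)).1 : ℤ) = rowFn D c := by
      have := m.row_nonneg
      simp [cellAt]; omega
    have hm : cellAt c (rowFn D c) ∈ D := by
      rw [hD.mem_iff_rowFn, hcc]; exact ⟨hc.1.le, hc.2.1.le, hr.symm⟩
    refine ⟨cellAt c (rowFn D c), ?_, hcc⟩
    simp only [valleys, Finset.mem_filter, List.mem_toFinset]
    exact ⟨hm, (hD.isValley_iff hm).2 (by rwa [hcc])⟩

theorem IsDyckPathFromTo.firstStepUp (hD : IsDyckPathFromTo lam s t D) (h : FirstStepUp D) :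
    content s < content t ∧ rowFn D (content s + 1) = rowFn D (content s) - 1 := by
  obtain ⟨u, v, hp, huv⟩ := h
  rw [List.prefix_iff_getElem] at hp
  obtain ⟨hl, hp⟩ := hp
  have hl' : 2 ≤ D.length := by simpa using hl
  have h0 := hp 0 (by simp)
  have h1 := hp 1 (by simp)
  have e0 := hD.rowFn_getElem 0 (by omega)
  have e1 := hD.rowFn_getElem 1 (by omega)
  have := hD.length
  simp only [List.getElem_cons_zero, List.getElem_cons_succ] at h0 h1
  rw [← h0] at e0; rw [← h1] at e1
  simp only [UpStep] at huv
  simp only [Nat.cast_zero, add_zero, Nat.cast_one] at e0 e1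
  omega

theorem IsDyckPathFromTo.lastStepDown (hD : IsDyckPathFromTo lam s t D) (h : LastStepDown D) :
    content s < content t ∧ rowFn D (content t - 1) = rowFn D (content t) := by
  obtain ⟨u, v, hp, huv⟩ := h
  have hlen := hD.length
  rw [List.suffix_iff_getElem] at hp
  obtain ⟨hl, hp⟩ := hp
  have hl' : 2 ≤ D.length := by simpa using hl
  have h0 := hp 0 (by simp)
  have h1 := hp 1 (by simp)
  simp only [List.getElem_cons_zero, List.getElem_cons_succ, List.length_cons,
    List.length_nil] at h0 h1
  have e0 := hD.rowFn_getElem (D.length - 2) (by omega)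
  have e1 := hD.rowFn_getElem (D.length - 1) (by omega)
  have c0 : content s + ((D.length - 2 : ℕ) : ℤ) = content t - 1 := by omega
  have c1 : content s + ((D.length - 1 : ℕ) : ℤ) = content t := by omega
  rw [c0] at e0; rw [c1] at e1
  have f0 : D[D.length - 2] = u := by
    rw [← h0]; congr 1; omega
  have f1 : D[D.length - 1] = v := by
    rw [← h1]; congr 1; omega
  rw [f0] at e0; rw [f1] at e1
  simp only [DownStep] at huv
  omega

end ListPath

/-- The functions describing the `lam`-Dyck paths from `s` to `t`. -/
noncomputable def pathFns (lam : YoungDiagram) (s t : Cell) : Finset (ℤ → ℤ) := by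
  classical exact (dyckPaths lam s t).image rowFn

theorem mem_pathFns {lam : YoungDiagram} {s t : Cell} {h : ℤ → ℤ} :
    h ∈ pathFns lam s t ↔ IsPath lam s t h := by
  classical
  simp only [pathFns, Finset.mem_image, mem_dyckPaths]
  exact ⟨by rintro ⟨D, hD, rfl⟩; exact hD.isPath, fun h => h.exists_list⟩

theorem sum_pathFns {M : Type*} [AddCommMonoid M] (lam : YoungDiagram) (s t : Cell)
    (f : (ℤ → ℤ) → M) : ∑ h ∈ pathFns lam s t, f h = ∑ D ∈ dyckPaths lam s t, f (rowFn D) := by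
  classical
  rw [pathFns, Finset.sum_image]
  intro D hD E hE h
  exact rowFn_injOn (mem_dyckPaths.1 hD) (mem_dyckPaths.1 hE) h

theorem valleyGF_eq {K : Type*} [Field K] (lam : YoungDiagram) (s t : Cell) (q : K) :
    valleyGF lam s t q =
      ∑ h ∈ pathFns lam s t, q ^ (valleySet (content s) (content t) h).card := by
  rw [sum_pathFns, valleyGF]
  exact Finset.sum_congr rfl fun D hD => by rw [(mem_dyckPaths.1 hD).card_valleys]

/-! ### Exchanging valleys and peaks of a single path -/

section Switch

variable {a b α β : ℤ} {h h' : ℤ → ℤ}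

/-- If a path is somewhere strictly above (has a smaller row than) another one with the same ends,
then it is strictly above it at one of its own peaks. -/
theorem IsWalk.exists_peak_of_lt (hh : IsWalk a b α β h) (hh' : IsWalk a b α β h') {c : ℤ}
    (hc : h c < h' c) : ∃ d, PeakAt a b h d ∧ h d < h' d := by
  -- Without such a peak, a down step never follows the up step by which `h` got above `h'`, so that
  -- `h` stays above `h'` up to the end.
  by_contra! H
  have hac : a ≤ c := by
    by_contra hlt
    rw [hh.out c (by omega), hh'.out c (by omega)] at hc; omega
  have hcb : c ≤ b := by
    by_contra hlt
    rw [hh.out c (by omega), hh'.out c (by omega)] at hc; omega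
  have hstep : ∀ d, a ≤ d → d < b → (h d < h' d → a < d ∧ h (d - 1) = h d + 1) →
      (h (d + 1) < h' (d + 1) → h d = h (d + 1) + 1) ∧
        (h d < h' d → h (d + 1) < h' (d + 1)) := by
    intro d h1 h2 h3
    have s1 := hh.step d h1 h2
    have s2 := hh'.step d h1 h2
    refine ⟨fun h4 => ?_, fun h4 => ?_⟩
    · by_contra hne
      have h5 : h (d + 1) = h d := by omega
      have h6 : h d < h' d := by omega
      have := H d ⟨(h3 h6).1, h2, (h3 h6).2, h5⟩
      omega
    · by_contra hne
      have h5 : h (d + 1) = h d := by omega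
      have := H d ⟨(h3 h4).1, h2, (h3 h4).2, h5⟩
      omega
  have key : ∀ d, a ≤ d → d ≤ b → (h d < h' d → a < d ∧ h (d - 1) = h d + 1) := by
    intro d hd
    induction d, hd using Int.leInduction with
    | base => intro _ h4; rw [hh.start, hh'.start] at h4; omega
    | succ d hd ih =>
      intro h1 h2
      have := (hstep d hd (by omega) (ih (by omega))).1 h2
      refine ⟨by omega, ?_⟩
      rw [add_sub_cancel_right]; exact this
  have key2 : ∀ d, c ≤ d → d ≤ b → h d < h' d := by
    intro d hd
    induction d, hd using Int.leInduction with
    | base => intro _; exact hc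
    | succ d hd ih =>
      intro h1
      exact (hstep d (by omega) (by omega) (key d (by omega) (by omega))).2 (ih (by omega))
  have := key2 b hcb le_rfl
  rw [hh.finish, hh'.finish] at this
  omega

/-- If a path is somewhere strictly below another one with the same ends, then it is strictly
below it at one of its own valleys. -/
theorem IsWalk.exists_valley_of_lt (hh : IsWalk a b α β h) (hh' : IsWalk a b α β h') {c : ℤ}
    (hc : h' c < h c) : ∃ d, ValleyAt a b h d ∧ h' d < h d := by
  by_contra! H
  have hac : a ≤ c := by
    by_contra hlt
    rw [hh.out c (by omega), hh'.out c (by omega)] at hc; omega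
  have hcb : c ≤ b := by
    by_contra hlt
    rw [hh.out c (by omega), hh'.out c (by omega)] at hc; omega
  have hstep : ∀ d, a ≤ d → d < b → (h' d < h d → a < d ∧ h (d - 1) = h d) →
      (h' (d + 1) < h (d + 1) → h d = h (d + 1)) ∧
        (h' d < h d → h' (d + 1) < h (d + 1)) := by
    intro d h1 h2 h3
    have s1 := hh.step d h1 h2
    have s2 := hh'.step d h1 h2
    refine ⟨fun h4 => ?_, fun h4 => ?_⟩
    · by_contra hne
      have h5 : h (d + 1) = h d - 1 := by omega
      have h6 : h' d < h d := by omega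
      have := H d ⟨(h3 h6).1, h2, (h3 h6).2, h5⟩
      omega
    · by_contra hne
      have h5 : h (d + 1) = h d - 1 := by omega
      have := H d ⟨(h3 h4).1, h2, (h3 h4).2, h5⟩
      omega
  have key : ∀ d, a ≤ d → d ≤ b → (h' d < h d → a < d ∧ h (d - 1) = h d) := by
    intro d hd
    induction d, hd using Int.leInduction with
    | base => intro _ h4; rw [hh.start, hh'.start] at h4; omega
    | succ d hd ih =>
      intro h1 h2
      have := (hstep d hd (by omega) (ih (by omega))).1 h2
      refine ⟨by omega, ?_⟩
      rw [add_sub_cancel_right]; exact this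
  have key2 : ∀ d, c ≤ d → d ≤ b → h' d < h d := by
    intro d hd
    induction d, hd using Int.leInduction with
    | base => intro _; exact hc
    | succ d hd ih =>
      intro h1
      exact (hstep d (by omega) (by omega) (key d (by omega) (by omega))).2 (ih (by omega))
  have := key2 b hcb le_rfl
  rw [hh.finish, hh'.finish] at this
  omega

/-- Lowering a path at a peak by one cell gives a path. -/
theorem IsWalk.lower (hh : IsWalk a b α β h) {c : ℤ} (hc : PeakAt a b h c) :
    IsWalk a b α β (Function.update h c (h c + 1)) := by
  obtain ⟨h1, h2, h3, h4⟩ := hc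
  refine ⟨hh.le, ?_, ?_, ?_, ?_⟩
  · rw [Function.update_of_ne (by omega), hh.start]
  · rw [Function.update_of_ne (by omega), hh.finish]
  · intro d hd
    rw [Function.update_of_ne (by omega), hh.out d hd]
  · intro d hd hd'
    have := hh.step d hd hd'
    rcases eq_or_ne d c with rfl | h5
    · rw [Function.update_of_ne (by omega), Function.update_self]; omega
    · rcases eq_or_ne (d + 1) c with rfl | h6
      · rw [Function.update_self, Function.update_of_ne h5]
        rw [add_sub_cancel_right] at h3; omega
      · rwa [Function.update_of_ne h6, Function.update_of_ne h5]

/-- Raising a path at a valley by one cell gives a path. -/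
theorem IsWalk.raise (hh : IsWalk a b α β h) {c : ℤ} (hc : ValleyAt a b h c) :
    IsWalk a b α β (Function.update h c (h c - 1)) := by
  obtain ⟨h1, h2, h3, h4⟩ := hc
  refine ⟨hh.le, ?_, ?_, ?_, ?_⟩
  · rw [Function.update_of_ne (by omega), hh.start]
  · rw [Function.update_of_ne (by omega), hh.finish]
  · intro d hd
    rw [Function.update_of_ne (by omega), hh.out d hd]
  · intro d hd hd'
    have := hh.step d hd hd'
    rcases eq_or_ne d c with rfl | h5
    · rw [Function.update_of_ne (by omega), Function.update_self]; omega
    · rcases eq_or_ne (d + 1) c with rfl | h6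
      · rw [Function.update_self, Function.update_of_ne h5]
        rw [add_sub_cancel_right] at h3; omega
      · rwa [Function.update_of_ne h6, Function.update_of_ne h5]

variable {R : ℤ → ℤ → Prop} {G : Finset (ℤ → ℤ)}

/-- Among the paths in a region with prescribed cells at the contents in `S` there is one all of
whose lowerable peaks are at contents in `S`. -/
theorem exists_lowest
    (hG : ∀ h, h ∈ G ↔ IsWalk a b α β h ∧ ∀ c, a ≤ c → c ≤ b → R c (h c))
    (S : Finset ℤ) (hh : h ∈ G) :
    ∃ h' ∈ G, (∀ c ∈ S, h' c = h c) ∧ ∀ c, PeakAt a b h' c → R c (h' c + 1) → c ∈ S := by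
  classical
  obtain ⟨g, hg, hmax⟩ := (G.filter fun g => ∀ c ∈ S, g c = h c).exists_max_image
    (fun g => ∑ c ∈ Finset.Icc a b, g c) ⟨h, by simp [hh]⟩
  rw [Finset.mem_filter] at hg
  refine ⟨g, hg.1, hg.2, fun c hc hR => ?_⟩
  by_contra hcS
  have hw := (hG g).1 hg.1
  have hmem : Function.update g c (g c + 1) ∈ G.filter fun g => ∀ c ∈ S, g c = h c := by
    refine Finset.mem_filter.2 ⟨(hG _).2 ⟨hw.1.lower hc, fun d h1 h2 => ?_⟩, fun d hd => ?_⟩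
    · rcases eq_or_ne d c with rfl | h5
      · rwa [Function.update_self]
      · rw [Function.update_of_ne h5]; exact hw.2 d h1 h2
    · rw [Function.update_of_ne (by rintro rfl; exact hcS hd), hg.2 d hd]
  have := hmax _ hmem
  rw [Finset.sum_update_of_mem (Finset.mem_Icc.2 ⟨hc.1.le, hc.2.1.le⟩),
    ← Finset.add_sum_erase _ g (Finset.mem_Icc.2 ⟨hc.1.le, hc.2.1.le⟩),
    Finset.sdiff_singleton_eq_erase] at this
  linarith

/-- Among the paths in a region with prescribed cells at the contents in `S` there is one all of
whose raisable valleys are at contents in `S`. -/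
theorem exists_highest
    (hG : ∀ h, h ∈ G ↔ IsWalk a b α β h ∧ ∀ c, a ≤ c → c ≤ b → R c (h c))
    (S : Finset ℤ) (hh : h ∈ G) :
    ∃ h' ∈ G, (∀ c ∈ S, h' c = h c) ∧ ∀ c, ValleyAt a b h' c → R c (h' c - 1) → c ∈ S := by
  classical
  obtain ⟨g, hg, hmax⟩ := (G.filter fun g => ∀ c ∈ S, g c = h c).exists_min_image
    (fun g => ∑ c ∈ Finset.Icc a b, g c) ⟨h, by simp [hh]⟩
  rw [Finset.mem_filter] at hg
  refine ⟨g, hg.1, hg.2, fun c hc hR => ?_⟩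
  by_contra hcS
  have hw := (hG g).1 hg.1
  have hmem : Function.update g c (g c - 1) ∈ G.filter fun g => ∀ c ∈ S, g c = h c := by
    refine Finset.mem_filter.2 ⟨(hG _).2 ⟨hw.1.raise hc, fun d h1 h2 => ?_⟩, fun d hd => ?_⟩
    · rcases eq_or_ne d c with rfl | h5
      · rwa [Function.update_self]
      · rw [Function.update_of_ne h5]; exact hw.2 d h1 h2
    · rw [Function.update_of_ne (by rintro rfl; exact hcS hd), hg.2 d hd]
  have := hmax _ hmem
  rw [Finset.sum_update_of_mem (Finset.mem_Icc.2 ⟨hc.1.le, hc.2.1.le⟩),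
    ← Finset.add_sum_erase _ g (Finset.mem_Icc.2 ⟨hc.1.le, hc.2.1.le⟩),
    Finset.sdiff_singleton_eq_erase] at this
  linarith

/-- A path in a region all of whose lowerable peaks are at contents in `S` is determined by its
cells at these contents: of two such paths, the one that is higher somewhere is so at one of its own
peaks, which is then lowerable. -/
theorem eq_of_lowest
    (hG : ∀ h, h ∈ G ↔ IsWalk a b α β h ∧ ∀ c, a ≤ c → c ≤ b → R c (h c))
    (hR : ∀ c r₁ r r₂, R c r₁ → R c r₂ → r₁ ≤ r → r ≤ r₂ → R c r) {S : Finset ℤ}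
    (hh : h ∈ G) (hh' : h' ∈ G) (heq : ∀ c ∈ S, h c = h' c)
    (H : ∀ c, PeakAt a b h c → R c (h c + 1) → c ∈ S)
    (H' : ∀ c, PeakAt a b h' c → R c (h' c + 1) → c ∈ S) : h = h' := by
  have hw := (hG h).1 hh
  have hw' := (hG h').1 hh'
  funext c
  by_contra hne
  rcases lt_or_gt_of_ne hne with hlt | hlt
  · obtain ⟨d, hd, h1⟩ := hw.1.exists_peak_of_lt hw'.1 hlt
    have := heq d (H d hd (hR d _ _ _ (hw.2 d hd.1.le hd.2.1.le) (hw'.2 d hd.1.le hd.2.1.le)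
      (by omega) (by omega)))
    omega
  · obtain ⟨d, hd, h1⟩ := hw'.1.exists_peak_of_lt hw.1 hlt
    have := heq d (H' d hd (hR d _ _ _ (hw'.2 d hd.1.le hd.2.1.le) (hw.2 d hd.1.le hd.2.1.le)
      (by omega) (by omega)))
    omega

/-- A path in a region all of whose raisable valleys are at contents in `S` is determined by its
cells at these contents. -/
theorem eq_of_highest
    (hG : ∀ h, h ∈ G ↔ IsWalk a b α β h ∧ ∀ c, a ≤ c → c ≤ b → R c (h c))
    (hR : ∀ c r₁ r r₂, R c r₁ → R c r₂ → r₁ ≤ r → r ≤ r₂ → R c r) {S : Finset ℤ}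
    (hh : h ∈ G) (hh' : h' ∈ G) (heq : ∀ c ∈ S, h c = h' c)
    (H : ∀ c, ValleyAt a b h c → R c (h c - 1) → c ∈ S)
    (H' : ∀ c, ValleyAt a b h' c → R c (h' c - 1) → c ∈ S) : h = h' := by
  have hw := (hG h).1 hh
  have hw' := (hG h').1 hh'
  funext c
  by_contra hne
  rcases lt_or_gt_of_ne hne with hlt | hlt
  · obtain ⟨d, hd, h1⟩ := hw'.1.exists_valley_of_lt hw.1 hlt
    have := heq d (H' d hd (hR d _ _ _ (hw.2 d hd.1.le hd.2.1.le) (hw'.2 d hd.1.le hd.2.1.le)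
      (by omega) (by omega)))
    omega
  · obtain ⟨d, hd, h1⟩ := hw.1.exists_valley_of_lt hw'.1 hlt
    have := heq d (H d hd (hR d _ _ _ (hw'.2 d hd.1.le hd.2.1.le) (hw.2 d hd.1.le hd.2.1.le)
      (by omega) (by omega)))
    omega

variable {K : Type*} [CommRing K]

open Classical in
/-- Expansion of a product of factors `x c` and `x c + y`, indexed by the set `S` of the contents at
which `x c` is chosen. -/
theorem prod_ite_add (I : Finset ℤ) (F : ℤ → Prop) [DecidablePred F]
    (x : ℤ → K) (y : K) :
    ∏ c ∈ I, (if F c then x c else x c + y) =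
      ∑ S ∈ I.powerset, if ∀ c ∈ I, F c → c ∈ S then
        (∏ c ∈ S, x c) * ∏ _c ∈ I \ S, y else 0 := by
  have h1 : ∀ c ∈ I, (if F c then x c else x c + y) = x c + (if F c then 0 else y) := by
    intro c _; split_ifs <;> simp
  rw [Finset.prod_congr rfl h1, Finset.prod_add]
  refine Finset.sum_congr rfl fun S _ => ?_
  split_ifs with h
  · congr 1
    refine Finset.prod_congr rfl fun c hc => ?_
    rw [Finset.mem_sdiff] at hc
    rw [if_neg fun hF => hc.2 (h c hc.1 hF)]
  · push Not at h
    obtain ⟨c, hc, hF, hS⟩ := h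
    rw [Finset.prod_eq_zero (i := c) (Finset.mem_sdiff.2 ⟨hc, hS⟩) (by simp [hF]), mul_zero]

open Classical in
/-- **Exchange of valleys and peaks.** In a region that meets every diagonal in an interval, the
paths weighted by their raisable valleys have the same generating function as the paths weighted
by their lowerable peaks. Both sides count pairs of a set `S` of contents and the trace of a path
on `S`: among the paths with a given trace there is a unique one whose raisable valleys
(respectively lowerable peaks) all belong to `S`. -/
theorem sum_prod_valley_eq_sum_prod_peak
    (hG : ∀ h, h ∈ G ↔ IsWalk a b α β h ∧ ∀ c, a ≤ c → c ≤ b → R c (h c))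
    (hR : ∀ c r₁ r r₂, R c r₁ → R c r₂ → r₁ ≤ r → r ≤ r₂ → R c r) (x : ℤ → ℤ → K) (y : K) :
    ∑ h ∈ G, ∏ c ∈ Finset.Icc a b,
        (if ValleyAt a b h c ∧ R c (h c - 1) then x c (h c) else x c (h c) + y) =
      ∑ h ∈ G, ∏ c ∈ Finset.Icc a b,
        (if PeakAt a b h c ∧ R c (h c + 1) then x c (h c) else x c (h c) + y) := by
  rw [Finset.sum_congr rfl fun h _ => prod_ite_add (Finset.Icc a b)
      (fun c => ValleyAt a b h c ∧ R c (h c - 1)) (fun c => x c (h c)) y,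
    Finset.sum_congr rfl fun h _ => prod_ite_add (Finset.Icc a b)
      (fun c => PeakAt a b h c ∧ R c (h c + 1)) (fun c => x c (h c)) y]
  rw [Finset.sum_comm, Finset.sum_comm (s := G)]
  refine Finset.sum_congr rfl fun S _ => ?_
  rw [← Finset.sum_filter, ← Finset.sum_filter]
  have hV : ∀ h : ℤ → ℤ, (∀ c ∈ Finset.Icc a b, ValleyAt a b h c ∧ R c (h c - 1) → c ∈ S) ↔
      ∀ c, ValleyAt a b h c → R c (h c - 1) → c ∈ S := fun h =>
    ⟨fun H c h1 h2 => H c (Finset.mem_Icc.2 ⟨h1.1.le, h1.2.1.le⟩) ⟨h1, h2⟩,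
      fun H c _ h1 => H c h1.1 h1.2⟩
  have hP : ∀ h : ℤ → ℤ, (∀ c ∈ Finset.Icc a b, PeakAt a b h c ∧ R c (h c + 1) → c ∈ S) ↔
      ∀ c, PeakAt a b h c → R c (h c + 1) → c ∈ S := fun h =>
    ⟨fun H c h1 h2 => H c (Finset.mem_Icc.2 ⟨h1.1.le, h1.2.1.le⟩) ⟨h1, h2⟩,
      fun H c _ h1 => H c h1.1 h1.2⟩
  refine Finset.sum_bij
    (fun h hh => (exists_lowest hG S (Finset.mem_filter.1 hh).1).choose) ?_ ?_ ?_ ?_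
  · intro h hh
    have := (exists_lowest hG S (Finset.mem_filter.1 hh).1).choose_spec
    exact Finset.mem_filter.2 ⟨this.1, (hP _).2 this.2.2⟩
  · intro h hh g hg heq
    have h1 := (exists_lowest hG S (Finset.mem_filter.1 hh).1).choose_spec
    have h2 := (exists_lowest hG S (Finset.mem_filter.1 hg).1).choose_spec
    refine eq_of_highest hG hR (Finset.mem_filter.1 hh).1 (Finset.mem_filter.1 hg).1
      (fun c hc => ?_) ((hV _).1 (Finset.mem_filter.1 hh).2) ((hV _).1 (Finset.mem_filter.1 hg).2)
    rw [← h1.2.1 c hc, ← h2.2.1 c hc, heq]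
  · intro g hg
    rw [Finset.mem_filter, hP] at hg
    obtain ⟨h, hh, h1, h2⟩ := exists_highest hG S hg.1
    refine ⟨h, Finset.mem_filter.2 ⟨hh, (hV h).2 h2⟩, ?_⟩
    have h3 := (exists_lowest hG S hh).choose_spec
    exact eq_of_lowest hG hR h3.1 hg.1 (fun c hc => (h3.2.1 c hc).trans (h1 c hc)) h3.2.2 hg.2
  · intro h hh
    have h1 := (exists_lowest hG S (Finset.mem_filter.1 hh).1).choose_spec
    congr 1
    exact Finset.prod_congr rfl fun c hc => by rw [h1.2.1 c hc]

/-- A path starting with an up step and ending with a down step has one more peak than valleys. -/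
theorem IsWalk.card_peakSet (hh : IsWalk a b α β h) (hab : a < b) (h1 : h (a + 1) = h a - 1)
    (h2 : h (b - 1) = h b) : (peakSet a b h).card = (valleySet a b h).card + 1 := by
  classical
  -- Counted over the contents below `d + 1`, the difference is `1` or `0` according to the
  -- step from `d` to `d + 1`.
  have key : ∀ d, a ≤ d → d < b →
      (((peakSet a b h).filter (· ≤ d)).card : ℤ) =
        ((valleySet a b h).filter (· ≤ d)).card + (h (d + 1) - h d + 1) := by
    intro d hd
    induction d, hd using Int.leInduction with
    | base =>
      intro _
      rw [h1, Finset.filter_false_of_mem, Finset.filter_false_of_mem]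
      · simp
      · intro c hc; have := (mem_valleySet.1 hc).1; omega
      · intro c hc; have := (mem_peakSet.1 hc).1; omega
    | succ d hd ih =>
      intro hdb
      have ih := ih (by omega)
      have e1 : (peakSet a b h).filter (· ≤ d + 1) =
          if PeakAt a b h (d + 1) then insert (d + 1) ((peakSet a b h).filter (· ≤ d))
          else (peakSet a b h).filter (· ≤ d) := by
        ext c
        split_ifs with hp <;> simp only [Finset.mem_filter, Finset.mem_insert, mem_peakSet]
        · constructor
          · rintro ⟨h3, h4⟩; by_cases h5 : c = d + 1
            · exact Or.inl h5
            · exact Or.inr ⟨h3, by omega⟩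
          · rintro (rfl | ⟨h3, h4⟩)
            · exact ⟨hp, le_rfl⟩
            · exact ⟨h3, by omega⟩
        · refine and_congr_right fun h3 => ⟨fun h4 => ?_, fun h4 => by omega⟩
          by_contra h5
          obtain rfl : c = d + 1 := by omega
          exact hp h3
      have e2 : (valleySet a b h).filter (· ≤ d + 1) =
          if ValleyAt a b h (d + 1) then insert (d + 1) ((valleySet a b h).filter (· ≤ d))
          else (valleySet a b h).filter (· ≤ d) := by
        ext c
        split_ifs with hp <;> simp only [Finset.mem_filter, Finset.mem_insert, mem_valleySet]
        · constructor
          · rintro ⟨h3, h4⟩; by_cases h5 : c = d + 1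
            · exact Or.inl h5
            · exact Or.inr ⟨h3, by omega⟩
          · rintro (rfl | ⟨h3, h4⟩)
            · exact ⟨hp, le_rfl⟩
            · exact ⟨h3, by omega⟩
        · refine and_congr_right fun h3 => ⟨fun h4 => ?_, fun h4 => by omega⟩
          by_contra h5
          obtain rfl : c = d + 1 := by omega
          exact hp h3
      have s1 := hh.step d hd (by omega)
      have s2 := hh.step (d + 1) (by omega) hdb
      have n1 : d + 1 ∉ (peakSet a b h).filter (· ≤ d) := by simp
      have n2 : d + 1 ∉ (valleySet a b h).filter (· ≤ d) := by simp
      have c1 : PeakAt a b h (d + 1) ↔ h (d + 1) = h d - 1 ∧ h (d + 1 + 1) = h (d + 1) := by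
        simp only [PeakAt, add_sub_cancel_right]; omega
      have c2 : ValleyAt a b h (d + 1) ↔ h (d + 1) = h d ∧ h (d + 1 + 1) = h (d + 1) - 1 := by
        simp only [ValleyAt, add_sub_cancel_right]; omega
      rw [e1, e2]
      split_ifs with p1 p2 p2
      · rw [c1] at p1; rw [c2] at p2; omega
      · rw [Finset.card_insert_of_notMem n1]; rw [c1] at p1; push_cast; omega
      · rw [Finset.card_insert_of_notMem n2]; rw [c2] at p2; push_cast; omega
      · rw [c1] at p1; rw [c2] at p2; omega
  have h3 := key (b - 1) (by omega) (by omega)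
  rw [sub_add_cancel, h2, Finset.filter_true_of_mem, Finset.filter_true_of_mem] at h3
  · omega
  · intro c hc; have := (mem_valleySet.1 hc).2.1; omega
  · intro c hc; have := (mem_peakSet.1 hc).2.1; omega

end Switch

/-! ### Planarity -/

/-- A southmost cell of a column is the lowest cell of its diagonal. -/
theorem row_le_of_south {lam : YoungDiagram} {s : Cell} (hs : (s.1 + 1, s.2) ∉ lam) {r : ℤ}
    (h : OnDiag lam (content s) r) : r ≤ s.1 := by
  by_contra hlt
  refine hs (onDiag_content.1 (h.of_le ?_ ?_ ?_ ?_)) <;> simp only [content] at * <;> push_cast <;>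
    omega

/-- An eastmost cell of a row is the lowest cell of its diagonal. -/
theorem row_le_of_east {lam : YoungDiagram} {t : Cell} (ht : (t.1, t.2 + 1) ∉ lam) {r : ℤ}
    (h : OnDiag lam (content t) r) : r ≤ t.1 := by
  by_contra hlt
  refine ht (onDiag_content.1 (h.of_le ?_ ?_ ?_ ?_)) <;> simp only [content] at * <;> push_cast <;>
    omega

/-- At content `c` the path `h` on `[a, b]` is neither entered by a down step nor left by an up
step: it has a peak or one of its ends there. -/
def PeakLike (a b : ℤ) (h : ℤ → ℤ) (c : ℤ) : Prop :=
  (c = a ∨ h (c - 1) = h c + 1) ∧ (c = b ∨ h (c + 1) = h c)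

/-- Two paths, on which the valleys at contents in `M` and `M'` are skipped, have no vertex in
common. -/
def VertexDisjoint (a b : ℤ) (h : ℤ → ℤ) (M : Finset ℤ) (a' b' : ℤ) (h' : ℤ → ℤ)
    (M' : Finset ℤ) : Prop :=
  ∀ c, a ≤ c → c ≤ b → a' ≤ c → c ≤ b' → c ∈ M ∨ c ∈ M' ∨ h c ≠ h' c

/-- If a vertex-disjoint path `h'` starts weakly below `h`, it stays weakly below `h`. They can
only meet at valleys skipped by `h` where `h'` has a peak or an end. -/
theorem VertexDisjoint.weakly_below {a b α β a' b' α' β' : ℤ} {h h' : ℤ → ℤ} {M M' : Finset ℤ}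
    (H : VertexDisjoint a b h M a' b' h' M') (hh : IsWalk a b α β h) (hh' : IsWalk a' b' α' β' h')
    (hM : M ⊆ valleySet a b h) (hM' : M' ⊆ valleySet a' b' h') (ha : a ≤ a')
    (hstart : h a' ≤ h' a') {c : ℤ} (h1 : a' ≤ c) (h2 : c ≤ b) (h3 : c ≤ b') :
    h c ≤ h' c ∧ (h c = h' c → c ∈ M ∧ PeakLike a' b' h' c) := by
  have hM : ∀ c ∈ M, ValleyAt a b h c := fun c hc => mem_valleySet.1 (hM hc)
  have hM' : ∀ c ∈ M', ValleyAt a' b' h' c := fun c hc => mem_valleySet.1 (hM' hc)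
  have key : ∀ c, a' ≤ c → c ≤ b → c ≤ b' →
      h c ≤ h' c ∧ (h c = h' c → c ∈ M ∧ (c = a' ∨ h' (c - 1) = h' c + 1)) := by
    intro c hc
    induction c, hc using Int.leInduction with
    | base =>
      intro h2 h3
      refine ⟨hstart, fun heq => ⟨?_, Or.inl rfl⟩⟩
      rcases H a' ha h2 le_rfl h3 with h4 | h4 | h4
      · exact h4
      · have := (hM' _ h4).1; omega
      · exact absurd heq h4
    | succ c hc ih =>
      intro h2 h3
      obtain ⟨i1, i2⟩ := ih (by omega) (by omega)
      have s1 := hh.step c (by omega) (by omega)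
      have s2 := hh'.step c (by omega) (by omega)
      have hM1 : c + 1 ∈ M → h c = h (c + 1) := fun hc => by
        have := (hM _ hc).2.2.1; rwa [add_sub_cancel_right] at this
      have hM1' : c + 1 ∈ M' → h' c = h' (c + 1) := fun hc => by
        have := (hM' _ hc).2.2.1; rwa [add_sub_cancel_right] at this
      have hd := H (c + 1) (by omega) h2 (by omega) h3
      rw [add_sub_cancel_right]
      rcases i1.lt_or_eq with hlt | heq
      · refine ⟨by omega, fun he => ?_⟩
        rcases hd with h4 | h4 | h4
        · exact ⟨h4, Or.inr (by omega)⟩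
        · have := hM1' h4; omega
        · exact absurd he h4
      · have hv := (hM _ (i2 heq).1).2.2.2
        refine ⟨by omega, fun he => ?_⟩
        rcases hd with h4 | h4 | h4
        · have := hM1 h4; omega
        · have := hM1' h4; omega
        · exact absurd he h4
  obtain ⟨k1, k2⟩ := key c h1 h2 h3
  refine ⟨k1, fun heq => ⟨(k2 heq).1, (k2 heq).2, ?_⟩⟩
  by_cases hcb : c = b'
  · exact Or.inl hcb
  · right
    have hv := hM _ (k2 heq).1
    have s2 := hh'.step c h1 (by omega)
    by_contra hne
    have h5 : h (c + 1) = h' (c + 1) := by have := hv.2.2.2; omega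
    have h6 := hM _ ((key (c + 1) (by omega) (by have := hv.2.1; omega) (by omega)).2 h5).1
    have := h6.2.2.1
    rw [add_sub_cancel_right] at this
    have := hv.2.2.2
    omega

section Ends

variable {lam : YoungDiagram} {s t s' t' : Cell} {h h' : ℤ → ℤ} {M M' : Finset ℤ}

/-- A vertex-disjoint path that starts at a southmost cell inside the content interval of another
path ending at an eastmost cell, also ends inside this interval. -/
theorem VertexDisjoint.nested
    (H : VertexDisjoint (content s) (content t) h M (content s') (content t') h' M')
    (hh : IsPath lam s t h) (hh' : IsPath lam s' t' h')
    (hM : M ⊆ valleySet (content s) (content t) h)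
    (hM' : M' ⊆ valleySet (content s') (content t') h')
    (hs : (s.1 + 1, s.2) ∉ lam) (hs' : (s'.1 + 1, s'.2) ∉ lam) (ht : (t.1, t.2 + 1) ∉ lam)
    (h1 : content s ≤ content s') (h2 : content s' ≤ content t) :
    content s < content s' ∧ content t' < content t := by
  have hstart : h (content s') ≤ h' (content s') := by
    rw [hh'.start]; exact row_le_of_south hs' (hh.mem _ h1 h2)
  have hM1 : ∀ c ∈ M, ValleyAt (content s) (content t) h c := fun c hc => mem_valleySet.1 (hM hc)
  have hle := hh'.le
  constructor
  · by_contra hlt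
    have e : content s' = content s := by omega
    have e1 : h (content s') = h' (content s') := by
      refine le_antisymm hstart ?_
      have m := hh'.mem _ le_rfl hle
      rw [e] at m ⊢
      rw [hh.start]
      exact row_le_of_south hs m
    have := (H.weakly_below hh.toIsWalk hh'.toIsWalk hM hM' h1 hstart le_rfl h2 hle).2 e1
    have := (hM1 _ this.1).1
    omega
  · by_contra hlt
    have k := H.weakly_below hh.toIsWalk hh'.toIsWalk hM hM' h1 hstart h2 le_rfl (by omega)
    have e : h (content t) = h' (content t) := by
      refine le_antisymm k.1 ?_
      rw [hh.finish]
      exact row_le_of_east ht (hh'.mem _ h2 (by omega))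
    have := (hM1 _ (k.2 e).1).2.1
    omega

end Ends

/-- A family of pairwise disjoint paths from southmost to eastmost cells of `lam` that covers all
cells of `lam` lying below one of the paths. -/
structure IsPathSystem (lam : YoungDiagram) {ι : Type*} (L : ι → ℤ → ℤ) (s t : ι → Cell) :
    Prop where
  path : ∀ i, IsPath lam (s i) (t i) (L i)
  south : ∀ i, ((s i).1 + 1, (s i).2) ∉ lam
  east : ∀ i, ((t i).1, (t i).2 + 1) ∉ lam
  disjoint : ∀ i j, i ≠ j → ∀ c, content (s i) ≤ c → c ≤ content (t i) → content (s j) ≤ c →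
    c ≤ content (t j) → L i c ≠ L j c
  filled : ∀ i c r, content (s i) ≤ c → c ≤ content (t i) → L i c < r → OnDiag lam c r →
    ∃ j, content (s j) ≤ c ∧ c ≤ content (t j) ∧ L j c = r

/-- The content interval of `(s i, t i)` lies strictly inside the one of `(s j, t j)`. -/
def Nested {ι : Type*} (s t : ι → Cell) (i j : ι) : Prop :=
  content (s j) < content (s i) ∧ content (t i) < content (t j)

section Nested

variable {lam : YoungDiagram} {ι : Type*} {L : ι → ℤ → ℤ} {s t : ι → Cell}

theorem Nested.trans {i j l : ι} (h : Nested s t i j) (h' : Nested s t j l) : Nested s t i l :=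
  ⟨h'.1.trans h.1, h.2.trans h'.2⟩

theorem Nested.irrefl {i : ι} : ¬ Nested s t i i := fun h => lt_irrefl _ h.1

theorem IsPathSystem.le (hL : IsPathSystem lam L s t) (i : ι) : content (s i) ≤ content (t i) :=
  (hL.path i).le

/-- The content intervals of a path system form a laminar family. -/
theorem IsPathSystem.laminar (hL : IsPathSystem lam L s t) {i j : ι} (hij : i ≠ j) :
    content (t i) < content (s j) ∨ content (t j) < content (s i) ∨ Nested s t i j ∨
      Nested s t j i := by
  have hd : ∀ {i j : ι}, i ≠ j →
      VertexDisjoint (content (s i)) (content (t i)) (L i) ∅ (content (s j)) (content (t j)) (L j)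
        ∅ := fun hij c h1 h2 h3 h4 => Or.inr (Or.inr (hL.disjoint _ _ hij c h1 h2 h3 h4))
  rcases le_total (content (s i)) (content (s j)) with h | h
  · rcases lt_or_ge (content (t i)) (content (s j)) with h' | h'
    · exact Or.inl h'
    · exact Or.inr (Or.inr (Or.inr ((hd hij).nested (hL.path i) (hL.path j) (by simp) (by simp)
        (hL.south i) (hL.south j) (hL.east i) h h')))
  · rcases lt_or_ge (content (t j)) (content (s i)) with h' | h'
    · exact Or.inr (Or.inl h')
    · exact Or.inr (Or.inr (Or.inl ((hd hij.symm).nested (hL.path j) (hL.path i) (by simp)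
        (by simp) (hL.south j) (hL.south i) (hL.east j) h h')))

theorem IsPathSystem.nested_of_common (hL : IsPathSystem lam L s t) {i j : ι} (hij : i ≠ j)
    {c : ℤ} (h1 : content (s i) ≤ c) (h2 : c ≤ content (t i)) (h3 : content (s j) ≤ c)
    (h4 : c ≤ content (t j)) : Nested s t i j ∨ Nested s t j i := by
  rcases hL.laminar hij with h | h | h
  · omega
  · omega
  · exact h

/-- A path to an eastmost cell and a path from a southmost cell start weakly ordered. -/
theorem IsPathSystem.start_le (hL : IsPathSystem lam L s t) {i j : ι} (hij : Nested s t i j)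
    {h h' : ℤ → ℤ} (hh : IsPath lam (s j) (t j) h) (hh' : IsPath lam (s i) (t i) h') :
    h (content (s i)) ≤ h' (content (s i)) := by
  have := hL.le i
  have := hij.2
  rw [hh'.start]
  exact row_le_of_south (hL.south i) (hh.mem _ hij.1.le (by omega))

/-- In a path system the path with the larger content interval lies strictly above the other. -/
theorem IsPathSystem.lt_of_nested (hL : IsPathSystem lam L s t) {i j : ι} (hij : Nested s t i j)
    {c : ℤ} (h1 : content (s i) ≤ c) (h2 : c ≤ content (t i)) : L j c < L i c := by
  have hne : j ≠ i := by rintro rfl; exact hij.irrefl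
  have hd : VertexDisjoint (content (s j)) (content (t j)) (L j) ∅ (content (s i)) (content (t i))
      (L i) ∅ := fun c h1 h2 h3 h4 => Or.inr (Or.inr (hL.disjoint _ _ hne c h1 h2 h3 h4))
  have := hij.1; have := hij.2
  have k := hd.weakly_below (hL.path j).toIsWalk (hL.path i).toIsWalk (by simp) (by simp)
    hij.1.le (hL.start_le hij (hL.path j) (hL.path i)) h1 (by omega) h2
  refine lt_of_le_of_ne k.1 fun h => ?_
  simpa using (k.2 h).1

end Nested

/-! ### The determinant as a sum over vertex-disjoint families -/

/-- A path together with a set of contents of valleys that it skips: at such a content `c` the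
path jumps directly from its cell of content `c - 1` to its cell of content `c + 1`. -/
abbrev MarkedPath : Type := (_ : ℤ → ℤ) × Finset ℤ

/-- The paths from `s` to `t` together with a set of skipped valleys. -/
noncomputable def markedPaths (lam : YoungDiagram) (s t : Cell) : Finset MarkedPath :=
  (pathFns lam s t).sigma fun h => (valleySet (content s) (content t) h).powerset

theorem mem_markedPaths {lam : YoungDiagram} {s t : Cell} {p : MarkedPath} :
    p ∈ markedPaths lam s t ↔
      IsPath lam s t p.1 ∧ p.2 ⊆ valleySet (content s) (content t) p.1 := by
  simp [markedPaths, mem_pathFns]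

/-- Each valley contributes `q = (q - 1) + 1`: it is skipped with weight `q - 1` or kept with
weight `1`. -/
theorem valleyGF_eq_sum_markedPaths {K : Type*} [Field K] (lam : YoungDiagram) (s t : Cell)
    (q : K) : valleyGF lam s t q = ∑ p ∈ markedPaths lam s t, (q - 1) ^ p.2.card := by
  rw [valleyGF_eq, markedPaths, Finset.sum_sigma]
  refine Finset.sum_congr rfl fun h _ => ?_
  have := Finset.sum_pow_mul_eq_add_pow (q - 1) 1 (valleySet (content s) (content t) h)
  simp only [one_pow, mul_one, sub_add_cancel] at this
  exact this.symm

/-- The path that follows `p` up to content `c₀` and `p'` from there on. -/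
def splice (c₀ : ℤ) (p p' : MarkedPath) : MarkedPath :=
  ⟨fun c => if c ≤ c₀ then p.1 c else p'.1 c, p.2.filter (· ≤ c₀) ∪ p'.2.filter (c₀ < ·)⟩

theorem mem_splice {c₀ c : ℤ} {p p' : MarkedPath} :
    c ∈ (splice c₀ p p').2 ↔ (c ∈ p.2 ∧ c ≤ c₀) ∨ (c ∈ p'.2 ∧ c₀ < c) := by
  simp [splice]

theorem splice_self (c₀ : ℤ) (p : MarkedPath) : splice c₀ p p = p := by
  refine Sigma.ext ?_ (heq_of_eq ?_)
  · funext c; simp [splice]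
  · ext c; rw [mem_splice]; constructor
    · tauto
    · intro h; rcases le_or_gt c c₀ with h' | h' <;> tauto

theorem splice_splice (c₀ : ℤ) (p p' : MarkedPath) :
    splice c₀ (splice c₀ p p') (splice c₀ p' p) = p := by
  refine Sigma.ext ?_ (heq_of_eq ?_)
  · funext c
    by_cases h : c ≤ c₀ <;> simp [splice, h]
  · ext c
    simp only [mem_splice]
    constructor
    · rintro (⟨⟨h, -⟩ | ⟨-, h⟩, h'⟩ | ⟨⟨-, h⟩ | ⟨h, -⟩, h'⟩)
      · exact h
      · omega
      · omega
      · exact h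
    · intro h; rcases le_or_gt c c₀ with h' | h' <;> tauto

theorem card_splice (c₀ : ℤ) (p p' : MarkedPath) :
    (splice c₀ p p').2.card = (p.2.filter (· ≤ c₀)).card + (p'.2.filter (c₀ < ·)).card := by
  rw [splice, Finset.card_union_of_disjoint]
  rw [Finset.disjoint_left]
  intro c h h'
  rw [Finset.mem_filter] at h h'
  omega

theorem splice_mem {lam : YoungDiagram} {s t s' t' : Cell} {p p' : MarkedPath} {c₀ : ℤ}
    (hp : p ∈ markedPaths lam s t) (hp' : p' ∈ markedPaths lam s' t')
    (h1 : content s ≤ c₀) (h2 : c₀ ≤ content t) (h1' : content s' ≤ c₀) (h2' : c₀ ≤ content t')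
    (h3 : c₀ ∉ p.2) (h4 : p.1 c₀ = p'.1 c₀) :
    splice c₀ p p' ∈ markedPaths lam s t' := by
  rw [mem_markedPaths] at *
  obtain ⟨hp, hM⟩ := hp
  obtain ⟨hp', hM'⟩ := hp'
  have eL : ∀ c, c ≤ c₀ → (splice c₀ p p').1 c = p.1 c := fun c hc => if_pos hc
  have eR : ∀ c, c₀ ≤ c → (splice c₀ p p').1 c = p'.1 c := fun c hc => by
    rcases hc.eq_or_lt with rfl | hc
    · rw [eL _ le_rfl, h4]
    · exact if_neg (by omega)
  refine ⟨⟨⟨by omega, ?_, ?_, ?_, ?_⟩, ?_⟩, ?_⟩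
  · rw [eL _ h1, hp.start]
  · rw [eR _ h2', hp'.finish]
  · rintro c (hc | hc)
    · rw [eL _ (by omega), hp.out c (Or.inl hc)]
    · rw [eR _ (by omega), hp'.out c (Or.inr hc)]
  · intro c hc hc'
    rcases lt_or_ge c c₀ with h | h
    · rw [eL _ (by omega), eL _ (by omega)]; exact hp.step c hc (by omega)
    · rw [eR _ (by omega), eR _ (by omega)]; exact hp'.step c (by omega) hc'
  · intro c hc hc'
    rcases le_or_gt c c₀ with h | h
    · rw [eL _ h]; exact hp.mem c hc (by omega)
    · rw [eR _ h.le]; exact hp'.mem c (by omega) hc'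
  · intro c hc
    rw [mem_valleySet]
    rcases mem_splice.1 hc with ⟨hc, hcc⟩ | ⟨hc, hcc⟩
    · have hne : c ≠ c₀ := fun h => h3 (h ▸ hc)
      obtain ⟨v1, v2, v3, v4⟩ := mem_valleySet.1 (hM hc)
      refine ⟨v1, by omega, ?_, ?_⟩
      · rw [eL _ (by omega), eL _ (by omega), v3]
      · rw [eL _ (by omega), eL _ (by omega), v4]
    · obtain ⟨v1, v2, v3, v4⟩ := mem_valleySet.1 (hM' hc)
      refine ⟨by omega, v2, ?_, ?_⟩
      · rw [eR _ (by omega), eR _ (by omega), v3]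
      · rw [eR _ (by omega), eR _ (by omega), v4]

section LGV

variable {lam : YoungDiagram} {ι : Type*} {s t : ι → Cell}

/-- A permutation `σ` and a family of marked paths from `s i` to `t (σ i)`. -/
abbrev PathFamily (ι : Type*) : Type _ := (_ : Equiv.Perm ι) × (ι → MarkedPath)

variable (s t) in
open Classical in
/-- The row of the vertex of content `c` of the `i`-th path, if there is such a vertex. -/
noncomputable def vertexRow (x : PathFamily ι) (i : ι) (c : ℤ) : Option ℤ :=
  if content (s i) ≤ c ∧ c ≤ content (t (x.1 i)) ∧ c ∉ (x.2 i).2 then some ((x.2 i).1 c) else none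

theorem vertexRow_eq_some {x : PathFamily ι} {i : ι} {c r : ℤ} :
    vertexRow s t x i c = some r ↔ content (s i) ≤ c ∧ c ≤ content (t (x.1 i)) ∧ c ∉ (x.2 i).2 ∧
      (x.2 i).1 c = r := by
  rw [vertexRow]; split_ifs with h
  · rw [Option.some.injEq]; tauto
  · simp only [false_iff]; tauto

variable (s t) in
/-- The `i`-th and the `j`-th path have a common vertex of content `c`. -/
def Meet (x : PathFamily ι) (c : ℤ) (i j : ι) : Prop :=
  i ≠ j ∧ ∃ r, vertexRow s t x i c = some r ∧ vertexRow s t x j c = some r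

variable (s t) in
/-- Two paths meet at `p`, and there is no common vertex of smaller content. -/
def IsFirstMeet (x : PathFamily ι) (p : ℤ × ι × ι) : Prop :=
  Meet s t x p.1 p.2.1 p.2.2 ∧ ∀ c i j, Meet s t x c i j → p.1 ≤ c

theorem Meet.spec {x : PathFamily ι} {c : ℤ} {i j : ι} (h : Meet s t x c i j) :
    i ≠ j ∧ content (s i) ≤ c ∧ c ≤ content (t (x.1 i)) ∧ c ∉ (x.2 i).2 ∧ content (s j) ≤ c ∧
      c ≤ content (t (x.1 j)) ∧ c ∉ (x.2 j).2 ∧ (x.2 i).1 c = (x.2 j).1 c := by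
  obtain ⟨hne, r, h1, h2⟩ := h
  rw [vertexRow_eq_some] at h1 h2
  exact ⟨hne, h1.1, h1.2.1, h1.2.2.1, h2.1, h2.2.1, h2.2.2.1, h1.2.2.2.trans h2.2.2.2.symm⟩

theorem exists_isFirstMeet [Finite ι] (x : PathFamily ι) (h : ∃ c i j, Meet s t x c i j) :
    ∃ p, IsFirstMeet s t x p := by
  have hb : ∃ m : ℤ, ∀ c, (∃ i j, Meet s t x c i j) → m ≤ c := by
    obtain ⟨m, hm⟩ := (Set.finite_range fun i => content (s i)).bddBelow
    refine ⟨m, fun c => ?_⟩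
    rintro ⟨i, j, -, r, hr, -⟩
    exact (hm ⟨i, rfl⟩).trans (vertexRow_eq_some.1 hr).1
  obtain ⟨c, ⟨i, j, hij⟩, hmin⟩ :=
    Int.exists_least_of_bdd (P := fun c => ∃ i j, Meet s t x c i j) hb h
  exact ⟨(c, i, j), hij, fun c' i' j' h' => hmin c' ⟨i', j', h'⟩⟩

variable [DecidableEq ι]

/-- Exchange of the tails of the `i`-th and the `j`-th path after content `c`. -/
def swapTails (x : PathFamily ι) (p : ℤ × ι × ι) : PathFamily ι :=
  ⟨x.1 * Equiv.swap p.2.1 p.2.2, fun m =>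
    splice p.1 (x.2 m) (x.2 (Equiv.swap p.2.1 p.2.2 m))⟩

theorem swapTails_swapTails (x : PathFamily ι) (p : ℤ × ι × ι) :
    swapTails (swapTails x p) p = x := by
  refine Sigma.ext ?_ (heq_of_eq ?_)
  · simp [swapTails, mul_assoc]
  · funext m
    simp only [swapTails, Equiv.swap_apply_self]
    exact splice_splice _ _ _

/-- The exchange of tails does not change the vertices up to the content where it takes place. -/
theorem vertexRow_swapTails {x : PathFamily ι} {p : ℤ × ι × ι} (hp : Meet s t x p.1 p.2.1 p.2.2)
    (m : ι) {c : ℤ} (hc : c ≤ p.1) :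
    vertexRow s t (swapTails x p) m c = vertexRow s t x m c := by
  obtain ⟨c₀, i, j⟩ := p
  obtain ⟨hne, h1, h2, h3, h4, h5, h6, h7⟩ := hp.spec
  dsimp only at *
  ext r
  rw [vertexRow_eq_some, vertexRow_eq_some]
  have e1 : c ∈ (splice c₀ (x.2 m) (x.2 (Equiv.swap i j m))).2 ↔ c ∈ (x.2 m).2 := by
    rw [mem_splice]; constructor
    · rintro (h | h)
      · exact h.1
      · omega
    · exact fun h => Or.inl ⟨h, hc⟩
  have e2 : (splice c₀ (x.2 m) (x.2 (Equiv.swap i j m))).1 c = (x.2 m).1 c := if_pos hc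
  have e3 : c ≤ content (t (x.1 (Equiv.swap i j m))) ↔ c ≤ content (t (x.1 m)) := by
    rcases eq_or_ne m i with rfl | hi
    · rw [Equiv.swap_apply_left]; constructor <;> intro <;> omega
    · rcases eq_or_ne m j with rfl | hj
      · rw [Equiv.swap_apply_right]; constructor <;> intro <;> omega
      · rw [Equiv.swap_apply_of_ne_of_ne hi hj]
  simp only [swapTails, e1, e2, Equiv.Perm.mul_apply, e3]

/-- The first meeting points are not affected by the exchange of tails at one of them, which makes
the exchange an involution. -/
theorem isFirstMeet_swapTails {x : PathFamily ι} {p : ℤ × ι × ι} (hp : IsFirstMeet s t x p) :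
    IsFirstMeet s t (swapTails x p) = IsFirstMeet s t x := by
  have hM : ∀ c ≤ p.1, ∀ i j, Meet s t (swapTails x p) c i j ↔ Meet s t x c i j := by
    intro c hc i j
    rw [Meet, Meet, vertexRow_swapTails hp.1 i hc, vertexRow_swapTails hp.1 j hc]
  funext p'
  refine propext ⟨fun h => ?_, fun h => ?_⟩
  · have hle : p'.1 ≤ p.1 := h.2 _ _ _ ((hM _ le_rfl _ _).2 hp.1)
    have h1 := (hM _ hle _ _).1 h.1
    exact ⟨h1, fun c i j hc => hle.trans (hp.2 _ _ _ hc)⟩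
  · have hle : p'.1 ≤ p.1 := h.2 _ _ _ hp.1
    refine ⟨(hM _ hle _ _).2 h.1, fun c i j hc => ?_⟩
    by_contra hlt
    exact hlt (h.2 _ _ _ ((hM c (by omega) i j).1 hc))

variable [Fintype ι]

variable (lam s t) in
/-- The permutations `σ` with families of marked paths from `s i` to `t (σ i)`. -/
noncomputable def pathFamilies : Finset (PathFamily ι) :=
  Finset.univ.sigma fun σ => Fintype.piFinset fun i => markedPaths lam (s i) (t (σ i))

theorem mem_pathFamilies {x : PathFamily ι} :
    x ∈ pathFamilies lam s t ↔ ∀ i, x.2 i ∈ markedPaths lam (s i) (t (x.1 i)) := by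
  simp [pathFamilies]

theorem swapTails_mem {x : PathFamily ι} (hx : x ∈ pathFamilies lam s t) {p : ℤ × ι × ι}
    (hp : Meet s t x p.1 p.2.1 p.2.2) : swapTails x p ∈ pathFamilies lam s t := by
  obtain ⟨c, i, j⟩ := p
  obtain ⟨hne, h1, h2, h3, h4, h5, h6, h7⟩ := hp.spec
  rw [mem_pathFamilies] at *
  intro m
  dsimp only [swapTails, Equiv.Perm.mul_apply] at *
  rcases eq_or_ne m i with rfl | hi
  · rw [Equiv.swap_apply_left]
    exact splice_mem (hx m) (hx j) h1 h2 h4 h5 h3 h7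
  · rcases eq_or_ne m j with rfl | hj
    · rw [Equiv.swap_apply_right]
      exact splice_mem (hx m) (hx i) h4 h5 h1 h2 h6 h7.symm
    · rw [Equiv.swap_apply_of_ne_of_ne hi hj, splice_self]
      exact hx m

theorem prod_swapTails {K : Type*} [CommRing K] (w : K) (x : PathFamily ι) (p : ℤ × ι × ι) :
    ∏ m, w ^ ((swapTails x p).2 m).2.card = ∏ m, w ^ (x.2 m).2.card := by
  have h1 : ∀ m, w ^ ((swapTails x p).2 m).2.card = w ^ ((x.2 m).2.filter (· ≤ p.1)).card *
      w ^ ((x.2 (Equiv.swap p.2.1 p.2.2 m)).2.filter (p.1 < ·)).card := by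
    intro m
    rw [← pow_add, ← card_splice]; rfl
  have h2 : ∀ m, w ^ (x.2 m).2.card = w ^ ((x.2 m).2.filter (· ≤ p.1)).card *
      w ^ ((x.2 m).2.filter (p.1 < ·)).card := by
    intro m
    rw [← pow_add, ← card_splice, splice_self]
  simp_rw [h1, h2, Finset.prod_mul_distrib]
  rw [Equiv.prod_comp (Equiv.swap p.2.1 p.2.2)
    (fun m => w ^ ((x.2 m).2.filter (p.1 < ·)).card)]

open Classical in
/-- **Lindström–Gessel–Viennot lemma** for marked paths: families with a common vertex cancel in
pairs by exchanging the tails of two paths at a common vertex of least content. -/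
theorem det_valleyGF_eq_sum_pathFamilies {K : Type*} [Field K] (q : K) :
    Matrix.det (Matrix.of fun i j : ι => valleyGF lam (s i) (t j) q) =
      ∑ x ∈ (pathFamilies lam s t).filter (fun x => ¬ ∃ c i j, Meet s t x c i j),
        ((Equiv.Perm.sign x.1 : ℤ) : K) * ∏ i, (q - 1) ^ (x.2 i).2.card := by
  set f : PathFamily ι → K := fun x =>
    ((Equiv.Perm.sign x.1 : ℤ) : K) * ∏ i, (q - 1) ^ (x.2 i).2.card with hf
  have h1 : Matrix.det (Matrix.of fun i j : ι => valleyGF lam (s i) (t j) q) =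
      ∑ x ∈ pathFamilies lam s t, f x := by
    rw [← Matrix.det_transpose, Matrix.det_apply', pathFamilies, Finset.sum_sigma]
    refine Finset.sum_congr rfl fun σ _ => ?_
    simp only [Matrix.transpose_apply, Matrix.of_apply, valleyGF_eq_sum_markedPaths,
      Finset.prod_univ_sum, Finset.mul_sum, hf]
  rw [h1, ← Finset.sum_filter_add_sum_filter_not _ (fun x => ∃ c i j, Meet s t x c i j)]
  rw [Finset.sum_involution (s := (pathFamilies lam s t).filter _)
    (fun x hx => swapTails x (exists_isFirstMeet x (Finset.mem_filter.1 hx).2).choose), zero_add]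
  · intro x hx
    have hp := (exists_isFirstMeet x (Finset.mem_filter.1 hx).2).choose_spec
    set p := (exists_isFirstMeet x (Finset.mem_filter.1 hx).2).choose
    simp only [hf, prod_swapTails]
    rw [← add_mul]
    simp [swapTails, Equiv.Perm.sign_mul, Equiv.Perm.sign_swap hp.1.1]
  · intro x hx _ heq
    have hp := (exists_isFirstMeet x (Finset.mem_filter.1 hx).2).choose_spec
    set p := (exists_isFirstMeet x (Finset.mem_filter.1 hx).2).choose
    have h2 : x.1 * Equiv.swap p.2.1 p.2.2 = x.1 := congrArg Sigma.fst heq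
    rw [mul_eq_left, Equiv.swap_eq_one_iff] at h2
    exact hp.1.1 h2
  · intro x hx
    have hp := (exists_isFirstMeet x (Finset.mem_filter.1 hx).2).choose_spec
    set p := (exists_isFirstMeet x (Finset.mem_filter.1 hx).2).choose
    refine Finset.mem_filter.2
      ⟨swapTails_mem (Finset.mem_filter.1 hx).1 hp.1, p.1, p.2.1, p.2.2, ?_⟩
    have := isFirstMeet_swapTails hp
    rw [← this] at hp
    exact hp.1
  · intro x hx
    have hp := (exists_isFirstMeet x (Finset.mem_filter.1 hx).2).choose_spec
    have h2 := isFirstMeet_swapTails hp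
    have key : ∀ (P Q : ℤ × ι × ι → Prop) (hP : ∃ p, P p) (hQ : ∃ p, Q p), P = Q →
        hP.choose = hQ.choose := by
      rintro P Q hP hQ rfl; rfl
    rw [key _ _ _ (exists_isFirstMeet x (Finset.mem_filter.1 hx).2) h2, swapTails_swapTails]

end LGV

section Planar

variable {lam : YoungDiagram} {ι : Type*} {s t : ι → Cell} {L : ι → ℤ → ℤ}

theorem vertexDisjoint_of_not_meet {x : PathFamily ι} (hx : ¬ ∃ c i j, Meet s t x c i j) {i j : ι}
    (hij : i ≠ j) :
    VertexDisjoint (content (s i)) (content (t (x.1 i))) (x.2 i).1 (x.2 i).2 (content (s j))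
      (content (t (x.1 j))) (x.2 j).1 (x.2 j).2 := by
  intro c h1 h2 h3 h4
  by_contra! H
  exact hx ⟨c, i, j, hij, (x.2 i).1 c, vertexRow_eq_some.2 ⟨h1, h2, H.1, rfl⟩,
    vertexRow_eq_some.2 ⟨h3, h4, H.2.1, H.2.2.symm⟩⟩

variable [Fintype ι] [DecidableEq ι]

/-- In a vertex-disjoint family the `i`-th path ends at `t i`: the content intervals form a
noncrossing matching of the starting points with the end points, and there is only one. -/
theorem perm_eq_one (hL : IsPathSystem lam L s t) (σ : Equiv.Perm ι) (E : ι → MarkedPath)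
    (hE : ∀ i, IsPath lam (s i) (t (σ i)) (E i).1 ∧
      (E i).2 ⊆ valleySet (content (s i)) (content (t (σ i))) (E i).1)
    (hM : ∀ i j, i ≠ j → VertexDisjoint (content (s i)) (content (t (σ i))) (E i).1 (E i).2
      (content (s j)) (content (t (σ j))) (E j).1 (E j).2) : σ = 1 := by
  have hnest : ∀ i j, i ≠ j → content (s i) ≤ content (s j) →
      content (s j) ≤ content (t (σ i)) → content (s i) < content (s j) ∧
        content (t (σ j)) < content (t (σ i)) := fun i j hij h1 h2 =>
    (hM i j hij).nested (hE i).1 (hE j).1 (hE i).2 (hE j).2 (hL.south i)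
      (hL.south j) (hL.east _) h1 h2
  by_contra hne
  obtain ⟨i₀, hi₀⟩ : ∃ i, σ i ≠ i := by
    by_contra! h
    exact hne (Equiv.ext h)
  obtain ⟨i, hi, hmin⟩ := (Finset.univ.filter fun i => σ i ≠ i).exists_min_image
    (fun i => content (t i) - content (s i)) ⟨i₀, by simpa using hi₀⟩
  replace hi : σ i ≠ i := by simpa using hi
  have hmin' : ∀ j, Nested s t j i → σ j = j := by
    intro j hj
    by_contra h
    have := hmin j (by simpa using h)
    have := hj.1; have := hj.2
    omega
  have hle := hL.le i
  have hpi := (hE i).1.le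
  rcases lt_trichotomy (content (t i)) (content (t (σ i))) with h | h | h
  · obtain ⟨i', hi'⟩ := σ.surjective i
    have hne' : i' ≠ i := by rintro rfl; exact hi hi'
    have hpi' := (hE i').1.le
    rw [hi'] at hpi'
    have hlt : content (s i) < content (s i') := by
      rcases le_or_gt (content (s i)) (content (s i')) with h1 | h1
      · exact (hnest i i' hne'.symm h1 (by omega)).1
      · have := (hnest i' i hne' h1.le (by rw [hi']; exact hle)).2
        rw [hi'] at this; omega
    rcases hL.nested_of_common hne' le_rfl (hL.le i') hlt.le hpi' with h1 | h1
    · exact hne' ((hmin' i' h1).symm.trans hi')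
    · have := h1.1; omega
  · rcases hL.nested_of_common hi (hL.le _) le_rfl (by rw [← h]; exact hle) h.ge with h1 | h1
    · have := h1.2; omega
    · have := h1.2; omega
  · rcases hL.nested_of_common hi (hL.le _) le_rfl hpi h.le with h1 | h1
    · exact hi (σ.injective (hmin' _ h1))
    · have := h1.2; omega

open Classical in
/-- The determinant counts families of marked paths from `s i` to `t i` without common vertices. -/
theorem det_valleyGF_eq_sum_vertexDisjoint (hL : IsPathSystem lam L s t) {K : Type*} [Field K]
    (q : K) :
    Matrix.det (Matrix.of fun i j : ι => valleyGF lam (s i) (t j) q) =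
      ∑ E ∈ (Fintype.piFinset fun i => markedPaths lam (s i) (t i)).filter (fun E =>
        ∀ i j, i ≠ j → VertexDisjoint (content (s i)) (content (t i)) (E i).1 (E i).2
          (content (s j)) (content (t j)) (E j).1 (E j).2),
        ∏ i, (q - 1) ^ (E i).2.card := by
  rw [det_valleyGF_eq_sum_pathFamilies]
  have hone : ∀ x : PathFamily ι, x ∈ pathFamilies lam s t →
      (¬ ∃ c i j, Meet s t x c i j) → x.1 = 1 := fun x h1 h2 =>
    perm_eq_one hL x.1 x.2 (fun i => mem_markedPaths.1 (mem_pathFamilies.1 h1 i))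
      fun i j hij => vertexDisjoint_of_not_meet h2 hij
  rw [Finset.sum_filter, pathFamilies, Finset.sum_sigma, Finset.sum_eq_single 1]
  · rw [Finset.sum_filter]
    refine Finset.sum_congr rfl fun E hE => ?_
    rw [Equiv.Perm.sign_one, Units.val_one, Int.cast_one, one_mul]
    refine if_congr ⟨fun h i j hij => vertexDisjoint_of_not_meet h hij, ?_⟩ rfl rfl
    rintro h ⟨c, i, j, hm⟩
    obtain ⟨hne, h1, h2, h3, h4, h5, h6, h7⟩ := hm.spec
    rcases h i j hne c h1 h2 h4 h5 with h | h | h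
    · exact h3 h
    · exact h6 h
    · exact h h7
  · intro σ _ hσ
    refine Finset.sum_eq_zero fun E hE => if_neg fun h => hσ ?_
    exact hone ⟨σ, E⟩ (Finset.mem_sigma.2 ⟨Finset.mem_univ _, hE⟩) h
  · intro h; exact absurd (Finset.mem_univ _) h

end Planar

/-! ### Families of paths with weighted contacts -/

/-- `j` covers `i`: the content interval of `j` is a minimal one strictly containing that of `i`. -/
def Covers {ι : Type*} (s t : ι → Cell) (i j : ι) : Prop :=
  Nested s t i j ∧ ∀ l, ¬ (Nested s t i l ∧ Nested s t l j)

/-- The path `h` on `[a', b']` touches the path `g` on `[a, b]` from above at content `c`: a valley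
of `h` sits on a peak or an end of `g`. -/
def Touches (a b : ℤ) (g : ℤ → ℤ) (a' b' : ℤ) (h : ℤ → ℤ) (c : ℤ) : Prop :=
  h c = g c ∧ PeakLike a b g c ∧ ValleyAt a' b' h c

open Classical in
/-- The weight of the relative position of a path `g` on `[a, b]` and a path `h` on `[a', b']` at
content `c`: it is `1` if `h` is strictly above `g`, it is `w` if `h` touches `g` from above, and
all other positions are forbidden. -/
noncomputable def contactWeight {K : Type*} [Field K] (w : K) (a b : ℤ) (g : ℤ → ℤ) (a' b' : ℤ)
    (h : ℤ → ℤ) (c : ℤ) : K :=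
  if h c < g c then 1 else if Touches a b g a' b' h c then w else 0

section Laminar

variable {lam : YoungDiagram} {ι : Type*} {L : ι → ℤ → ℤ} {s t : ι → Cell}

theorem Nested.mem {i j : ι} (h : Nested s t i j) {c : ℤ} (h1 : content (s i) ≤ c)
    (h2 : c ≤ content (t i)) : content (s j) < c ∧ c < content (t j) :=
  ⟨h.1.trans_le h1, h2.trans_lt h.2⟩

/-- A nested pair of intervals is refined by a covering pair with the same upper element. -/
theorem Nested.exists_covers [Finite ι] {i j : ι} (h : Nested s t i j) :
    ∃ l, Covers s t l j ∧ (l = i ∨ Nested s t i l) := by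
  classical
  cases nonempty_fintype ι
  obtain ⟨l, hl, hmax⟩ := (Finset.univ.filter fun l => Nested s t l j ∧
    (l = i ∨ Nested s t i l)).exists_max_image (fun l => content (t l) - content (s l))
    ⟨i, by simp [h]⟩
  simp only [Finset.mem_filter, Finset.mem_univ, true_and] at hl hmax
  refine ⟨l, ⟨hl.1, fun m hm => ?_⟩, hl.2⟩
  have := hmax m ⟨hm.2, Or.inr (by rcases hl.2 with rfl | h1; exacts [hm.1, h1.trans hm.1])⟩
  have := hm.1.1; have := hm.1.2
  omega

/-- The intervals covered by the same interval are disjoint. -/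
theorem IsPathSystem.covers_left_unique (hL : IsPathSystem lam L s t) {i i' j : ι}
    (h : Covers s t i j) (h' : Covers s t i' j) {c : ℤ} (h1 : content (s i) ≤ c)
    (h2 : c ≤ content (t i)) (h3 : content (s i') ≤ c) (h4 : c ≤ content (t i')) : i = i' := by
  by_contra hne
  rcases hL.nested_of_common hne h1 h2 h3 h4 with h5 | h5
  · exact h.2 _ ⟨h5, h'.1⟩
  · exact h'.2 _ ⟨h5, h.1⟩

/-- Every interval is covered by at most one interval, so that the covering relation is a forest. -/
theorem IsPathSystem.covers_right_unique (hL : IsPathSystem lam L s t) {i j j' : ι}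
    (h : Covers s t i j) (h' : Covers s t i j') : j = j' := by
  by_contra hne
  have e := hL.le i
  have h1 := h.1.1; have h2 := h.1.2; have h3 := h'.1.1; have h4 := h'.1.2
  rcases hL.nested_of_common hne h1.le (by omega) h3.le (by omega) with h5 | h5
  · exact h'.2 _ ⟨h.1, h5⟩
  · exact h.2 _ ⟨h'.1, h5⟩

end Laminar

open Classical in
/-- Conditions `A i c` that exclude each other for different `i` contribute one factor. -/
theorem prod_prod_ite_of_unique {K ι κ : Type*} [CommMonoid K] (X : Finset ι) (I : Finset κ)
    (A : ι → κ → Prop) [∀ i c, Decidable (A i c)] (u : K)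
    (hA : ∀ c ∈ I, ∀ i ∈ X, ∀ i' ∈ X, A i c → A i' c → i = i') :
    ∏ i ∈ X, ∏ c ∈ I, (if A i c then u else 1) =
      ∏ c ∈ I, if ∃ i ∈ X, A i c then u else 1 := by
  rw [Finset.prod_comm]
  refine Finset.prod_congr rfl fun c hc => ?_
  split_ifs with h
  · obtain ⟨i, hi, hic⟩ := h
    rw [Finset.prod_eq_single i, if_pos hic]
    · intro i' hi' hne
      exact if_neg fun h => hne (hA c hc _ hi' _ hi h hic)
    · exact fun h => absurd hi h
  · push Not at h
    exact Finset.prod_eq_one fun i hi => if_neg (h i hi)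

section Contacts

variable {lam : YoungDiagram} {ι : Type*} {L : ι → ℤ → ℤ} {s t : ι → Cell} {K : Type*} [Field K]

variable (s t) in
/-- The path `h j` meets one of the paths `h i` covered by it at content `c`. -/
def ChildTouch (h : ι → ℤ → ℤ) (j : ι) (c : ℤ) : Prop :=
  ∃ i, Covers s t i j ∧ content (s i) ≤ c ∧ c ≤ content (t i) ∧ h j c = h i c

variable (s t) in
/-- The path `h j` meets a path covering it at content `c`. -/
def ParentTouch (h : ι → ℤ → ℤ) (j : ι) (c : ℤ) : Prop :=
  ∃ p, Covers s t j p ∧ h p c = h j c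

variable (s t) in
/-- The path `h j` lies above `h i` and is in contact with it only by touching. -/
def WeaklyAbove (h : ι → ℤ → ℤ) (i j : ι) : Prop :=
  ∀ c, content (s i) ≤ c → c ≤ content (t i) → h j c < h i c ∨
    Touches (content (s i)) (content (t i)) (h i) (content (s j)) (content (t j)) (h j) c

variable (s t) in
/-- The product of the contact weights of the paths `h i` and `h j`. -/
noncomputable def edgeWeight (w : K) (h : ι → ℤ → ℤ) (i j : ι) : K :=
  ∏ c ∈ Finset.Icc (content (s i)) (content (t i)),
    contactWeight w (content (s i)) (content (t i)) (h i) (content (s j)) (content (t j)) (h j) c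

theorem edgeWeight_eq_zero {w : K} {h : ι → ℤ → ℤ} {i j : ι} (H : ¬ WeaklyAbove s t h i j) :
    edgeWeight s t w h i j = 0 := by
  simp only [WeaklyAbove, not_forall, not_or] at H
  obtain ⟨c, h1, h2, h3, h4⟩ := H
  refine Finset.prod_eq_zero (Finset.mem_Icc.2 ⟨h1, h2⟩) ?_
  rw [contactWeight, if_neg h3, if_neg h4]

theorem edgeWeight_zero_eq_zero {h : ι → ℤ → ℤ} {i j : ι} {c : ℤ} (h1 : content (s i) ≤ c)
    (h2 : c ≤ content (t i)) (h3 : h i c ≤ h j c) : edgeWeight s t (0 : K) h i j = 0 := by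
  refine Finset.prod_eq_zero (Finset.mem_Icc.2 ⟨h1, h2⟩) ?_
  rw [contactWeight, if_neg h3.not_gt, ite_self]

theorem edgeWeight_eq_one {w : K} {h : ι → ℤ → ℤ} {i j : ι}
    (H : ∀ c, content (s i) ≤ c → c ≤ content (t i) → h j c < h i c) :
    edgeWeight s t w h i j = 1 := by
  refine Finset.prod_eq_one fun c hc => ?_
  rw [Finset.mem_Icc] at hc
  rw [contactWeight, if_pos (H c hc.1 hc.2)]

open Classical in
theorem edgeWeight_of_weaklyAbove {w : K} {h : ι → ℤ → ℤ} {i j : ι} (H : WeaklyAbove s t h i j) :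
    edgeWeight s t w h i j =
      ∏ c ∈ Finset.Icc (content (s i)) (content (t i)), if h j c = h i c then w else 1 := by
  refine Finset.prod_congr rfl fun c hc => ?_
  rw [Finset.mem_Icc] at hc
  rcases H c hc.1 hc.2 with h1 | h1
  · rw [contactWeight, if_pos h1, if_neg h1.ne]
  · rw [contactWeight, if_neg h1.1.ge.not_gt, if_pos h1, if_pos h1.1]

variable [Fintype ι]

open Classical in
theorem prod_edgeWeight_children (hL : IsPathSystem lam L s t) (w : K) (h : ι → ℤ → ℤ) (j : ι)
    (H : ∀ i, Covers s t i j → WeaklyAbove s t h i j) :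
    ∏ i with Covers s t i j, edgeWeight s t w h i j =
      ∏ c ∈ Finset.Icc (content (s j)) (content (t j)), if ChildTouch s t h j c then w else 1 := by
  have h1 : ∀ i ∈ Finset.univ.filter (fun i => Covers s t i j), edgeWeight s t w h i j =
      ∏ c ∈ Finset.Icc (content (s j)) (content (t j)),
        if content (s i) ≤ c ∧ c ≤ content (t i) ∧ h j c = h i c then w else 1 := by
    intro i hi
    replace hi : Covers s t i j := by simpa using hi
    rw [edgeWeight_of_weaklyAbove (H i hi)]
    have hsub : Finset.Icc (content (s i)) (content (t i)) ⊆
        Finset.Icc (content (s j)) (content (t j)) := Finset.Icc_subset_Icc hi.1.1.le hi.1.2.le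
    rw [← Finset.prod_subset hsub]
    · refine Finset.prod_congr rfl fun c hc => ?_
      rw [Finset.mem_Icc] at hc
      simp [hc.1, hc.2]
    · intro c _ hc
      rw [Finset.mem_Icc] at hc
      exact if_neg fun h => hc ⟨h.1, h.2.1⟩
  rw [Finset.prod_congr rfl h1]
  refine (prod_prod_ite_of_unique _ _
    (fun i c => content (s i) ≤ c ∧ c ≤ content (t i) ∧ h j c = h i c) w ?_).trans ?_
  rotate_left
  · refine Finset.prod_congr rfl fun c _ => ?_
    exact if_congr (by simp [ChildTouch]) rfl rfl
  · intro c _ i hi i' hi' h2 h3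
    exact hL.covers_left_unique (by simpa using hi) (by simpa using hi') h2.1 h2.2.1 h3.1 h3.2.1

open Classical in
theorem prod_edgeWeight_parents (hL : IsPathSystem lam L s t) (w : K) (h : ι → ℤ → ℤ) (j : ι)
    (H : ∀ p, Covers s t j p → WeaklyAbove s t h j p) :
    ∏ p with Covers s t j p, edgeWeight s t w h j p =
      ∏ c ∈ Finset.Icc (content (s j)) (content (t j)),
        if ParentTouch s t h j c then w else 1 := by
  rw [Finset.prod_congr rfl fun p hp => edgeWeight_of_weaklyAbove (H p (by simpa using hp))]
  refine (prod_prod_ite_of_unique _ _ (fun p c => h p c = h j c) w ?_).trans ?_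
  rotate_left
  · refine Finset.prod_congr rfl fun c _ => ?_
    exact if_congr (by simp [ParentTouch]) rfl rfl
  · intro c _ p hp p' hp' _ _
    exact hL.covers_right_unique (by simpa using hp) (by simpa using hp')

end Contacts

section SystemSum

variable {lam : YoungDiagram} {ι : Type*} [Fintype ι] {L : ι → ℤ → ℤ}
  {s t : ι → Cell} {K : Type*} [Field K]

open Classical in
variable (lam s t) in
/-- The generating function of families of paths from `s i` to `t i` by valleys, where a contact of
a path `i` with the path `j` covering it has weight `w i j`. -/
noncomputable def systemSum [DecidableEq ι] (q : K) (w : ι → ι → K) : K :=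
  ∑ h ∈ Fintype.piFinset fun i => pathFns lam (s i) (t i),
    (∏ j, q ^ (valleySet (content (s j)) (content (t j)) (h j)).card) *
      ∏ j, ∏ i with Covers s t i j, edgeWeight s t (w i j) h i j

/-- In a family of paths that are weakly above the paths covered by them, nested paths meet only
at touching points of covering pairs. -/
theorem le_of_nested {h : ι → ℤ → ℤ} (H : ∀ i j, Covers s t i j → WeaklyAbove s t h i j) {i j : ι}
    (hij : Nested s t i j) {c : ℤ} (h1 : content (s i) ≤ c) (h2 : c ≤ content (t i)) :
    h j c ≤ h i c ∧ (h j c = h i c → Covers s t i j) := by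
  induction hn : (content (t j) - content (s j)).toNat using Nat.strong_induction_on
    generalizing j with
  | _ n ih =>
    subst hn
    obtain ⟨l, hl, rfl | hil⟩ := hij.exists_covers
    · refine ⟨?_, fun _ => hl⟩
      rcases H _ _ hl c h1 h2 with h3 | h3
      · exact h3.le
      · exact h3.1.le
    · have hlt := hl.1.1
      have hlt' := hl.1.2
      have hc := hil.mem h1 h2
      obtain ⟨k1, k2⟩ := ih _ (by omega) hil rfl
      have hlt : h j c < h i c := by
        rcases H _ _ hl c hc.1.le hc.2.le with h3 | h3
        · omega
        · refine lt_of_le_of_ne (h3.1.le.trans k1) fun he => ?_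
          have heq : h l c = h i c := by rw [← h3.1, he]
          rcases H _ _ (k2 heq) c h1 h2 with h4 | h4
          · omega
          · have e1 := h4.2.2.2.2
            have e2 := h3.2.1.2
            omega
      exact ⟨hlt.le, fun h => absurd h hlt.ne⟩

/-- A family of marked paths has no common vertices if and only if paths are weakly above the paths
covered by them and every contact is a skipped valley of the upper path. -/
theorem vertexDisjoint_iff (hL : IsPathSystem lam L s t) {h : ι → ℤ → ℤ} {M : ι → Finset ℤ}
    (hh : ∀ i, IsPath lam (s i) (t i) (h i))
    (hM : ∀ i, M i ⊆ valleySet (content (s i)) (content (t i)) (h i)) :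
    (∀ i j, i ≠ j → VertexDisjoint (content (s i)) (content (t i)) (h i) (M i)
        (content (s j)) (content (t j)) (h j) (M j)) ↔
      (∀ i j, Covers s t i j → WeaklyAbove s t h i j) ∧
        ∀ j c, ChildTouch s t h j c → c ∈ M j := by
  constructor
  · intro H
    have key : ∀ i j, Nested s t i j → ∀ c, content (s i) ≤ c → c ≤ content (t i) →
        h j c ≤ h i c ∧ (h j c = h i c → c ∈ M j ∧
          PeakLike (content (s i)) (content (t i)) (h i) c) := by
      intro i j hij c h1 h2
      have hne : j ≠ i := by rintro rfl; exact hij.irrefl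
      exact (H j i hne).weakly_below (hh j).toIsWalk (hh i).toIsWalk (hM j) (hM i) hij.1.le
        (hL.start_le hij (hh j) (hh i)) h1 (hij.mem h1 h2).2.le h2
    refine ⟨fun i j hij c h1 h2 => ?_, ?_⟩
    · obtain ⟨k1, k2⟩ := key i j hij.1 c h1 h2
      rcases k1.lt_or_eq with h3 | h3
      · exact Or.inl h3
      · exact Or.inr ⟨h3, (k2 h3).2, mem_valleySet.1 (hM j (k2 h3).1)⟩
    · rintro j c ⟨i, hij, h1, h2, h3⟩
      exact ((key i j hij.1 c h1 h2).2 h3).1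
  · rintro ⟨H1, H2⟩ i j hij c h1 h2 h3 h4
    by_cases he : h i c = h j c
    · rcases hL.nested_of_common hij h1 h2 h3 h4 with h5 | h5
      · exact Or.inr (Or.inl (H2 j c ⟨i, (le_of_nested H1 h5 h1 h2).2 he.symm, h1, h2, he.symm⟩))
      · exact Or.inl (H2 i c ⟨j, (le_of_nested H1 h5 h3 h4).2 he, h3, h4, he⟩)
    · exact Or.inr (Or.inr he)

open Classical in
/-- Summation over the marked subsets `M` of the set `V` of valleys that contain all contacts: a
valley without contact contributes `(q - 1) + 1 = q`, and one with a contact contributes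
`q - 1 = q (1 - q⁻¹)`. -/
theorem sum_powerset_subset (V : Finset ℤ) (T : ℤ → Prop) (q : K) (hq : q ≠ 0)
    (I : Finset ℤ) (hVI : V ⊆ I) (hT : ∀ c ∈ I, T c → c ∈ V) :
    ∑ M ∈ V.powerset, (if ∀ c ∈ I, T c → c ∈ M then (q - 1) ^ M.card else 0) =
      q ^ V.card * ∏ c ∈ I, if T c then 1 - q⁻¹ else 1 := by
  have h1 : ∀ M ∈ V.powerset, (if ∀ c ∈ I, T c → c ∈ M then (q - 1) ^ M.card else 0) =
      (∏ c ∈ M, (q - 1)) * ∏ c ∈ V \ M, if T c then 0 else 1 := by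
    intro M _
    rw [Finset.prod_const]
    split_ifs with h
    · rw [Finset.prod_eq_one, mul_one]
      intro c hc
      rw [Finset.mem_sdiff] at hc
      exact if_neg fun hT' => hc.2 (h c (hVI hc.1) hT')
    · push Not at h
      obtain ⟨c, hc, hT', hM'⟩ := h
      rw [Finset.prod_eq_zero (Finset.mem_sdiff.2 ⟨hT c hc hT', hM'⟩) (by simp [hT']), mul_zero]
  rw [Finset.sum_congr rfl h1, ← Finset.prod_add, ← Finset.prod_const,
    ← Finset.prod_subset hVI, ← Finset.prod_mul_distrib]
  · refine Finset.prod_congr rfl fun c _ => ?_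
    split_ifs
    · field_simp; ring
    · ring
  · intro c hc hcV
    exact if_neg fun h => hcV (hT c hc h)

open Classical in
/-- The determinant is the generating function of all weakly ordered families, with the same
weight `1 - q⁻¹` for all contacts. -/
theorem det_valleyGF_eq_systemSum [DecidableEq ι] (hL : IsPathSystem lam L s t) (q : K)
    (hq : q ≠ 0) :
    Matrix.det (Matrix.of fun i j : ι => valleyGF lam (s i) (t j) q) =
      systemSum lam s t q fun _ _ => 1 - q⁻¹ := by
  rw [det_valleyGF_eq_sum_vertexDisjoint hL, Finset.sum_filter, systemSum]
  have h1 : ∀ F : (ι → MarkedPath) → K,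
      ∑ E ∈ Fintype.piFinset fun i => markedPaths lam (s i) (t i), F E =
        ∑ h ∈ Fintype.piFinset fun i => pathFns lam (s i) (t i),
          ∑ M ∈ Fintype.piFinset fun i =>
            (valleySet (content (s i)) (content (t i)) (h i)).powerset, F fun i => ⟨h i, M i⟩ := by
    intro F
    rw [Finset.sum_sigma']
    refine Finset.sum_bij' (fun E _ => ⟨fun i => (E i).1, fun i => (E i).2⟩)
      (fun x _ => fun i => ⟨x.1 i, x.2 i⟩) ?_ ?_ ?_ ?_ ?_
    · intro E hE
      simp only [Fintype.mem_piFinset, markedPaths, Finset.mem_sigma] at hE ⊢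
      exact ⟨fun i => (hE i).1, fun i => (hE i).2⟩
    · intro x hx
      simp only [Fintype.mem_piFinset, markedPaths, Finset.mem_sigma] at hx ⊢
      exact fun i => ⟨hx.1 i, hx.2 i⟩
    · intro E _; rfl
    · intro x _; rfl
    · intro E _; rfl
  rw [h1]
  refine Finset.sum_congr rfl fun h hh => ?_
  have hh' : ∀ i, IsPath lam (s i) (t i) (h i) := fun i =>
    mem_pathFns.1 (Fintype.mem_piFinset.1 hh i)
  have h2 : ∀ M ∈ Fintype.piFinset fun i =>
      (valleySet (content (s i)) (content (t i)) (h i)).powerset,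
      (if ∀ i j, i ≠ j → VertexDisjoint (content (s i)) (content (t i)) (h i) (M i)
        (content (s j)) (content (t j)) (h j) (M j) then ∏ i, (q - 1) ^ (M i).card else 0) =
      if ∀ i j, Covers s t i j → WeaklyAbove s t h i j then
        ∏ j, (if ∀ c ∈ Finset.Icc (content (s j)) (content (t j)), ChildTouch s t h j c → c ∈ M j
          then (q - 1) ^ (M j).card else 0) else 0 := by
    intro M hM
    have hM' := fun i => Finset.mem_powerset.1 (Fintype.mem_piFinset.1 hM i)
    have e : ∀ j, (∀ c, ChildTouch s t h j c → c ∈ M j) ↔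
        ∀ c ∈ Finset.Icc (content (s j)) (content (t j)), ChildTouch s t h j c → c ∈ M j := by
      refine fun j => ⟨fun H c _ => H c, fun H c hc => H c ?_ hc⟩
      obtain ⟨i, hi, h3, h4, -⟩ := hc
      have := hi.1.mem h3 h4
      exact Finset.mem_Icc.2 ⟨this.1.le, this.2.le⟩
    have hvd := vertexDisjoint_iff hL hh' hM'
    rw [Finset.prod_ite_zero]
    by_cases HW : ∀ i j, Covers s t i j → WeaklyAbove s t h i j
    · rw [if_pos HW]
      by_cases HV : ∀ j c, ChildTouch s t h j c → c ∈ M j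
      · rw [if_pos (hvd.2 ⟨HW, HV⟩), if_pos fun j _ => (e j).1 (HV j)]
      · rw [if_neg fun k => HV (hvd.1 k).2,
          if_neg fun k => HV fun j => (e j).2 (k j (Finset.mem_univ j))]
    · rw [if_neg HW, if_neg fun k => HW (hvd.1 k).1]
  rw [Finset.sum_congr rfl h2]
  by_cases H : ∀ i j, Covers s t i j → WeaklyAbove s t h i j
  · simp only [if_pos H]
    rw [← Finset.prod_univ_sum (fun i => (valleySet (content (s i)) (content (t i)) (h i)).powerset)
      (fun j M => if ∀ c ∈ Finset.Icc (content (s j)) (content (t j)), ChildTouch s t h j c → c ∈ M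
          then (q - 1) ^ M.card else 0), ← Finset.prod_mul_distrib]
    refine Finset.prod_congr rfl fun j _ => ?_
    rw [prod_edgeWeight_children hL _ h j fun i => H i j]
    refine sum_powerset_subset _ _ q hq _ ?_ ?_
    · intro c hc
      have := mem_valleySet.1 hc
      exact Finset.mem_Icc.2 ⟨this.1.le, this.2.1.le⟩
    · rintro c - ⟨i, hi, h3, h4, h5⟩
      rw [mem_valleySet]
      rcases H i j hi c h3 h4 with h6 | h6
      · omega
      · exact h6.2.2
  · simp only [if_neg H, Finset.sum_const_zero]
    push Not at H
    obtain ⟨i, j, hij, hw⟩ := H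
    rw [Finset.prod_eq_zero (i := j) (f := fun j => ∏ i with Covers s t i j, _) (Finset.mem_univ j)
      (Finset.prod_eq_zero (i := i) (by simpa using hij) (edgeWeight_eq_zero hw)), mul_zero]

end SystemSum

/-! ### Moving the contacts of a path from below to above -/

/-- The path `h` from `s` to `t` starts with an up step, ends with a down step, and its peaks are
`lam`-high. -/
structure IsHighPath (lam : YoungDiagram) (s t : Cell) (h : ℤ → ℤ) : Prop where
  lt : content s < content t
  first : h (content s + 1) = h (content s) - 1
  last : h (content t - 1) = h (content t)
  high : ∀ c, PeakAt (content s) (content t) h c → OnDiag lam c (h c + 1)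

section Switch

variable {lam : YoungDiagram} {ι : Type*} {L : ι → ℤ → ℤ} {s t : ι → Cell} {h : ι → ℤ → ℤ} {j : ι}

variable (lam s t) in
/-- The positions allowed for the `j`-th path: on or above the paths covered by `j`, meeting them
only at peaks and ends, and on or below the paths covering `j`, meeting them only at valleys. -/
def Region (h : ι → ℤ → ℤ) (j : ι) (c r : ℤ) : Prop :=
  OnDiag lam c r ∧
    (∀ i, Covers s t i j → content (s i) ≤ c → c ≤ content (t i) →
      r < h i c ∨ (r = h i c ∧ PeakLike (content (s i)) (content (t i)) (h i) c)) ∧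
    ∀ p, Covers s t j p →
      h p c < r ∨ (h p c = r ∧ ValleyAt (content (s p)) (content (t p)) (h p) c)

theorem Region.convex {c r₁ r r₂ : ℤ} (h₁ : Region lam s t h j c r₁) (h₂ : Region lam s t h j c r₂)
    (h3 : r₁ ≤ r) (h4 : r ≤ r₂) : Region lam s t h j c r := by
  refine ⟨h₂.1.of_le ?_ ?_ h4 (by omega), fun i hi h5 h6 => ?_, fun p hp => ?_⟩
  · have := h₁.1.row_nonneg; omega
  · have := h₁.1.col_nonneg; omega
  · rcases h4.lt_or_eq with h4 | rfl
    · rcases h₂.2.1 i hi h5 h6 with h7 | h7 <;> left <;> omega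
    · exact h₂.2.1 i hi h5 h6
  · rcases h3.lt_or_eq with h3 | rfl
    · rcases h₁.2.2 p hp with h7 | h7 <;> left <;> omega
    · exact h₁.2.2 p hp

variable (hL : IsPathSystem lam L s t) (hh : ∀ i, IsPath lam (s i) (t i) (h i))
  (hR : ∀ c, content (s j) ≤ c → c ≤ content (t j) → Region lam s t h j c (h j c))

include hL hh hR

theorem ChildTouch.valleyAt {c : ℤ} (hc : ChildTouch s t h j c) :
    ValleyAt (content (s j)) (content (t j)) (h j) c := by
  obtain ⟨i, hi, h1, h2, h3⟩ := hc
  have hm := hi.1.mem h1 h2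
  have hR0 := (hR c (by omega) (by omega)).2.1 i hi h1 h2
  have hpk : PeakLike (content (s i)) (content (t i)) (h i) c := by
    rcases hR0 with h4 | h4
    · omega
    · exact h4.2
  refine ⟨hm.1, hm.2, ?_, ?_⟩
  · have st := (hh j).step (c - 1) (by omega) (by omega)
    rw [sub_add_cancel] at st
    by_contra hne
    have e : h j (c - 1) = h j c + 1 := by omega
    rcases eq_or_ne c (content (s i)) with rfl | hne'
    · have m := (hR _ (by omega) (by omega : content (s i) - 1 ≤ content (t j))).1
      rw [e, h3, (hh i).start] at m
      refine hL.south i (onDiag_content.1 ?_)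
      convert m using 1 <;> simp [content]
      ring
    · have e2 : h i (c - 1) = h i c + 1 := hpk.1.resolve_left hne'
      rcases (hR (c - 1) (by omega) (by omega)).2.1 i hi (by omega) (by omega) with h4 | h4
      · omega
      · have := h4.2.2
        rw [sub_add_cancel] at this
        omega
  · have st := (hh j).step c (by omega) (by omega)
    by_contra hne
    have e : h j (c + 1) = h j c := by omega
    rcases eq_or_ne c (content (t i)) with rfl | hne'
    · have m := (hR (content (t i) + 1) (by omega) (by omega)).1
      rw [e, h3, (hh i).finish] at m
      refine hL.east i (onDiag_content.1 ?_)
      convert m using 1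
      simp only [content]; push_cast; ring
    · have e2 : h i (c + 1) = h i c := hpk.2.resolve_left hne'
      rcases (hR (c + 1) (by omega) (by omega)).2.1 i hi (by omega) (by omega) with h4 | h4
      · omega
      · have := h4.2.1
        rw [add_sub_cancel_right] at this
        omega

omit hL hh in
theorem ParentTouch.spec {c : ℤ} (h1 : content (s j) ≤ c) (h2 : c ≤ content (t j))
    (hc : ParentTouch s t h j c) : ∃ p, Covers s t j p ∧ h p c = h j c ∧
      ValleyAt (content (s p)) (content (t p)) (h p) c := by
  obtain ⟨p, hp, he⟩ := hc
  refine ⟨p, hp, he, ?_⟩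
  rcases (hR c h1 h2).2.2 p hp with h3 | h3
  · omega
  · exact h3.2

omit hL hh in
theorem ParentTouch.not_valleyAt {c : ℤ} (hc : ParentTouch s t h j c) :
    ¬ ValleyAt (content (s j)) (content (t j)) (h j) c := by
  rintro ⟨v1, v2, v3, v4⟩
  obtain ⟨p, hp, he, w1, w2, w3, w4⟩ := hc.spec hR v1.le v2.le
  rcases (hR (c - 1) (by omega) (by omega)).2.2 p hp with h3 | h3
  · omega
  · have := h3.2.2.2.2
    rw [sub_add_cancel] at this
    omega

omit hL in
theorem ParentTouch.peakAt {c : ℤ} (h1 : content (s j) < c) (h2 : c < content (t j))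
    (hc : ParentTouch s t h j c) : PeakAt (content (s j)) (content (t j)) (h j) c := by
  obtain ⟨p, hp, he, w1, w2, w3, w4⟩ := hc.spec hR h1.le h2.le
  have s1 := (hh j).step (c - 1) (by omega) (by omega)
  have s2 := (hh j).step c (by omega) (by omega)
  rw [sub_add_cancel] at s1
  refine ⟨h1, h2, ?_, ?_⟩
  · rcases (hR (c - 1) (by omega) (by omega)).2.2 p hp with h3 | h3
    · omega
    · have := h3.2.2.2.2
      rw [sub_add_cancel] at this
      omega
  · rcases (hR (c + 1) (by omega) (by omega)).2.2 p hp with h3 | h3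
    · omega
    · have := h3.2.2.2.1
      rw [add_sub_cancel_right] at this
      omega

omit hL in
/-- If the path does not touch a covering path, then it can be raised at all its valleys. -/
theorem region_raise (hT : ∀ c, content (s j) ≤ c → c ≤ content (t j) → ¬ ParentTouch s t h j c)
    {c : ℤ} (hc : ValleyAt (content (s j)) (content (t j)) (h j) c) :
    Region lam s t h j c (h j c - 1) := by
  obtain ⟨v1, v2, v3, v4⟩ := hc
  obtain ⟨r1, r2, r3⟩ := hR c v1.le v2.le
  have hlt : ∀ p, Covers s t j p → ∀ d, content (s j) ≤ d → d ≤ content (t j) → h p d < h j d := by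
    intro p hp d h1 h2
    rcases (hR d h1 h2).2.2 p hp with h3 | h3
    · exact h3
    · exact absurd ⟨p, hp, h3.1⟩ (hT d h1 h2)
  have m1 := ((hh j).mem (c - 1) (by omega) (by omega)).col_nonneg
  have m2 := ((hh j).mem (c + 1) (by omega) (by omega)).row_nonneg
  refine ⟨r1.of_le (by omega) (by omega) (by omega) (by omega), fun i hi h1 h2 => ?_,
    fun p hp => ?_⟩
  · rcases r2 i hi h1 h2 with h3 | h3 <;> left <;> omega
  · have k0 := hlt p hp c v1.le v2.le
    have k1 := hlt p hp (c - 1) (by omega) (by omega)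
    have k2 := hlt p hp (c + 1) (by omega) (by omega)
    have n1 := hp.1.1; have n2 := hp.1.2
    rcases (show h p c ≤ h j c - 1 by omega).lt_or_eq with h3 | h3
    · exact Or.inl h3
    · have s1 := (hh p).step (c - 1) (by omega) (by omega)
      have s2 := (hh p).step c (by omega) (by omega)
      rw [sub_add_cancel] at s1
      exact Or.inr ⟨h3, by omega, by omega, by omega, by omega⟩

omit hL hh in
theorem lt_child (hT : ∀ c, ¬ ChildTouch s t h j c) {i : ι} (hi : Covers s t i j) {d : ℤ}
    (h1 : content (s i) ≤ d) (h2 : d ≤ content (t i)) : h j d < h i d := by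
  have := hi.1.mem h1 h2
  rcases (hR d (by omega) (by omega)).2.1 i hi h1 h2 with h3 | h3
  · exact h3
  · exact absurd ⟨i, hi, h1, h2, h3.1⟩ (hT d)

omit hh in
/-- Where the covered paths leave room below a cell of `L j`, the path `h j` is strictly above a
covered path. -/
theorem exists_child_of_lt [Finite ι] (hT : ∀ c, ¬ ChildTouch s t h j c) {d r : ℤ}
    (h1 : content (s j) ≤ d) (h2 : d ≤ content (t j)) (h3 : L j d < r) (h4 : OnDiag lam d r) :
    ∃ i, Covers s t i j ∧ content (s i) ≤ d ∧ d ≤ content (t i) ∧ h j d < h i d := by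
  obtain ⟨m, m1, m2, m3⟩ := hL.filled j d r h1 h2 h3 h4
  have hne : m ≠ j := by rintro rfl; omega
  have hm : Nested s t m j := by
    rcases hL.nested_of_common hne m1 m2 h1 h2 with h5 | h5
    · exact h5
    · have := hL.lt_of_nested h5 h1 h2; omega
  obtain ⟨l, hl, hml⟩ := hm.exists_covers
  have hl' : content (s l) ≤ d ∧ d ≤ content (t l) := by
    rcases hml with rfl | hml
    · exact ⟨m1, m2⟩
    · exact ⟨(hml.mem m1 m2).1.le, (hml.mem m1 m2).2.le⟩
  exact ⟨l, hl, hl'.1, hl'.2, lt_child hR hT hl hl'.1 hl'.2⟩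

variable [Finite ι] (hN : IsHighPath lam (s j) (t j) (L j))
include hN

/-- If `h j` is strictly above the covered paths, then its first step is an up step: otherwise it
would enter the starting cell of a covered path. -/
theorem first_step_up (hT : ∀ c, ¬ ChildTouch s t h j c) :
    h j (content (s j) + 1) = h j (content (s j)) - 1 := by
  have hlt := hN.lt
  rcases (hh j).step (content (s j)) le_rfl hlt with h1 | h1
  · exfalso
    have e0 : L j (content (s j)) = h j (content (s j)) := by rw [(hL.path j).start, (hh j).start]
    have e1 := hN.first
    have m := (hh j).mem (content (s j) + 1) (by omega) (by omega)
    obtain ⟨i, hi, i1, i2, i3⟩ := exists_child_of_lt hL hR hT (by omega) (by omega)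
      (by omega : L j (content (s j) + 1) < h j (content (s j) + 1)) m
    have hlt' := hi.1.1
    have e2 : content (s i) = content (s j) + 1 := by omega
    rw [← e2, (hh i).start] at i3
    rw [← e2] at h1
    have m' := (hL.path j).mem (content (s j)) le_rfl hlt.le
    -- The cell below the first cell of `h j` would be in `lam`.
    refine hL.south j (onDiag_content.1 ?_)
    have m2 := (hh i).mem (content (s i)) le_rfl (hL.le i)
    rw [(hh i).start] at m2
    rw [h1, (hh j).start] at i3
    have := m'.col_nonneg
    rw [(hL.path j).start] at this
    refine m2.of_le (by positivity) ?_ ?_ ?_ <;> simp only [content] at * <;> push_cast <;> omega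
  · exact h1

/-- If `h j` is strictly above the covered paths, then its last step is a down step: otherwise it
would enter the last cell of a covered path. -/
theorem last_step_down (hT : ∀ c, ¬ ChildTouch s t h j c) :
    h j (content (t j) - 1) = h j (content (t j)) := by
  have hlt := hN.lt
  have st := (hh j).step (content (t j) - 1) (by omega) (by omega)
  rw [sub_add_cancel] at st
  rcases st with h1 | h1
  · exact h1.symm
  · exfalso
    have e0 : L j (content (t j)) = h j (content (t j)) := by rw [(hL.path j).finish, (hh j).finish]
    have e1 := hN.last
    have m := (hh j).mem (content (t j) - 1) (by omega) (by omega)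
    obtain ⟨i, hi, i1, i2, i3⟩ := exists_child_of_lt hL hR hT (by omega) (by omega)
      (by omega : L j (content (t j) - 1) < h j (content (t j) - 1)) m
    have hlt' := hi.1.2
    have e2 : content (t i) = content (t j) - 1 := by omega
    have m' := (hL.path j).mem (content (t j)) hlt.le le_rfl
    refine hL.east j (onDiag_content.1 ?_)
    have m2 := (hh i).mem (content (t i)) (hL.le i) le_rfl
    rw [← e2, (hh i).finish] at i3
    rw [(hh i).finish] at m2
    rw [(hh j).finish, ← e2] at h1
    have := m'.row_nonneg
    rw [(hL.path j).finish] at this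
    refine m2.of_le (by positivity) ?_ ?_ ?_ <;> simp only [content] at * <;> push_cast <;> omega

/-- If `h j` is strictly above the covered paths, then its peaks are `lam`-high. -/
theorem peak_high (hT : ∀ c, ¬ ChildTouch s t h j c) {c : ℤ}
    (hc : PeakAt (content (s j)) (content (t j)) (h j) c) : OnDiag lam c (h j c + 1) := by
  obtain ⟨p1, p2, p3, p4⟩ := hc
  by_contra hno
  have m0 := (hh j).mem c p1.le p2.le
  have r0 := m0.row_nonneg
  have r1 := m0.col_nonneg
  -- A covered path passing below one of the three cells around the peak would make it high.
  have key : ∀ d r, c - 1 ≤ d → d ≤ c + 1 → L j d < r → OnDiag lam d r → False := by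
    intro d r h1 h2 h3 h4
    obtain ⟨i, hi, i1, i2, i3⟩ := exists_child_of_lt hL hR hT (by omega) (by omega) h3 h4
    have m := (hh i).mem d i1 i2
    obtain rfl | rfl | rfl : d = c - 1 ∨ d = c ∨ d = c + 1 := by omega
    all_goals exact hno (m.of_le (by omega) (by omega) (by omega) (by omega))
  have e0 : L j c = h j c := by
    rcases lt_trichotomy (L j c) (h j c) with h1 | h1 | h1
    · exact (key c _ (by omega) (by omega) h1 m0).elim
    · exact h1
    · have := (hL.path j).mem c p1.le p2.le
      exact absurd (this.of_le (by omega) (by omega) (by omega) (by omega)) hno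
  have s1 := (hL.path j).step (c - 1) (by omega) (by omega)
  have s2 := (hL.path j).step c (by omega) (by omega)
  rw [sub_add_cancel] at s1
  have e1 : L j (c - 1) = h j c + 1 := by
    by_contra hne
    exact key (c - 1) _ (by omega) (by omega) (by omega) ((hh j).mem (c - 1) (by omega) (by omega))
  have e2 : L j (c + 1) = h j c := by
    by_contra hne
    exact key (c + 1) _ (by omega) (by omega) (by omega) ((hh j).mem (c + 1) (by omega) (by omega))
  have := hN.high c ⟨p1, p2, by omega, by omega⟩
  rw [e0] at this
  exact hno this

/-- If the path does not touch a covered path, then it can be lowered at all its peaks. -/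
theorem region_lower (hT : ∀ c, ¬ ChildTouch s t h j c) {c : ℤ}
    (hc : PeakAt (content (s j)) (content (t j)) (h j) c) :
    Region lam s t h j c (h j c + 1) := by
  have hhigh := peak_high hL hh hR hN hT hc
  obtain ⟨v1, v2, v3, v4⟩ := hc
  obtain ⟨r1, r2, r3⟩ := hR c v1.le v2.le
  refine ⟨hhigh, fun i hi h1 h2 => ?_, fun p hp => ?_⟩
  · have k0 := lt_child hR hT hi h1 h2
    rcases (show h j c + 1 ≤ h i c by omega).lt_or_eq with h3 | h3
    · exact Or.inl h3
    · refine Or.inr ⟨h3, ?_, ?_⟩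
      · rcases eq_or_ne c (content (s i)) with h4 | h4
        · exact Or.inl h4
        · have k1 := lt_child hR hT hi (d := c - 1) (by omega) (by omega)
          have s1 := (hh i).step (c - 1) (by omega) (by omega)
          rw [sub_add_cancel] at s1
          right; omega
      · rcases eq_or_ne c (content (t i)) with h4 | h4
        · exact Or.inl h4
        · have k1 := lt_child hR hT hi (d := c + 1) (by omega) (by omega)
          have s1 := (hh i).step c (by omega) (by omega)
          right; omega
  · rcases r3 p hp with h3 | h3 <;> left <;> omega

/-- Contacts with a covering path are at peaks, if there are none with a covered path. -/
theorem peakAt_of_parentTouch (hT : ∀ c, ¬ ChildTouch s t h j c) {c : ℤ}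
    (h1 : content (s j) ≤ c) (h2 : c ≤ content (t j)) (hc : ParentTouch s t h j c) :
    PeakAt (content (s j)) (content (t j)) (h j) c := by
  obtain ⟨p, hp, he, w1, w2, w3, w4⟩ := hc.spec hR h1 h2
  have hlt := hN.lt
  rcases h1.eq_or_lt with rfl | h1
  · exfalso
    have hf := first_step_up hL hh hR hN hT
    rcases (hR (content (s j) + 1) (by omega) (by omega)).2.2 p hp with h3 | h3
    · omega
    · have := h3.2.2.2.1
      rw [add_sub_cancel_right] at this
      omega
  rcases h2.eq_or_lt with rfl | h2
  · exfalso
    have hf := last_step_down hL hh hR hN hT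
    rcases (hR (content (t j) - 1) (by omega) (by omega)).2.2 p hp with h3 | h3
    · omega
    · have := h3.2.2.2.2
      rw [sub_add_cancel] at this
      omega
  exact hc.peakAt hh hR h1 h2

end Switch

/-! ### The switch identity for families -/

section SwitchSum

variable {lam : YoungDiagram} {ι : Type*} {L : ι → ℤ → ℤ} {s t : ι → Cell} {h : ι → ℤ → ℤ} {j : ι}
  {K : Type*} [Field K]

open Classical in
variable (s t) in
/-- The weight of a position of the `j`-th path: `q - 1` on the covered and covering paths, and `q`
elsewhere. -/
noncomputable def regionWeight (q : K) (h : ι → ℤ → ℤ) (j : ι) (c r : ℤ) : K :=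
  if (∃ i, Covers s t i j ∧ content (s i) ≤ c ∧ c ≤ content (t i) ∧ r = h i c) ∨
    (∃ p, Covers s t j p ∧ h p c = r) then q - 1 else q

theorem regionWeight_of_touch {q : K} {c : ℤ}
    (H : ChildTouch s t h j c ∨ ParentTouch s t h j c) :
    regionWeight s t q h j c (h j c) = q - 1 := if_pos H

theorem regionWeight_of_not_touch {q : K} {c : ℤ} (H : ¬ ChildTouch s t h j c)
    (H' : ¬ ParentTouch s t h j c) : regionWeight s t q h j c (h j c) = q :=
  if_neg fun h => h.elim H H'

open Classical in
theorem pow_card_valleySet (q : K) (a b : ℤ) (g : ℤ → ℤ) :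
    q ^ (valleySet a b g).card = ∏ c ∈ Finset.Icc a b, if ValleyAt a b g c then q else 1 := by
  rw [← Finset.prod_filter, Finset.prod_const]
  congr 2
  ext c
  simp only [mem_valleySet, Finset.mem_filter, Finset.mem_Icc]
  exact ⟨fun h => ⟨⟨h.1.le, h.2.1.le⟩, h⟩, fun h => h.2⟩

open Classical in
theorem pow_card_peakSet (q : K) (a b : ℤ) (g : ℤ → ℤ) :
    q ^ (peakSet a b g).card = ∏ c ∈ Finset.Icc a b, if PeakAt a b g c then q else 1 := by
  rw [← Finset.prod_filter, Finset.prod_const]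
  congr 2
  ext c
  simp only [mem_peakSet, Finset.mem_filter, Finset.mem_Icc]
  exact ⟨fun h => ⟨⟨h.1.le, h.2.1.le⟩, h⟩, fun h => h.2⟩

theorem Covers.ne {i : ι} (hi : Covers s t i j) : i ≠ j := by
  rintro rfl; exact hi.1.irrefl

theorem region_update [DecidableEq ι] (g : ℤ → ℤ) :
    Region lam s t (Function.update h j g) j = Region lam s t h j := by
  funext c r
  rw [Region, Region]
  refine propext (and_congr_right fun _ => and_congr (forall_congr' fun i => ?_)
    (forall_congr' fun p => ?_))
  · refine forall_congr' fun hi => ?_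
    rw [Function.update_of_ne hi.ne]
  · refine forall_congr' fun hp => ?_
    rw [Function.update_of_ne hp.ne.symm]

theorem regionWeight_update [DecidableEq ι] (q : K) (g : ℤ → ℤ) :
    regionWeight s t q (Function.update h j g) j = regionWeight s t q h j := by
  funext c r
  rw [regionWeight, regionWeight]
  congr 1
  refine propext (or_congr (exists_congr fun i => ?_) (exists_congr fun p => ?_))
  · refine and_congr_right fun hi => ?_
    rw [Function.update_of_ne hi.ne]
  · refine and_congr_right fun hp => ?_
    rw [Function.update_of_ne hp.ne.symm]

theorem edgeWeight_congr {w : K} {h h' : ι → ℤ → ℤ} {i j : ι} (hi : h i = h' i)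
    (hj : h j = h' j) : edgeWeight s t w h i j = edgeWeight s t w h' i j := by
  rw [edgeWeight, edgeWeight, hi, hj]

variable [Fintype ι]

open Classical in
/-- The weight of the `j`-th path when contacts are allowed with the covered paths only is its
weight in the region by raisable valleys. -/
theorem weight_eq_prod_valley (hL : IsPathSystem lam L s t)
    (hh : ∀ i, IsPath lam (s i) (t i) (h i)) {q : K} (hq : q ≠ 0) :
    q ^ (valleySet (content (s j)) (content (t j)) (h j)).card *
        ((∏ i with Covers s t i j, edgeWeight s t (1 - q⁻¹) h i j) *
          ∏ p with Covers s t j p, edgeWeight s t 0 h j p) =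
      if ∀ c, content (s j) ≤ c → c ≤ content (t j) → Region lam s t h j c (h j c) then
        ∏ c ∈ Finset.Icc (content (s j)) (content (t j)),
          (if ValleyAt (content (s j)) (content (t j)) (h j) c ∧ Region lam s t h j c (h j c - 1)
            then regionWeight s t q h j c (h j c) else regionWeight s t q h j c (h j c) + (1 - q))
      else 0 := by
  split_ifs with hR
  · by_cases hT : ∀ c, content (s j) ≤ c → c ≤ content (t j) → ¬ ParentTouch s t h j c
    · rw [Finset.prod_eq_one (s := Finset.univ.filter fun p => Covers s t j p), mul_one,
        prod_edgeWeight_children hL, pow_card_valleySet, ← Finset.prod_mul_distrib]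
      · refine Finset.prod_congr rfl fun c hc => ?_
        rw [Finset.mem_Icc] at hc
        by_cases hv : ValleyAt (content (s j)) (content (t j)) (h j) c
        · by_cases hCT : ChildTouch s t h j c
          · rw [if_pos hv, if_pos hCT, if_pos ⟨hv, region_raise hh hR hT hv⟩,
              regionWeight_of_touch (Or.inl hCT)]
            field_simp
          · rw [if_pos hv, if_neg hCT, if_pos ⟨hv, region_raise hh hR hT hv⟩,
              regionWeight_of_not_touch hCT (hT c hc.1 hc.2), mul_one]
        · have hCT : ¬ ChildTouch s t h j c := fun h => hv (h.valleyAt hL hh hR)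
          rw [if_neg hv, if_neg hCT, if_neg (fun h => hv h.1),
            regionWeight_of_not_touch hCT (hT c hc.1 hc.2)]
          ring
      · intro i hi c h1 h2
        have hm := hi.1.mem h1 h2
        rcases (hR c hm.1.le hm.2.le).2.1 i hi h1 h2 with h3 | h3
        · exact Or.inl h3
        · exact Or.inr ⟨h3.1, h3.2, ChildTouch.valleyAt hL hh hR ⟨i, hi, h1, h2, h3.1⟩⟩
      · intro p hp
        replace hp : Covers s t j p := by simpa using hp
        refine edgeWeight_eq_one fun c h1 h2 => ?_
        rcases (hR c h1 h2).2.2 p hp with h3 | h3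
        · exact h3
        · exact absurd ⟨p, hp, h3.1⟩ (hT c h1 h2)
    · push Not at hT
      obtain ⟨c, h1, h2, hc⟩ := hT
      rw [Finset.prod_eq_zero (i := c) (Finset.mem_Icc.2 ⟨h1, h2⟩)]
      · obtain ⟨p, hp, he⟩ := hc
        rw [Finset.prod_eq_zero (i := p) (s := Finset.univ.filter fun p => Covers s t j p)
          (by simpa using hp) (edgeWeight_zero_eq_zero h1 h2 he.ge), mul_zero, mul_zero]
      · rw [if_neg fun h => hc.not_valleyAt hR h.1, regionWeight_of_touch (Or.inr hc)]
        ring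
  · push Not at hR
    obtain ⟨c, h1, h2, hc⟩ := hR
    by_cases hch : ∀ i, Covers s t i j → WeaklyAbove s t h i j
    · by_cases hpa : ∀ p, Covers s t j p → h p c < h j c
      · refine absurd ⟨(hh j).mem c h1 h2, fun i hi h3 h4 => ?_, fun p hp => Or.inl (hpa p hp)⟩ hc
        rcases hch i hi c h3 h4 with h5 | h5
        · exact Or.inl h5
        · exact Or.inr ⟨h5.1, h5.2.1⟩
      · push Not at hpa
        obtain ⟨p, hp, he⟩ := hpa
        rw [Finset.prod_eq_zero (i := p) (s := Finset.univ.filter fun p => Covers s t j p)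
          (by simpa using hp) (edgeWeight_zero_eq_zero h1 h2 he), mul_zero, mul_zero]
    · push Not at hch
      obtain ⟨i, hi, hw⟩ := hch
      rw [Finset.prod_eq_zero (i := i) (s := Finset.univ.filter fun i => Covers s t i j)
          (by simpa using hi) (edgeWeight_eq_zero hw), zero_mul, mul_zero]

open Classical in
/-- The weight of the `j`-th path when contacts are allowed with the covering paths only is, up to
the factor `q`, its weight in the region by lowerable peaks. -/
theorem weight_eq_prod_peak (hL : IsPathSystem lam L s t)
    (hh : ∀ i, IsPath lam (s i) (t i) (h i)) (hN : IsHighPath lam (s j) (t j) (L j)) {q : K}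
    (hq : q ≠ 0) :
    q * (q ^ (valleySet (content (s j)) (content (t j)) (h j)).card *
        ((∏ i with Covers s t i j, edgeWeight s t 0 h i j) *
          ∏ p with Covers s t j p, edgeWeight s t (1 - q⁻¹) h j p)) =
      if ∀ c, content (s j) ≤ c → c ≤ content (t j) → Region lam s t h j c (h j c) then
        ∏ c ∈ Finset.Icc (content (s j)) (content (t j)),
          (if PeakAt (content (s j)) (content (t j)) (h j) c ∧ Region lam s t h j c (h j c + 1)
            then regionWeight s t q h j c (h j c) else regionWeight s t q h j c (h j c) + (1 - q))
      else 0 := by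
  split_ifs with hR
  · by_cases hT : ∀ c, ¬ ChildTouch s t h j c
    · have hcard := (hh j).card_peakSet hN.lt (first_step_up hL hh hR hN hT)
        (last_step_down hL hh hR hN hT)
      rw [← mul_assoc, ← pow_succ', ← hcard,
        Finset.prod_eq_one (s := Finset.univ.filter fun i => Covers s t i j), one_mul,
        prod_edgeWeight_parents hL, pow_card_peakSet, ← Finset.prod_mul_distrib]
      · refine Finset.prod_congr rfl fun c hc => ?_
        rw [Finset.mem_Icc] at hc
        by_cases hv : PeakAt (content (s j)) (content (t j)) (h j) c
        · by_cases hPT : ParentTouch s t h j c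
          · rw [if_pos hv, if_pos hPT, if_pos ⟨hv, region_lower hL hh hR hN hT hv⟩,
              regionWeight_of_touch (Or.inr hPT)]
            field_simp
          · rw [if_pos hv, if_neg hPT, if_pos ⟨hv, region_lower hL hh hR hN hT hv⟩,
              regionWeight_of_not_touch (hT c) hPT, mul_one]
        · have hPT : ¬ ParentTouch s t h j c := fun h =>
            hv (peakAt_of_parentTouch hL hh hR hN hT hc.1 hc.2 h)
          rw [if_neg hv, if_neg hPT, if_neg (fun h => hv h.1),
            regionWeight_of_not_touch (hT c) hPT]
          ring
      · intro p hp c h1 h2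
        rcases (hR c h1 h2).2.2 p hp with h3 | h3
        · exact Or.inl h3
        · have hpk := peakAt_of_parentTouch hL hh hR hN hT h1 h2 ⟨p, hp, h3.1⟩
          exact Or.inr ⟨h3.1, ⟨Or.inr hpk.2.2.1, Or.inr hpk.2.2.2⟩, h3.2⟩
      · intro i hi
        replace hi : Covers s t i j := by simpa using hi
        exact edgeWeight_eq_one fun c h1 h2 => lt_child hR hT hi h1 h2
    · push Not at hT
      obtain ⟨c, hc⟩ := hT
      have hv := hc.valleyAt hL hh hR
      rw [Finset.prod_eq_zero (i := c) (Finset.mem_Icc.2 ⟨hv.1.le, hv.2.1.le⟩)]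
      · obtain ⟨i, hi, h1, h2, he⟩ := hc
        rw [Finset.prod_eq_zero (i := i) (s := Finset.univ.filter fun i => Covers s t i j)
          (by simpa using hi) (edgeWeight_zero_eq_zero h1 h2 he.ge), zero_mul, mul_zero, mul_zero]
      · rw [if_neg, regionWeight_of_touch (Or.inl hc)]
        · ring
        · rintro ⟨hp, -⟩
          have := hp.2.2.1; have := hv.2.2.1
          omega
  · push Not at hR
    obtain ⟨c, h1, h2, hc⟩ := hR
    by_cases hpa : ∀ p, Covers s t j p → WeaklyAbove s t h j p
    · by_cases hch : ∀ i, Covers s t i j → content (s i) ≤ c → c ≤ content (t i) → h j c < h i c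
      · refine absurd ⟨(hh j).mem c h1 h2, fun i hi h3 h4 => Or.inl (hch i hi h3 h4),
          fun p hp => ?_⟩ hc
        rcases hpa p hp c h1 h2 with h5 | h5
        · exact Or.inl h5
        · exact Or.inr ⟨h5.1, h5.2.2⟩
      · push Not at hch
        obtain ⟨i, hi, h3, h4, he⟩ := hch
        rw [Finset.prod_eq_zero (i := i) (s := Finset.univ.filter fun i => Covers s t i j)
          (by simpa using hi) (edgeWeight_zero_eq_zero h3 h4 he), zero_mul, mul_zero, mul_zero]
    · push Not at hpa
      obtain ⟨p, hp, hw⟩ := hpa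
      rw [Finset.prod_eq_zero (i := p) (s := Finset.univ.filter fun p => Covers s t j p)
          (by simpa using hp) (edgeWeight_eq_zero hw), mul_zero, mul_zero, mul_zero]

variable [DecidableEq ι]

open Classical in
/-- Moving the contacts of the `j`-th path from the covered paths to the covering ones, for fixed
other paths. -/
theorem sum_weight_children_eq_sum_weight_parents (hL : IsPathSystem lam L s t)
    (hh : ∀ i, IsPath lam (s i) (t i) (h i)) (hN : IsHighPath lam (s j) (t j) (L j)) {q : K}
    (hq : q ≠ 0) :
    ∑ g ∈ pathFns lam (s j) (t j),
      q ^ (valleySet (content (s j)) (content (t j)) g).card *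
        ((∏ i with Covers s t i j, edgeWeight s t (1 - q⁻¹) (Function.update h j g) i j) *
          ∏ p with Covers s t j p, edgeWeight s t 0 (Function.update h j g) j p) =
    q * ∑ g ∈ pathFns lam (s j) (t j),
      q ^ (valleySet (content (s j)) (content (t j)) g).card *
        ((∏ i with Covers s t i j, edgeWeight s t 0 (Function.update h j g) i j) *
          ∏ p with Covers s t j p, edgeWeight s t (1 - q⁻¹) (Function.update h j g) j p) := by
  have hup : ∀ g ∈ pathFns lam (s j) (t j), ∀ i,
      IsPath lam (s i) (t i) (Function.update h j g i) := by
    intro g hg i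
    rcases eq_or_ne i j with rfl | hi
    · rw [Function.update_self]; exact mem_pathFns.1 hg
    · rw [Function.update_of_ne hi]; exact hh i
  have h1 := fun g hg => weight_eq_prod_valley (j := j) hL (hup g hg) hq
  have h2 := fun g hg => weight_eq_prod_peak (j := j) hL (hup g hg) hN hq
  simp only [Function.update_self, region_update, regionWeight_update] at h1 h2
  rw [Finset.mul_sum, Finset.sum_congr rfl h1, Finset.sum_congr rfl h2, ← Finset.sum_filter,
    ← Finset.sum_filter]
  refine sum_prod_valley_eq_sum_prod_peak (α := (s j).1) (β := (t j).1)
    (R := Region lam s t h j) (fun g => ?_) (fun c r₁ r r₂ => Region.convex)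
    (regionWeight s t q h j) (1 - q)
  rw [Finset.mem_filter, mem_pathFns]
  exact ⟨fun h => ⟨h.1.toIsWalk, h.2⟩, fun h => ⟨⟨h.1, fun c h1 h2 => (h.2 c h1 h2).1⟩, h.2⟩⟩

/-- Sums over families agree if they agree after summation over one member. -/
theorem sum_piFinset_congr_update {A M : Type*} [AddCommMonoid M] (X : ι → Finset A)
    (j : ι) (f f' : (ι → A) → M)
    (H : ∀ h ∈ Fintype.piFinset X, ∑ g ∈ X j, f (Function.update h j g) =
      ∑ g ∈ X j, f' (Function.update h j g)) :
    ∑ h ∈ Fintype.piFinset X, f h = ∑ h ∈ Fintype.piFinset X, f' h := by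
  classical
  let res : (ι → A) → ({i // i ≠ j} → A) := fun h i => h i
  rw [← Finset.sum_fiberwise_of_maps_to (t := (Fintype.piFinset X).image res) (g := res)
      (fun h hh => Finset.mem_image_of_mem _ hh) f,
    ← Finset.sum_fiberwise_of_maps_to (t := (Fintype.piFinset X).image res) (g := res)
      (fun h hh => Finset.mem_image_of_mem _ hh) f']
  refine Finset.sum_congr rfl fun y hy => ?_
  obtain ⟨h, hh, rfl⟩ := Finset.mem_image.1 hy
  have key : ∀ f : (ι → A) → M, ∑ h' ∈ (Fintype.piFinset X).filter (fun h' => res h' = res h),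
      f h' = ∑ g ∈ X j, f (Function.update h j g) := by
    intro f
    refine Finset.sum_bij' (fun h' _ => h' j) (fun g _ => Function.update h j g) ?_ ?_ ?_ ?_ ?_
    · intro h' hh'
      exact Fintype.mem_piFinset.1 (Finset.mem_filter.1 hh').1 j
    · intro g hg
      rw [Finset.mem_filter, Fintype.mem_piFinset]
      refine ⟨fun i => ?_, ?_⟩
      · rcases eq_or_ne i j with rfl | hi
        · rwa [Function.update_self]
        · rw [Function.update_of_ne hi]; exact Fintype.mem_piFinset.1 hh i
      · funext i; exact Function.update_of_ne i.2 _ _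
    · intro h' hh'
      funext i
      rcases eq_or_ne i j with rfl | hi
      · rw [Function.update_self]
      · rw [Function.update_of_ne hi]
        exact (congrFun (Finset.mem_filter.1 hh').2 ⟨i, hi⟩).symm
    · intro g _; exact Function.update_self ..
    · intro h' hh'
      congr 1
      funext i
      rcases eq_or_ne i j with rfl | hi
      · rw [Function.update_self]
      · rw [Function.update_of_ne hi]
        exact congrFun (Finset.mem_filter.1 hh').2 ⟨i, hi⟩
  rw [key, key, H h hh]

open Classical in
/-- Separation of the covering pairs that involve `j` from the others. -/
theorem prod_covers_isolate (j : ι) (E : ι → ι → K) :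
    ∏ j', ∏ i with Covers s t i j', E i j' =
      ((∏ i with Covers s t i j, E i j) * ∏ p with Covers s t j p, E j p) *
        ∏ j' ∈ Finset.univ.erase j, ∏ i with Covers s t i j' ∧ i ≠ j, E i j' := by
  rw [← Finset.mul_prod_erase _ _ (Finset.mem_univ j), mul_assoc]
  congr 1
  have h1 : ∏ p with Covers s t j p, E j p =
      ∏ j' ∈ Finset.univ.erase j, if Covers s t j j' then E j j' else 1 := by
    rw [Finset.prod_filter, ← Finset.mul_prod_erase _ _ (Finset.mem_univ j),
      if_neg fun h => h.ne rfl, one_mul]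
  rw [h1, ← Finset.prod_mul_distrib]
  refine Finset.prod_congr rfl fun j' _ => ?_
  rw [← Finset.prod_filter_mul_prod_filter_not (Finset.univ.filter fun i => Covers s t i j')
    (fun i => i = j), Finset.filter_filter, Finset.filter_filter]
  congr 1
  split_ifs with hj
  · have : Finset.univ.filter (fun i => Covers s t i j' ∧ i = j) = {j} := by
      ext i; simp only [Finset.mem_filter, Finset.mem_univ, true_and, Finset.mem_singleton]
      exact ⟨fun h => h.2, by rintro rfl; exact ⟨hj, rfl⟩⟩
    rw [this, Finset.prod_singleton]
  · refine Finset.prod_eq_one fun i hi => ?_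
    rw [Finset.mem_filter] at hi
    obtain ⟨-, h, rfl⟩ := hi
    exact absurd h hj

/-- If contacts of the `j`-th path are allowed with the covered paths and forbidden with the
covering ones, exchanging the two rules divides the generating function by `q`. -/
theorem systemSum_switch (hL : IsPathSystem lam L s t) (hN : IsHighPath lam (s j) (t j) (L j))
    {q : K} (hq : q ≠ 0) {w w' : ι → ι → K}
    (h1 : ∀ i, Covers s t i j → w i j = 1 - q⁻¹ ∧ w' i j = 0)
    (h2 : ∀ p, Covers s t j p → w j p = 0 ∧ w' j p = 1 - q⁻¹)
    (h3 : ∀ i j', i ≠ j → j' ≠ j → w i j' = w' i j') :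
    systemSum lam s t q w = q * systemSum lam s t q w' := by
  classical
  rw [systemSum, systemSum, Finset.mul_sum]
  refine sum_piFinset_congr_update _ j _ _ fun h hh => ?_
  have hh' : ∀ i, IsPath lam (s i) (t i) (h i) := fun i =>
    mem_pathFns.1 (Fintype.mem_piFinset.1 hh i)
  have key : ∀ (w : ι → ι → K) (g : ℤ → ℤ),
      (∏ j', q ^ (valleySet (content (s j')) (content (t j')) (Function.update h j g j')).card) *
        ∏ j', ∏ i with Covers s t i j', edgeWeight s t (w i j') (Function.update h j g) i j' =
      (q ^ (valleySet (content (s j)) (content (t j)) g).card *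
        ((∏ i with Covers s t i j, edgeWeight s t (w i j) (Function.update h j g) i j) *
          ∏ p with Covers s t j p, edgeWeight s t (w j p) (Function.update h j g) j p)) *
      ((∏ j' ∈ Finset.univ.erase j,
          q ^ (valleySet (content (s j')) (content (t j')) (h j')).card) *
        ∏ j' ∈ Finset.univ.erase j, ∏ i with Covers s t i j' ∧ i ≠ j,
          edgeWeight s t (w i j') h i j') := by
    intro w g
    rw [prod_covers_isolate j, ← Finset.mul_prod_erase _ _ (Finset.mem_univ j),
      Function.update_self]
    have e1 : ∏ j' ∈ Finset.univ.erase j,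
        q ^ (valleySet (content (s j')) (content (t j')) (Function.update h j g j')).card =
        ∏ j' ∈ Finset.univ.erase j,
          q ^ (valleySet (content (s j')) (content (t j')) (h j')).card :=
      Finset.prod_congr rfl fun j' hj' => by
        rw [Function.update_of_ne (Finset.ne_of_mem_erase hj')]
    have e2 : ∏ j' ∈ Finset.univ.erase j, ∏ i with Covers s t i j' ∧ i ≠ j,
          edgeWeight s t (w i j') (Function.update h j g) i j' =
        ∏ j' ∈ Finset.univ.erase j, ∏ i with Covers s t i j' ∧ i ≠ j,
          edgeWeight s t (w i j') h i j' :=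
      Finset.prod_congr rfl fun j' hj' => Finset.prod_congr rfl fun i hi =>
        edgeWeight_congr (Function.update_of_ne (Finset.mem_filter.1 hi).2.2 _ _)
          (Function.update_of_ne (Finset.ne_of_mem_erase hj') _ _)
    rw [e1, e2]
    ring
  -- Only the first factor, the weight of the `j`-th path and of its contacts, depends on `g`.
  simp only [key]
  have e3 : ∏ j' ∈ Finset.univ.erase j, ∏ i with Covers s t i j' ∧ i ≠ j,
          edgeWeight s t (w i j') h i j' =
        ∏ j' ∈ Finset.univ.erase j, ∏ i with Covers s t i j' ∧ i ≠ j,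
          edgeWeight s t (w' i j') h i j' :=
    Finset.prod_congr rfl fun j' hj' => Finset.prod_congr rfl fun i hi => by
      rw [h3 i j' (Finset.mem_filter.1 hi).2.2 (Finset.ne_of_mem_erase hj')]
  have e4 : ∀ g, (∏ i with Covers s t i j, edgeWeight s t (w i j) (Function.update h j g) i j) =
      ∏ i with Covers s t i j, edgeWeight s t (1 - q⁻¹) (Function.update h j g) i j := fun g =>
    Finset.prod_congr rfl fun i hi => by rw [(h1 i (Finset.mem_filter.1 hi).2).1]
  have e5 : ∀ g, (∏ i with Covers s t i j, edgeWeight s t (w' i j) (Function.update h j g) i j) =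
      ∏ i with Covers s t i j, edgeWeight s t 0 (Function.update h j g) i j := fun g =>
    Finset.prod_congr rfl fun i hi => by rw [(h1 i (Finset.mem_filter.1 hi).2).2]
  have e6 : ∀ g, (∏ p with Covers s t j p, edgeWeight s t (w j p) (Function.update h j g) j p) =
      ∏ p with Covers s t j p, edgeWeight s t 0 (Function.update h j g) j p := fun g =>
    Finset.prod_congr rfl fun i hi => by rw [(h2 i (Finset.mem_filter.1 hi).2).1]
  have e7 : ∀ g, (∏ p with Covers s t j p, edgeWeight s t (w' j p) (Function.update h j g) j p) =
      ∏ p with Covers s t j p, edgeWeight s t (1 - q⁻¹) (Function.update h j g) j p := fun g =>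
    Finset.prod_congr rfl fun i hi => by rw [(h2 i (Finset.mem_filter.1 hi).2).2]
  simp only [e3, e4, e5, e6, e7]
  rw [← Finset.mul_sum, ← Finset.sum_mul, ← Finset.sum_mul,
    sum_weight_children_eq_sum_weight_parents hL hh' hN hq, mul_assoc]

end SwitchSum

/-! ### From the determinant to strictly ordered families -/

section Rank

variable {lam : YoungDiagram} {ι : Type*} [Fintype ι] {L : ι → ℤ → ℤ} {s t : ι → Cell}
  {K : Type*} [Field K]

/-- The contact weights at the stage at which the `i`-th path has been switched `n i` times. -/
def stageWeight (q : K) (n : ι → ℕ) (i j : ι) : K := if n j = n i then 1 - q⁻¹ else 0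

open Classical in
/-- The stages are connected by switches: the path to be switched next is one of largest rank among
those that have been switched least often and fewer times than their rank. -/
theorem systemSum_stageWeight (hL : IsPathSystem lam L s t)
    (hN : ∀ i j, Nested s t i j → IsHighPath lam (s j) (t j) (L j)) {r : ι → ℕ}
    (hr : ∀ j, (∀ i, ¬ Nested s t i j) → r j = 0) (hr' : ∀ i j, Covers s t i j → r j = r i + 1)
    {q : K} (hq : q ≠ 0) (d : ℕ) (n : ι → ℕ) (hnr : ∀ i, n i ≤ r i)
    (hn : ∀ i j, Covers s t i j → n i ≤ n j ∧ n j ≤ n i + 1) (hd : ∑ i, (r i - n i) = d) :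
    systemSum lam s t q (stageWeight q n) = q ^ d * systemSum lam s t q (stageWeight q r) := by
  induction d generalizing n with
  | zero =>
    have : n = r := by
      funext i
      have := (Finset.sum_eq_zero_iff.1 hd) i (Finset.mem_univ i)
      have := hnr i
      omega
    rw [this, pow_zero, one_mul]
  | succ d ih =>
    have hne : ∃ i, n i < r i := by
      by_contra! h
      rw [Finset.sum_eq_zero fun i _ => Nat.sub_eq_zero_of_le (h i)] at hd
      omega
    obtain ⟨i₀, hi₀⟩ := hne
    obtain ⟨i₁, hi₁, hmin⟩ := (Finset.univ.filter fun i => n i < r i).exists_min_image n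
      ⟨i₀, by simpa using hi₀⟩
    obtain ⟨j, hj, hmax⟩ := (Finset.univ.filter fun i => n i < r i ∧ n i = n i₁).exists_max_image r
      ⟨i₁, by simpa using hi₁⟩
    simp only [Finset.mem_filter, Finset.mem_univ, true_and] at hmin hj hmax
    -- By the choice of `j`, its contacts are allowed with the covered paths and forbidden with the
    -- covering ones.
    have hchild : ∀ i, Covers s t i j → n j = n i := by
      intro i hi
      have h1 := hn i j hi
      have h2 := hr' i j hi
      by_contra h3
      have := hmin i (by omega)
      omega
    have hparent : ∀ p, Covers s t j p → n p = n j + 1 := by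
      intro p hp
      have h1 := hn j p hp
      have h2 := hr' j p hp
      by_contra h3
      have := hmax p (by omega)
      omega
    have hnest : ∃ i, Nested s t i j := by
      by_contra! h
      have := hr j h
      omega
    obtain ⟨i₂, hi₂⟩ := hnest
    have hsw := systemSum_switch (w := stageWeight q n)
      (w' := stageWeight q (Function.update n j (n j + 1))) hL (hN _ _ hi₂) hq ?_ ?_ ?_
    · rw [hsw, ih, pow_succ', mul_assoc]
      · intro i
        rcases eq_or_ne i j with rfl | hij
        · rw [Function.update_self]; exact hj.1
        · rw [Function.update_of_ne hij]; exact hnr i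
      · intro i p hip
        rcases eq_or_ne i j with rfl | hij
        · rw [Function.update_self, Function.update_of_ne hip.ne.symm, hparent p hip]
          omega
        · rw [Function.update_of_ne hij]
          rcases eq_or_ne p j with rfl | hpj
          · rw [Function.update_self, hchild i hip]; omega
          · rw [Function.update_of_ne hpj]; exact hn i p hip
      · rw [← Finset.add_sum_erase _ _ (Finset.mem_univ j)] at hd ⊢
        rw [Function.update_self]
        rw [Finset.sum_congr rfl fun i hi => by
          rw [Function.update_of_ne (Finset.ne_of_mem_erase hi)]]
        have := hj.1
        omega
    · intro i hi
      simp only [stageWeight]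
      rw [Function.update_self, Function.update_of_ne hi.ne, hchild i hi]
      simp
    · intro p hp
      simp only [stageWeight]
      rw [Function.update_self, Function.update_of_ne hp.ne.symm, hparent p hp]
      simp
    · intro i j' hi hj'
      simp only [stageWeight]
      rw [Function.update_of_ne hi, Function.update_of_ne hj']

omit [Fintype ι] in
variable (s t) in
/-- Paths with larger content interval lie strictly above those with smaller content interval. -/
def IsStrictFamily (h : ι → ℤ → ℤ) : Prop :=
  ∀ i j, Nested s t i j → ∀ c, content (s i) ≤ c → c ≤ content (t i) → h j c < h i c

open Classical in
variable (lam s t) in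
/-- The strictly ordered families of `lam`-Dyck paths from `s i` to `t i`. -/
noncomputable def strictFamilies : Finset (ι → ℤ → ℤ) :=
  (Fintype.piFinset fun i => pathFns lam (s i) (t i)).filter (IsStrictFamily s t)

theorem mem_strictFamilies {h : ι → ℤ → ℤ} : h ∈ strictFamilies lam s t ↔
    (∀ i, IsPath lam (s i) (t i) (h i)) ∧ IsStrictFamily s t h := by
  simp [strictFamilies, mem_pathFns]

theorem isStrictFamily_of_covers {h : ι → ℤ → ℤ} (H : ∀ i j, Covers s t i j → ∀ c,
    content (s i) ≤ c → c ≤ content (t i) → h j c < h i c) : IsStrictFamily s t h := by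
  intro i j hij c h1 h2
  obtain ⟨h3, h4⟩ := le_of_nested (fun i j hij c h1 h2 => Or.inl (H i j hij c h1 h2)) hij h1 h2
  rcases h3.lt_or_eq with h5 | h5
  · exact h5
  · exact H i j (h4 h5) c h1 h2

/-- The number of valleys of a family of paths. -/
noncomputable def valleyCount (s t : ι → Cell) (h : ι → ℤ → ℤ) : ℕ :=
  ∑ i, (valleySet (content (s i)) (content (t i)) (h i)).card

open Classical in
/-- If contacts of covering pairs are forbidden, only strictly ordered families contribute. -/
theorem systemSum_of_eq_zero {q : K} {w : ι → ι → K} (hw : ∀ i j, Covers s t i j → w i j = 0) :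
    systemSum lam s t q w = ∑ h ∈ strictFamilies lam s t, q ^ valleyCount s t h := by
  rw [systemSum, strictFamilies, Finset.sum_filter]
  refine Finset.sum_congr rfl fun h _ => ?_
  rw [Finset.prod_pow_eq_pow_sum]
  split_ifs with hs
  · rw [Finset.prod_eq_one, mul_one, valleyCount]
    refine fun j _ => Finset.prod_eq_one fun i hi => edgeWeight_eq_one fun c h1 h2 => ?_
    exact hs i j (by simpa using hi : Covers s t i j).1 c h1 h2
  · have : ∃ i j, Covers s t i j ∧ ∃ c, content (s i) ≤ c ∧ c ≤ content (t i) ∧ h i c ≤ h j c := by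
      by_contra! H
      exact hs (isStrictFamily_of_covers H)
    obtain ⟨i, j, hij, c, h1, h2, h3⟩ := this
    rw [Finset.prod_eq_zero (Finset.mem_univ j), mul_zero]
    refine Finset.prod_eq_zero (i := i) (by simpa using hij) ?_
    rw [hw i j hij]
    exact edgeWeight_zero_eq_zero h1 h2 h3

open Classical in
/-- The determinant counts strictly ordered families by valleys, up to a power of `q`. -/
theorem det_valleyGF [DecidableEq ι] (hL : IsPathSystem lam L s t)
    (hN : ∀ i j, Nested s t i j → IsHighPath lam (s j) (t j) (L j)) {r : ι → ℕ}
    (hr : ∀ j, (∀ i, ¬ Nested s t i j) → r j = 0) (hr' : ∀ i j, Covers s t i j → r j = r i + 1)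
    {q : K} (hq : q ≠ 0) :
    Matrix.det (Matrix.of fun i j : ι => valleyGF lam (s i) (t j) q) =
      q ^ (∑ i, r i) * ∑ h ∈ strictFamilies lam s t, q ^ valleyCount s t h := by
  rw [det_valleyGF_eq_systemSum hL q hq,
    ← systemSum_of_eq_zero (w := stageWeight q r) fun i j hij =>
      if_neg (by rw [hr' i j hij]; omega)]
  have h1 : (fun _ _ => 1 - q⁻¹ : ι → ι → K) = stageWeight q fun _ => 0 := by
    funext i j; simp [stageWeight]
  rw [h1]
  convert systemSum_stageWeight hL hN hr hr' hq _ (fun _ => 0) (by simp) (by simp) rfl using 2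
  simp

end Rank

/-! ### Excited diagrams as complements of strictly ordered families -/

section Excited

variable {lam : YoungDiagram} {ι : Type*} {L : ι → ℤ → ℤ} {s t : ι → Cell} {h h' : ι → ℤ → ℤ}

variable (s t) in
/-- One of the paths `h i` passes through the position with content `c` and row `r`. -/
def Occupied (h : ι → ℤ → ℤ) (c r : ℤ) : Prop :=
  ∃ i, content (s i) ≤ c ∧ c ≤ content (t i) ∧ h i c = r

open Classical in
variable (lam s t) in
/-- The cells of the paths `h i`. -/
noncomputable def familyCells (h : ι → ℤ → ℤ) : Finset Cell :=
  lam.cells.filter fun u => Occupied s t h (content u) u.1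

theorem mem_familyCells {u : Cell} :
    u ∈ familyCells lam s t h ↔ u ∈ lam ∧ Occupied s t h (content u) u.1 := by
  simp [familyCells]

theorem mem_sdiff_familyCells {u : Cell} :
    u ∈ lam.cells \ familyCells lam s t h ↔ u ∈ lam ∧ ¬ Occupied s t h (content u) u.1 := by
  rw [Finset.mem_sdiff, mem_familyCells, YoungDiagram.mem_cells]
  tauto

theorem IsPathSystem.isStrictFamily (hL : IsPathSystem lam L s t) : IsStrictFamily s t L :=
  fun _ _ hij _ h1 h2 => hL.lt_of_nested hij h1 h2

theorem IsStrictFamily.eq_of_common (hs : IsStrictFamily s t h) (hL : IsPathSystem lam L s t)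
    {i j : ι} {c : ℤ} (h1 : content (s i) ≤ c) (h2 : c ≤ content (t i)) (h3 : content (s j) ≤ c)
    (h4 : c ≤ content (t j)) (he : h i c = h j c) : i = j := by
  by_contra hij
  rcases hL.nested_of_common hij h1 h2 h3 h4 with h5 | h5
  · have := hs _ _ h5 c h1 h2; omega
  · have := hs _ _ h5 c h3 h4; omega

/-- Of two paths of a strictly ordered family, the upper one on a common diagonal belongs to the
larger content interval. -/
theorem IsStrictFamily.nested_of_lt (hs : IsStrictFamily s t h) (hL : IsPathSystem lam L s t)
    {i j : ι} {c : ℤ} (h1 : content (s i) ≤ c) (h2 : c ≤ content (t i)) (h3 : content (s j) ≤ c)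
    (h4 : c ≤ content (t j)) (hlt : h j c < h i c) : Nested s t i j := by
  have hij : i ≠ j := by rintro rfl; exact lt_irrefl _ hlt
  rcases hL.nested_of_common hij h1 h2 h3 h4 with h5 | h5
  · exact h5
  · have := hs _ _ h5 c h3 h4; omega

variable [DecidableEq ι]

/-- Moving one path at content `c` from row `h m c` to row `r` exchanges these two positions. -/
theorem occupied_update {m : ι} {c r : ℤ} (hL : IsPathSystem lam L s t) (hs : IsStrictFamily s t h)
    (h1 : content (s m) ≤ c) (h2 : c ≤ content (t m)) (hne : r ≠ h m c) {c' r' : ℤ} :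
    Occupied s t (Function.update h m (Function.update (h m) c r)) c' r' ↔
      (c' = c ∧ r' = r) ∨ (Occupied s t h c' r' ∧ ¬ (c' = c ∧ r' = h m c)) := by
  constructor
  · rintro ⟨i, h3, h4, rfl⟩
    rcases eq_or_ne i m with rfl | him
    · rw [Function.update_self]
      rcases eq_or_ne c' c with rfl | hc
      · left; simp
      · rw [Function.update_of_ne hc]
        exact Or.inr ⟨⟨i, h3, h4, rfl⟩, fun h => hc h.1⟩
    · rw [Function.update_of_ne him]
      refine Or.inr ⟨⟨i, h3, h4, rfl⟩, ?_⟩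
      rintro ⟨rfl, h5⟩
      exact him (hs.eq_of_common hL h3 h4 h1 h2 h5)
  · rintro (⟨rfl, rfl⟩ | ⟨⟨i, h3, h4, rfl⟩, h5⟩)
    · exact ⟨m, h1, h2, by simp⟩
    · refine ⟨i, h3, h4, ?_⟩
      rcases eq_or_ne i m with rfl | him
      · rw [Function.update_self, Function.update_of_ne]
        rintro rfl
        exact h5 ⟨rfl, rfl⟩
      · rw [Function.update_of_ne him]

/-- Raising the path through `(i + 1, j + 1)` to `(i, j)` moves a cell of the complement from
`(i, j)` to `(i + 1, j + 1)`. -/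
theorem sdiff_familyCells_update (hL : IsPathSystem lam L s t)
    (hh : ∀ i, IsPath lam (s i) (t i) (h i)) (hs : IsStrictFamily s t h) {m : ι} {i j : ℕ}
    (h1 : content (s m) ≤ content (i, j)) (h2 : content (i, j) ≤ content (t m))
    (hr : h m (content (i, j)) - 1 = i) :
    lam.cells \ familyCells lam s t (Function.update h m
        (Function.update (h m) (content (i, j)) (h m (content (i, j)) - 1))) =
      insert (i + 1, j + 1) ((lam.cells \ familyCells lam s t h).erase (i, j)) := by
  have e11 : content (i + 1, j + 1) = content (i, j) := by simp [content]
  have r1 : ((i + 1 : ℕ) : ℤ) = h m (content (i, j)) := by push_cast; omega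
  have hlam : (i + 1, j + 1) ∈ lam := by
    rw [← onDiag_content, e11, r1]; exact (hh m).mem _ h1 h2
  ext w
  have w0 : w = (i, j) ↔ content w = content (i, j) ∧ (w.1 : ℤ) = h m (content (i, j)) - 1 := by
    refine ⟨by rintro rfl; exact ⟨rfl, hr.symm⟩, fun h => cell_ext h.1 ?_⟩
    rw [h.2, hr]
  have w1 : w = (i + 1, j + 1) ↔ content w = content (i, j) ∧ (w.1 : ℤ) = h m (content (i, j)) := by
    refine ⟨by rintro rfl; exact ⟨e11, r1⟩, fun h => cell_ext (h.1.trans e11.symm) ?_⟩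
    rw [h.2, r1]
  have hw : w = (i + 1, j + 1) → w ∈ lam := by rintro rfl; exact hlam
  have hne : ¬ (w = (i + 1, j + 1) ∧ w = (i, j)) := by
    rintro ⟨rfl, h⟩
    simp at h
  rw [Finset.mem_insert, Finset.mem_erase, mem_sdiff_familyCells, mem_sdiff_familyCells,
    occupied_update hL hs h1 h2 (by omega), ← w0, ← w1]
  tauto

/-- Raising a path of a strictly ordered family at a valley is an excited move of the complement. -/
theorem excitedMove_of_raise (hL : IsPathSystem lam L s t)
    (hh : ∀ i, IsPath lam (s i) (t i) (h i)) (hs : IsStrictFamily s t h) {m : ι} {c : ℤ}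
    (hv : ValleyAt (content (s m)) (content (t m)) (h m) c)
    (hon : OnDiag lam c (h m c - 1)) (hfree : ¬ Occupied s t h c (h m c - 1)) :
    ExcitedMove lam (lam.cells \ familyCells lam s t h) (lam.cells \ familyCells lam s t
      (Function.update h m (Function.update (h m) c (h m c - 1)))) := by
  obtain ⟨v1, v2, v3, v4⟩ := hv
  obtain ⟨⟨i, j⟩, hu, rfl, hr⟩ := hon
  replace hr : (i : ℤ) = h m (content (i, j)) - 1 := hr
  rw [← hr] at hfree
  have e11 : content (i + 1, j + 1) = content (i, j) := by simp [content]
  have e10 : content (i + 1, j) = content (i, j) - 1 := by simp [content]; ring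
  have e01 : content (i, j + 1) = content (i, j) + 1 := by simp [content]; ring
  have r1 : ((i + 1 : ℕ) : ℤ) = h m (content (i, j)) := by push_cast; omega
  refine ⟨i, j, ?_, ?_, ?_, ?_, ?_,
    sdiff_familyCells_update hL hh hs v1.le v2.le hr.symm⟩
  · rw [mem_sdiff_familyCells]
    exact ⟨hu, hfree⟩
  · rw [mem_sdiff_familyCells, e10, r1]
    exact fun h => h.2 ⟨m, by omega, by omega, v3⟩
  · rw [mem_sdiff_familyCells, e01]
    exact fun h => h.2 ⟨m, by omega, by omega, v4.trans hr.symm⟩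
  · rw [mem_sdiff_familyCells, e11, r1]
    exact fun h => h.2 ⟨m, v1.le, v2.le, rfl⟩
  · rw [← onDiag_content, e11, r1]; exact (hh m).mem _ v1.le v2.le

omit [DecidableEq ι] in
/-- The paths of a strictly ordered family are weakly above those of the path system. -/
theorem IsStrictFamily.le (hs : IsStrictFamily s t h) (hL : IsPathSystem lam L s t)
    (hh : ∀ i, IsPath lam (s i) (t i) (h i)) {j : ι} {c : ℤ}
    (h1 : content (s j) ≤ c) (h2 : c ≤ content (t j)) : h j c ≤ L j c := by
  induction hn : (content (t j) - content (s j)).toNat using Nat.strong_induction_on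
    generalizing j with
  | _ n ih =>
    subst hn
    by_contra! hlt
    obtain ⟨m, m1, m2, m3⟩ := hL.filled j c _ h1 h2 hlt ((hh j).mem c h1 h2)
    have hm := hL.isStrictFamily.nested_of_lt hL m1 m2 h1 h2 (by omega)
    have k1 := hm.1; have k2 := hm.2; have k3 := hL.le m
    have := ih _ (by omega) m1 m2 rfl
    have := hs _ _ hm c m1 m2
    omega

/-- The excited move at `(i, j)` raises the path through `(i + 1, j + 1)` at a valley. -/
theorem exists_raise_of_excitedMove (hL : IsPathSystem lam L s t)
    (hh : ∀ i, IsPath lam (s i) (t i) (h i)) (hs : IsStrictFamily s t h) {D : Finset Cell}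
    (hD : ExcitedMove lam (lam.cells \ familyCells lam s t h) D) :
    ∃ h', (∀ i, IsPath lam (s i) (t i) (h' i)) ∧ IsStrictFamily s t h' ∧
      D = lam.cells \ familyCells lam s t h' := by
  obtain ⟨i, j, d00, d10, d01, d11, hlam, rfl⟩ := hD
  have l10 : (i + 1, j) ∈ lam := lam.up_left_mem le_rfl (Nat.le_succ j) hlam
  have l01 : (i, j + 1) ∈ lam := lam.up_left_mem (Nat.le_succ i) le_rfl hlam
  have e11 : content (i + 1, j + 1) = content (i, j) := by simp [content]
  have e10 : content (i + 1, j) = content (i, j) - 1 := by simp [content]; ring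
  have e01 : content (i, j + 1) = content (i, j) + 1 := by simp [content]; ring
  rw [mem_sdiff_familyCells] at d00 d10 d01 d11
  simp only [not_and, not_not] at d10 d01 d11
  obtain ⟨m, m1, m2, m3⟩ := d11 hlam
  obtain ⟨p, p1, p2, p3⟩ := d10 l10
  obtain ⟨n, n1, n2, n3⟩ := d01 l01
  rw [e11] at m1 m2 m3
  rw [e10] at p1 p2 p3
  rw [e01] at n1 n2 n3
  obtain ⟨l00, hfree⟩ := d00
  set c := content (i, j) with hc
  push_cast at *
  -- The path through `(i + 1, j)` does not end there, so it continues to `(i + 1, j + 1)`.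
  have hp : p = m := by
    rcases p2.eq_or_lt with hp2 | hp2
    · refine absurd hlam ?_
      have : (i + 1, j) = t p := cell_ext (by rw [e10, hp2]) (by
        rw [← (hh p).finish, ← hp2, p3]; push_cast; rfl)
      have he := hL.east p
      rwa [← this] at he
    · have st := (hh p).step (c - 1) p1 hp2
      rw [sub_add_cancel] at st
      rcases st with h1 | h1
      · exact hs.eq_of_common hL (by omega) (by omega) m1 m2 (by omega)
      · exact absurd ⟨p, by omega, by omega, by omega⟩ hfree
  -- The path through `(i, j + 1)` does not start there, so it comes from `(i + 1, j + 1)`.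
  have hn : n = m := by
    rcases n1.eq_or_lt with hn1 | hn1
    · refine absurd hlam ?_
      have : (i, j + 1) = s n := cell_ext (by rw [e01, hn1]) (by
        rw [← (hh n).start, hn1, n3])
      have he := hL.south n
      rwa [← this] at he
    · have st := (hh n).step c (by omega) (by omega)
      rcases st with h1 | h1
      · exact absurd ⟨n, by omega, by omega, by omega⟩ hfree
      · exact hs.eq_of_common hL (by omega) (by omega) m1 m2 (by omega)
  subst hp hn
  have hv : ValleyAt (content (s n)) (content (t n)) (h n) c :=
    ⟨by omega, by omega, by omega, by omega⟩
  have hrow : h n c - 1 = i := by omega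
  have hon : OnDiag lam c (h n c - 1) := by rw [hrow]; exact onDiag_content.2 l00
  have hfree' : ¬ Occupied s t h c (h n c - 1) := by rw [hrow]; exact hfree
  refine ⟨Function.update h n (Function.update (h n) c (h n c - 1)), fun q => ?_,
    fun q q' hq d h1 h2 => ?_, ?_⟩
  · rcases eq_or_ne q n with rfl | hqn
    · rw [Function.update_self]
      refine ⟨(hh q).raise hv, fun d h1 h2 => ?_⟩
      rcases eq_or_ne d c with rfl | hdc
      · rwa [Function.update_self]
      · rw [Function.update_of_ne hdc]; exact (hh q).mem d h1 h2
    · rw [Function.update_of_ne hqn]; exact hh q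
  · have hlt := hs q q' hq d h1 h2
    have hne : q ≠ q' := by rintro rfl; exact hq.irrefl
    rcases eq_or_ne q n with rfl | hqn
    · rw [Function.update_self, Function.update_of_ne hne.symm]
      rcases eq_or_ne d c with rfl | hdc
      · rw [Function.update_self]
        refine lt_of_le_of_ne (by omega) fun he => hfree' ⟨q', ?_, ?_, he⟩
        · exact (hq.mem h1 h2).1.le
        · exact (hq.mem h1 h2).2.le
      · rwa [Function.update_of_ne hdc]
    · rw [Function.update_of_ne hqn]
      rcases eq_or_ne q' n with rfl | hqn'
      · rw [Function.update_self]
        rcases eq_or_ne d c with rfl | hdc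
        · rw [Function.update_self]; omega
        · rwa [Function.update_of_ne hdc]
      · rwa [Function.update_of_ne hqn']
  · exact (sdiff_familyCells_update hL hh hs (by omega) (by omega) hrow).symm

omit [DecidableEq ι] in
open Classical in
/-- The excited diagrams are the complements of the strictly ordered families: the families are
connected by raising valleys, starting from the lowest family. -/
theorem isExcitedDiagram_iff [Fintype ι] (hL : IsPathSystem lam L s t) {D : Finset Cell} :
    IsExcitedDiagram lam (lam.cells \ familyCells lam s t L) D ↔
      ∃ h ∈ strictFamilies lam s t, D = lam.cells \ familyCells lam s t h := by
  simp only [mem_strictFamilies]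
  constructor
  · intro hD
    induction hD with
    | refl => exact ⟨L, ⟨hL.path, hL.isStrictFamily⟩, rfl⟩
    | tail _ hmove ih =>
      obtain ⟨h, ⟨hh, hs⟩, rfl⟩ := ih
      obtain ⟨h', hh', hs', rfl⟩ := exists_raise_of_excitedMove hL hh hs hmove
      exact ⟨h', ⟨hh', hs'⟩, rfl⟩
  · rintro ⟨h, ⟨hh, hs⟩, rfl⟩
    induction hn : (∑ i, ∑ c ∈ Finset.Icc (content (s i)) (content (t i)), (L i c - h i c)).toNat
      using Nat.strong_induction_on generalizing h with
    | _ n ih =>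
      subst hn
      by_cases hne : h = L
      · rw [hne]; exact Relation.ReflTransGen.refl
      -- Among the paths differing from those of the system take one of least content interval, and
      -- lower one of its peaks.
      obtain ⟨i₀, hi₀⟩ := Function.ne_iff.1 hne
      obtain ⟨m, hm, hmin⟩ := (Finset.univ.filter fun i => h i ≠ L i).exists_min_image
        (fun i => content (t i) - content (s i)) ⟨i₀, by simpa using hi₀⟩
      simp only [Finset.mem_filter, Finset.mem_univ, true_and] at hm hmin
      obtain ⟨c, hc⟩ := Function.ne_iff.1 hm
      have hcm : content (s m) ≤ c ∧ c ≤ content (t m) := by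
        by_contra hcm
        rw [(hh m).out c (by omega), (hL.path m).out c (by omega)] at hc
        exact hc rfl
      obtain ⟨d, hd, hlt⟩ := (hh m).exists_peak_of_lt (hL.path m).toIsWalk
        (lt_of_le_of_ne (hs.le hL hh hcm.1 hcm.2) hc)
      obtain ⟨d1, d2, d3, d4⟩ := id hd
      set h' := Function.update h m (Function.update (h m) d (h m d + 1)) with hh'
      have hm' : h' m = Function.update (h m) d (h m d + 1) := Function.update_self ..
      have hon := (hh m).mem d d1.le d2.le
      have p' : ∀ i, IsPath lam (s i) (t i) (h' i) := by
        intro i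
        rcases eq_or_ne i m with rfl | him
        · rw [hm']
          refine ⟨(hh i).lower hd, fun e h1 h2 => ?_⟩
          rcases eq_or_ne e d with rfl | hed
          · rw [Function.update_self]
            have := hon.row_nonneg; have := hon.col_nonneg
            exact ((hL.path i).mem e h1 h2).of_le (by omega) (by omega) (by omega) (by omega)
          · rw [Function.update_of_ne hed]; exact (hh i).mem e h1 h2
        · rw [hh', Function.update_of_ne him]; exact hh i
      have s' : IsStrictFamily s t h' := by
        intro i j hij e h1 h2
        have hlt' := hs i j hij e h1 h2
        have hne : i ≠ j := by rintro rfl; exact hij.irrefl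
        rcases eq_or_ne j m with rfl | hjm
        · rw [hm', hh', Function.update_of_ne hne]
          rcases eq_or_ne e d with rfl | hed
          · rw [Function.update_self]
            have hi : h i = L i := by
              by_contra hi
              have := hmin i hi
              have := hij.1; have := hij.2
              omega
            have := hL.lt_of_nested hij h1 h2
            rw [hi]; omega
          · rwa [Function.update_of_ne hed]
        · rw [hh', Function.update_of_ne hjm, ← hh']
          rcases eq_or_ne i m with rfl | him
          · rw [hm']
            rcases eq_or_ne e d with rfl | hed
            · rw [Function.update_self]; omega
            · rwa [Function.update_of_ne hed]
          · rwa [hh', Function.update_of_ne him]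
      have hback : Function.update h' m (Function.update (h' m) d (h' m d - 1)) = h := by
        rw [hm', hh', Function.update_self, Function.update_idem, Function.update_idem,
          add_sub_cancel_right, Function.update_eq_self, Function.update_eq_self]
      have hval : ValleyAt (content (s m)) (content (t m)) (h' m) d := by
        refine ⟨d1, d2, ?_, ?_⟩ <;> rw [hm', Function.update_self, Function.update_of_ne (by omega)]
        · exact d3
        · omega
      have hd' : h' m d - 1 = h m d := by rw [hm', Function.update_self]; ring
      have hle : ∀ i e, h i e ≤ h' i e := by
        intro i e
        rcases eq_or_ne i m with rfl | him
        · rw [hm']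
          rcases eq_or_ne e d with rfl | hed
          · rw [Function.update_self]; omega
          · rw [Function.update_of_ne hed]
        · rw [hh', Function.update_of_ne him]
      refine (ih _ ?_ h' p' s' rfl).tail ?_
      · have hdiff : ∑ i, ∑ c ∈ Finset.Icc (content (s i)) (content (t i)), (L i c - h' i c) <
            ∑ i, ∑ c ∈ Finset.Icc (content (s i)) (content (t i)), (L i c - h i c) := by
          refine Finset.sum_lt_sum (fun i _ => Finset.sum_le_sum fun e _ => ?_)
            ⟨m, Finset.mem_univ m, Finset.sum_lt_sum (fun e _ => ?_)
              ⟨d, Finset.mem_Icc.2 ⟨d1.le, d2.le⟩, by omega⟩⟩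
          · have := hle i e; omega
          · have := hle m e; omega
        have hpos : 0 ≤ ∑ i, ∑ c ∈ Finset.Icc (content (s i)) (content (t i)), (L i c - h' i c) :=
          Finset.sum_nonneg fun i _ => Finset.sum_nonneg fun e he => by
            rw [Finset.mem_Icc] at he
            have := s'.le hL p' he.1 he.2
            omega
        omega
      · have := excitedMove_of_raise hL p' s' hval (by rwa [hd']) (by
          rw [hd']
          rintro ⟨i, h1, h2, h3⟩
          rcases eq_or_ne i m with rfl | him
          · omega
          · rw [hh', Function.update_of_ne him] at h3
            exact him (hs.eq_of_common hL h1 h2 d1.le d2.le h3))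
        rwa [hback] at this

end Excited

/-! ### Counting pleasant diagrams -/

section Pleasant

variable {lam : YoungDiagram} {ι : Type*} {L : ι → ℤ → ℤ} {s t : ι → Cell} {h h' : ι → ℤ → ℤ}

open Classical in
variable (lam s t) in
/-- The cells at the valleys of the paths `h i`. -/
noncomputable def valleyCells (h : ι → ℤ → ℤ) : Finset Cell :=
  lam.cells.filter fun u => ∃ i, ValleyAt (content (s i)) (content (t i)) (h i) (content u) ∧
    h i (content u) = u.1

theorem mem_valleyCells {u : Cell} : u ∈ valleyCells lam s t h ↔ u ∈ lam ∧
    ∃ i, ValleyAt (content (s i)) (content (t i)) (h i) (content u) ∧ h i (content u) = u.1 := by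
  simp [valleyCells]

theorem valleyCells_subset : valleyCells lam s t h ⊆ familyCells lam s t h := by
  intro u hu
  obtain ⟨hu, i, hv, hi⟩ := mem_valleyCells.1 hu
  exact mem_familyCells.2 ⟨hu, i, hv.1.le, hv.2.1.le, hi⟩

open Classical in
/-- The cells of a strictly ordered family at contents in given subsets of the content intervals
are pairwise distinct. -/
theorem card_filter_family [Fintype ι] (hL : IsPathSystem lam L s t)
    (hh : ∀ i, IsPath lam (s i) (t i) (h i)) (hs : IsStrictFamily s t h) (S : ι → Finset ℤ)
    (hS : ∀ i, S i ⊆ Finset.Icc (content (s i)) (content (t i))) :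
    (lam.cells.filter fun u => ∃ i, content u ∈ S i ∧ h i (content u) = u.1).card =
      ∑ i, (S i).card := by
  rw [← Finset.card_sigma]
  symm
  have hmem : ∀ i c, c ∈ S i → OnDiag lam c (h i c) := fun i c hc => by
    have := Finset.mem_Icc.1 (hS i hc)
    exact (hh i).mem c this.1 this.2
  have hcell : ∀ i c, c ∈ S i → content (cellAt c (h i c)) = c ∧
      ((cellAt c (h i c)).1 : ℤ) = h i c := fun i c hc => by
    have h1 := (hmem i c hc).row_nonneg
    refine ⟨content_cellAt h1 (hmem i c hc).col_nonneg, ?_⟩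
    simp [cellAt, h1]
  refine Finset.card_bij (fun x _ => cellAt x.2 (h x.1 x.2)) ?_ ?_ ?_
  · rintro ⟨i, c⟩ hx
    have hc : c ∈ S i := (Finset.mem_sigma.1 hx).2
    obtain ⟨h1, h2⟩ := hcell i c hc
    rw [Finset.mem_filter, YoungDiagram.mem_cells]
    refine ⟨(hmem i c hc).cellAt_mem, i, ?_, ?_⟩ <;> simp only [h1, h2]
    exact hc
  · rintro ⟨i, c⟩ hx ⟨j, d⟩ hy he
    have hc : c ∈ S i := (Finset.mem_sigma.1 hx).2
    have hd : d ∈ S j := (Finset.mem_sigma.1 hy).2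
    simp only at he
    obtain rfl : c = d := by rw [← (hcell i c hc).1, he, (hcell j d hd).1]
    have h1 := Finset.mem_Icc.1 (hS i hc)
    have h2 := Finset.mem_Icc.1 (hS j hd)
    obtain rfl : i = j := hs.eq_of_common hL h1.1 h1.2 h2.1 h2.2
      (by rw [← (hcell i c hc).2, he, (hcell j c hd).2])
    rfl
  · intro u hu
    obtain ⟨-, i, h1, h2⟩ := Finset.mem_filter.1 hu
    refine ⟨⟨i, content u⟩, Finset.mem_sigma.2 ⟨Finset.mem_univ i, h1⟩, ?_⟩
    simp only [h2, cellAt_content]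

theorem card_familyCells [Fintype ι] (hL : IsPathSystem lam L s t)
    (hh : ∀ i, IsPath lam (s i) (t i) (h i)) (hs : IsStrictFamily s t h) :
    (familyCells lam s t h).card = ∑ i, (content (t i) + 1 - content (s i)).toNat := by
  classical
  simp only [← Int.card_Icc]
  rw [← card_filter_family hL hh hs _ fun i => subset_rfl]
  congr 1
  ext u
  rw [mem_familyCells, Finset.mem_filter, YoungDiagram.mem_cells]
  simp [Occupied, and_assoc]

theorem card_valleyCells [Fintype ι] (hL : IsPathSystem lam L s t)
    (hh : ∀ i, IsPath lam (s i) (t i) (h i)) (hs : IsStrictFamily s t h) :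
    (valleyCells lam s t h).card = valleyCount s t h := by
  classical
  rw [valleyCount, ← card_filter_family hL hh hs
    (fun i => valleySet (content (s i)) (content (t i)) (h i))]
  · congr 1
    ext u
    rw [mem_valleyCells, Finset.mem_filter, YoungDiagram.mem_cells]
    simp [mem_valleySet]
  · intro i c hc
    have := mem_valleySet.1 hc
    exact Finset.mem_Icc.2 ⟨this.1.le, this.2.1.le⟩

/-- In a strictly ordered family, a path directly above a valley of another path has a valley. -/
theorem IsStrictFamily.valleyAt_above (hs : IsStrictFamily s t h) (hL : IsPathSystem lam L s t)
    (hh : ∀ i, IsPath lam (s i) (t i) (h i)) {i j : ι} {c : ℤ}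
    (hv : ValleyAt (content (s i)) (content (t i)) (h i) c) (h1 : content (s j) ≤ c)
    (h2 : c ≤ content (t j)) (he : h j c + 1 = h i c) :
    ValleyAt (content (s j)) (content (t j)) (h j) c := by
  obtain ⟨v1, v2, v3, v4⟩ := hv
  have hij := hs.nested_of_lt hL v1.le v2.le h1 h2 (by omega)
  have hm := hij.mem v1.le v2.le
  have k1 := hs _ _ hij (c - 1) (by omega) (by omega)
  have k2 := hs _ _ hij (c + 1) (by omega) (by omega)
  have s1 := (hh j).step (c - 1) (by omega) (by omega)
  have s2 := (hh j).step c (by omega) (by omega)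
  rw [sub_add_cancel] at s1
  exact ⟨hm.1, hm.2, by omega, by omega⟩

/-- A set of cells covered by a strictly ordered family is covered by one all of whose valleys lie
in the set: a family with the highest paths covering the set has this property, since a valley
outside the set could be raised, together with the paths stacked directly above it. -/
theorem exists_valleyCells_subset [Fintype ι] (hL : IsPathSystem lam L s t)
    (hh : h ∈ strictFamilies lam s t) {P : Finset Cell} (hP : P ⊆ familyCells lam s t h) :
    ∃ h' ∈ strictFamilies lam s t, valleyCells lam s t h' ⊆ P ∧ P ⊆ familyCells lam s t h' := by
  classical
  obtain ⟨g, hg, hmin⟩ := ((strictFamilies lam s t).filter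
    fun g => P ⊆ familyCells lam s t g).exists_min_image
    (fun g => ∑ i, ∑ c ∈ Finset.Icc (content (s i)) (content (t i)), g i c)
    ⟨h, Finset.mem_filter.2 ⟨hh, hP⟩⟩
  obtain ⟨hgs, hgP⟩ := Finset.mem_filter.1 hg
  refine ⟨g, hgs, ?_, hgP⟩
  obtain ⟨pg, sg⟩ := mem_strictFamilies.1 hgs
  by_contra hV
  obtain ⟨u, hu, huP⟩ := Finset.not_subset.1 hV
  obtain ⟨-, j, hv, hju⟩ := mem_valleyCells.1 hu
  set c := content u with hc
  -- The paths that are stacked at content `c` without gaps above the valley `u`.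
  let S : ι → Prop := fun m => content (s m) ≤ c ∧ c ≤ content (t m) ∧ g m c ≤ g j c ∧
    ∀ r, g m c ≤ r → r ≤ g j c → Occupied s t g c r
  have hSj : S j := ⟨hv.1.le, hv.2.1.le, le_rfl, fun r h1 h2 =>
    ⟨j, hv.1.le, hv.2.1.le, le_antisymm h1 h2⟩⟩
  have hval : ∀ (n : ℕ) m, S m → g j c - g m c = n →
      ValleyAt (content (s m)) (content (t m)) (g m) c := by
    intro n
    induction n with
    | zero =>
      intro m hm he
      rwa [sg.eq_of_common hL hm.1 hm.2.1 hv.1.le hv.2.1.le (by push_cast at he; omega)]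
    | succ n ih =>
      intro m hm he
      push_cast at he
      obtain ⟨m', h1, h2, h3⟩ := hm.2.2.2 (g m c + 1) (by omega) (by omega)
      exact sg.valleyAt_above hL pg (ih m' ⟨h1, h2, by omega, fun r h4 h5 =>
        hm.2.2.2 r (by omega) h5⟩ (by omega)) hm.1 hm.2.1 h3.symm
  replace hval : ∀ m, S m → ValleyAt (content (s m)) (content (t m)) (g m) c := fun m hm =>
    hval (g j c - g m c).toNat m hm (by have := hm.2.2.1; omega)
  let g' : ι → ℤ → ℤ := fun m => if S m then Function.update (g m) c (g m c - 1) else g m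
  have hg1 : ∀ m, S m → g' m c = g m c - 1 := fun m hm => by simp [g', hm]
  have hg2 : ∀ m, ¬ S m → g' m = g m := fun m hm => by simp [g', hm]
  have hg3 : ∀ m d, d ≠ c → g' m d = g m d := fun m d hd => by
    by_cases hm : S m <;> simp [g', hm, hd]
  have pg' : ∀ i, IsPath lam (s i) (t i) (g' i) := by
    intro i
    by_cases hi : S i
    · have hvi := hval i hi
      have : g' i = Function.update (g i) c (g i c - 1) := by simp [g', hi]
      refine ⟨this ▸ (pg i).raise hvi, fun d h1 h2 => ?_⟩
      rcases eq_or_ne d c with rfl | hd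
      · obtain ⟨v1, v2, v3, v4⟩ := hvi
        have m1 := ((pg i).mem (c - 1) (by omega) (by omega)).col_nonneg
        have m2 := ((pg i).mem (c + 1) (by omega) (by omega)).row_nonneg
        rw [hg1 i hi]
        exact ((pg i).mem c h1 h2).of_le (by omega) (by omega) (by omega) (by omega)
      · rw [hg3 i d hd]; exact (pg i).mem d h1 h2
    · rw [hg2 i hi]; exact pg i
  have sg' : IsStrictFamily s t g' := by
    intro i k hik d h1 h2
    have hlt := sg i k hik d h1 h2
    rcases eq_or_ne d c with rfl | hd
    · have hm := hik.mem h1 h2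
      by_cases hk : S k
      · rw [hg1 k hk]
        by_cases hi : S i
        · rw [hg1 i hi]; omega
        · rw [hg2 i hi]; omega
      · rw [hg2 k hk]
        by_cases hi : S i
        · rw [hg1 i hi]
          refine lt_of_le_of_ne (by omega) fun he => hk ⟨hm.1.le, hm.2.le, ?_, fun r h3 h4 => ?_⟩
          · have := hi.2.2.1; omega
          · rcases h3.eq_or_lt with h3 | h3
            · exact ⟨k, hm.1.le, hm.2.le, h3⟩
            · exact hi.2.2.2 r (by omega) h4
        · rwa [hg2 i hi]
    · rwa [hg3 i d hd, hg3 k d hd]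
  have hgP' : P ⊆ familyCells lam s t g' := by
    intro w hw
    obtain ⟨hwl, m, h1, h2, h3⟩ := mem_familyCells.1 (hgP hw)
    refine mem_familyCells.2 ⟨hwl, ?_⟩
    rcases eq_or_ne (content w) c with hwc | hwc
    · rw [hwc] at h1 h2 h3 ⊢
      by_cases hm : S m
      · have hne : g m c ≠ g j c := fun he => by
          have : w = u := cell_ext hwc (by rw [← h3, he, hju])
          exact huP (this ▸ hw)
        have hle := hm.2.2.1
        obtain ⟨m', h4, h5, h6⟩ := hm.2.2.2 (g m c + 1) (by omega) (by omega)
        refine ⟨m', h4, h5, ?_⟩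
        rw [hg1 m' ⟨h4, h5, by omega, fun r h7 h8 => hm.2.2.2 r (by omega) h8⟩]
        omega
      · exact ⟨m, h1, h2, by rw [hg2 m hm, h3]⟩
    · exact ⟨m, h1, h2, by rw [hg3 m _ hwc, h3]⟩
  have hlt := hmin g' (Finset.mem_filter.2 ⟨mem_strictFamilies.2 ⟨pg', sg'⟩, hgP'⟩)
  refine absurd hlt (not_le.2 ?_)
  have hle : ∀ i d, g' i d ≤ g i d := by
    intro i d
    rcases eq_or_ne d c with rfl | hd
    · by_cases hi : S i
      · rw [hg1 i hi]; omega
      · rw [hg2 i hi]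
    · rw [hg3 i d hd]
  exact Finset.sum_lt_sum (fun i _ => Finset.sum_le_sum fun d _ => hle i d)
    ⟨j, Finset.mem_univ j, Finset.sum_lt_sum (fun d _ => hle j d)
      ⟨c, Finset.mem_Icc.2 ⟨hv.1.le, hv.2.1.le⟩, by rw [hg1 j hSj]; omega⟩⟩

/-- A strictly ordered family is determined by a set of its cells containing its valleys. Let two
families agree on the paths nested in the `j`-th one. If its `j`-th path is somewhere below that of
the other family, it is so at a valley, and no path of the other family can pass through it. -/
theorem eq_of_valleyCells_subset (hL : IsPathSystem lam L s t)
    (hh : ∀ i, IsPath lam (s i) (t i) (h i)) (hs : IsStrictFamily s t h)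
    (hh' : ∀ i, IsPath lam (s i) (t i) (h' i)) (hs' : IsStrictFamily s t h') {P : Finset Cell}
    (h1 : valleyCells lam s t h ⊆ P) (h2 : P ⊆ familyCells lam s t h)
    (h3 : valleyCells lam s t h' ⊆ P) (h4 : P ⊆ familyCells lam s t h') : h = h' := by
  have key : ∀ {h h' : ι → ℤ → ℤ}, (∀ i, IsPath lam (s i) (t i) (h i)) → IsStrictFamily s t h →
      (∀ i, IsPath lam (s i) (t i) (h' i)) → IsStrictFamily s t h' →
      valleyCells lam s t h ⊆ P → P ⊆ familyCells lam s t h' →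
      ∀ j, (∀ m, Nested s t m j → h m = h' m) → ∀ c, h j c ≤ h' j c := by
    intro h h' hh hs hh' hs' h1 h4 j hj c
    by_contra! hlt
    obtain ⟨d, hv, hd⟩ := (hh j).exists_valley_of_lt (hh' j).toIsWalk hlt
    obtain ⟨u, hu, rfl, hr⟩ := (hh j).mem d hv.1.le hv.2.1.le
    obtain ⟨-, m, m1, m2, m3⟩ :=
      mem_familyCells.1 (h4 (h1 (mem_valleyCells.2 ⟨hu, j, hv, hr.symm⟩)))
    have hm := hs'.nested_of_lt hL m1 m2 hv.1.le hv.2.1.le (by omega)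
    have := hs _ _ hm _ m1 m2
    rw [hj m hm] at this
    omega
  funext j
  induction hn : (content (t j) - content (s j)).toNat using Nat.strong_induction_on
    generalizing j with
  | _ n ih =>
    subst hn
    have hj : ∀ m, Nested s t m j → h m = h' m := fun m hm => by
      have k1 := hm.1; have k2 := hm.2; have k3 := hL.le m
      exact ih _ (by omega) m rfl
    funext c
    exact le_antisymm (key hh hs hh' hs' h1 h4 j hj c)
      (key hh' hs' hh hs h3 h2 j (fun m hm => (hj m hm).symm) c)

/-- Every pleasant diagram lies, for a unique strictly ordered family, between the set of valleys
and the set of all cells of the family. -/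
theorem pleasantCount_eq_sum [Fintype ι] (hL : IsPathSystem lam L s t) :
    pleasantCount lam (lam.cells \ familyCells lam s t L) =
      ∑ h ∈ strictFamilies lam s t,
        2 ^ (∑ i, (content (t i) + 1 - content (s i)).toNat - valleyCount s t h) := by
  classical
  have h1 : pleasantDiagrams lam (lam.cells \ familyCells lam s t L) =
      (strictFamilies lam s t).biUnion fun h =>
        Finset.Icc (valleyCells lam s t h) (familyCells lam s t h) := by
    have hsub : ∀ h : ι → ℤ → ℤ, lam.cells \ (lam.cells \ familyCells lam s t h) =
        familyCells lam s t h := fun h =>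
      Finset.sdiff_sdiff_eq_self (Finset.filter_subset _ _)
    ext P
    simp only [pleasantDiagrams, Finset.mem_filter, Finset.mem_powerset, Finset.mem_biUnion,
      Finset.mem_Icc, isExcitedDiagram_iff hL]
    constructor
    · rintro ⟨-, _, ⟨h, hh, rfl⟩, hP⟩
      rw [hsub] at hP
      exact exists_valleyCells_subset hL hh hP
    · rintro ⟨h, hh, -, hP⟩
      exact ⟨hP.trans (Finset.filter_subset _ _), _, ⟨h, hh, rfl⟩, by rwa [hsub]⟩
  rw [pleasantCount, h1, Finset.card_biUnion]
  · refine Finset.sum_congr rfl fun h hh => ?_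
    obtain ⟨p, hs⟩ := mem_strictFamilies.1 hh
    rw [Finset.card_Icc_finset valleyCells_subset, card_familyCells hL p hs,
      card_valleyCells hL p hs]
  · intro h hh h' hh' hne
    obtain ⟨p, hs⟩ := mem_strictFamilies.1 hh
    obtain ⟨p', hs'⟩ := mem_strictFamilies.1 hh'
    rw [Function.onFun, Finset.disjoint_left]
    intro P hP hP'
    rw [Finset.mem_Icc] at hP hP'
    exact hne (eq_of_valleyCells_subset hL p hs p' hs' hP.1 hP.2 hP'.1 hP'.2)

/-- The number of pleasant diagrams as a value of the generating function of strictly ordered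
families by valleys. -/
theorem pleasantCount_eq [Fintype ι] (hL : IsPathSystem lam L s t) :
    (pleasantCount lam (lam.cells \ familyCells lam s t L) : ℚ) =
      2 ^ (∑ i, (content (t i) + 1 - content (s i)).toNat) *
        ∑ h ∈ strictFamilies lam s t, (1 / 2 : ℚ) ^ valleyCount s t h := by
  rw [pleasantCount_eq_sum hL, Finset.mul_sum]
  push_cast
  refine Finset.sum_congr rfl fun h hh => ?_
  obtain ⟨p, hs⟩ := mem_strictFamilies.1 hh
  have hle : valleyCount s t h ≤ ∑ i, (content (t i) + 1 - content (s i)).toNat := by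
    rw [← card_familyCells hL p hs, ← card_valleyCells hL p hs]
    exact Finset.card_le_card valleyCells_subset
  rw [pow_sub₀ _ two_ne_zero hle, one_div, inv_pow]

end Pleasant

/-! ### Lowest paths -/

section Lists

variable {lam : YoungDiagram} {s t s' t' : Cell} {D E : List Cell}

theorem IsDyckPathFromTo.exists_mem (hD : IsDyckPathFromTo lam s t D) {c : ℤ}
    (h1 : content s ≤ c) (h2 : c ≤ content t) : ∃ u ∈ D, content u = c ∧ (u.1 : ℤ) = rowFn D c := by
  obtain ⟨u, -, rfl, hu⟩ := hD.isPath.mem c h1 h2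
  exact ⟨u, (hD.mem_iff_rowFn u).2 ⟨h1, h2, hu.symm⟩, rfl, hu⟩

theorem diagonallyBelow_iff (hD : IsDyckPathFromTo lam s t D)
    (hE : IsDyckPathFromTo lam s' t' E) :
    DiagonallyBelow D E ↔ ∀ c, content s ≤ c → c ≤ content t →
      content s' ≤ c ∧ c ≤ content t' ∧ rowFn E c ≤ rowFn D c := by
  constructor
  · intro H c h1 h2
    obtain ⟨u, hu, rfl, hr⟩ := hD.exists_mem h1 h2
    obtain ⟨k, v, hv, h3, h4⟩ := H u hu
    obtain ⟨h5, h6, h7⟩ := (hE.mem_iff_rowFn v).1 hv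
    have : content v = content u := by simp only [content]; omega
    rw [this] at h5 h6 h7
    exact ⟨h5, h6, by omega⟩
  · intro H u hu
    obtain ⟨h1, h2, h3⟩ := (hD.mem_iff_rowFn u).1 hu
    obtain ⟨h4, h5, h6⟩ := H _ h1 h2
    obtain ⟨v, hv, h7, h8⟩ := hE.exists_mem h4 h5
    refine ⟨u.1 - v.1, v, hv, ?_, ?_⟩
    · omega
    · simp only [content] at h7; omega

theorem strictlyBelow_iff (hD : IsDyckPathFromTo lam s t D)
    (hE : IsDyckPathFromTo lam s' t' E) :
    StrictlyBelow D E ↔ ∀ c, content s ≤ c → c ≤ content t →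
      content s' ≤ c ∧ c ≤ content t' ∧ rowFn E c < rowFn D c := by
  rw [StrictlyBelow, WeaklyBelow, diagonallyBelow_iff hD hE]
  constructor
  · rintro ⟨⟨H, -⟩, hd⟩ c h1 h2
    obtain ⟨h3, h4, h5⟩ := H c h1 h2
    refine ⟨h3, h4, lt_of_le_of_ne h5 fun he => ?_⟩
    obtain ⟨u, hu, rfl, hr⟩ := hD.exists_mem h1 h2
    exact hd hu ((hE.mem_iff_rowFn u).2 ⟨h3, h4, he.trans hr.symm⟩)
  · intro H
    have hd : List.Disjoint D E := by
      intro u hu hu'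
      obtain ⟨h1, h2, h3⟩ := (hD.mem_iff_rowFn u).1 hu
      have := ((hE.mem_iff_rowFn u).1 hu').2.2
      have := (H _ h1 h2).2.2
      omega
    refine ⟨⟨fun c h1 h2 => ?_, fun u hu hu' => absurd hu' (hd hu)⟩, hd⟩
    obtain ⟨h3, h4, h5⟩ := H c h1 h2
    exact ⟨h3, h4, h5.le⟩

end Lists

section Rim

variable {lam : YoungDiagram} {s t : Cell}

theorem OnDiag.exists_max {c r : ℤ} (h : OnDiag lam c r) :
    ∃ r, OnDiag lam c r ∧ ∀ r', OnDiag lam c r' → r' ≤ r := by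
  classical
  obtain ⟨u, hu, hc, -⟩ := h
  obtain ⟨v, hv, hmax⟩ := (lam.cells.filter fun v => content v = c).exists_max_image
    (fun v => v.1) ⟨u, by simp [hu, hc]⟩
  rw [Finset.mem_filter, YoungDiagram.mem_cells] at hv
  refine ⟨v.1, ⟨v, hv.1, hv.2, rfl⟩, ?_⟩
  rintro _ ⟨w, hw, hwc, rfl⟩
  exact_mod_cast hmax w (by simp [hw, hwc])

/-- The rim of `lam` between a southmost and an eastmost cell is a path, and its cells are the
lowest ones of their diagonals. -/
theorem exists_rim (hs : s ∈ lam) (ht : t ∈ lam) (hs' : (s.1 + 1, s.2) ∉ lam)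
    (ht' : (t.1, t.2 + 1) ∉ lam) (hle : content s ≤ content t) :
    ∃ h, IsPath lam s t h ∧
      ∀ c, content s ≤ c → c ≤ content t → ∀ r, OnDiag lam c r → r ≤ h c := by
  classical
  have hne : ∀ c, ∃ r, content s ≤ c → c ≤ content t → OnDiag lam c r ∧
      ∀ r', OnDiag lam c r' → r' ≤ r := by
    intro c
    by_cases hc : content s ≤ c ∧ c ≤ content t
    · -- The diagonal meets the first row or the first column of `lam`.
      have h0 : OnDiag lam c (max 0 (-c)) := by
        rcases le_total 0 c with h0 | h0
        · refine (onDiag_content.2 ht).of_le ?_ ?_ ?_ ?_ <;> simp only [content] at * <;> omega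
        · refine (onDiag_content.2 hs).of_le ?_ ?_ ?_ ?_ <;> simp only [content] at * <;> omega
      obtain ⟨r, hr⟩ := h0.exists_max
      exact ⟨r, fun _ _ => hr⟩
    · exact ⟨0, fun h1 h2 => absurd ⟨h1, h2⟩ hc⟩
  choose f hf using hne
  have key : ∀ c, content s ≤ c → c ≤ content t →
      (if content s ≤ c ∧ c ≤ content t then f c else 0) = f c := fun c h1 h2 => if_pos ⟨h1, h2⟩
  refine ⟨fun c => if content s ≤ c ∧ c ≤ content t then f c else 0,
    ⟨⟨hle, ?_, ?_, fun c hc => if_neg (by omega), fun c h1 h2 => ?_⟩, fun c h1 h2 => ?_⟩,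
    fun c h1 h2 r hr => ?_⟩
  · obtain ⟨h1, h2⟩ := hf _ le_rfl hle
    simp only [key _ le_rfl hle]
    exact le_antisymm (row_le_of_south hs' h1) (h2 _ (onDiag_content.2 hs))
  · obtain ⟨h1, h2⟩ := hf _ hle le_rfl
    simp only [key _ hle le_rfl]
    exact le_antisymm (row_le_of_east ht' h1) (h2 _ (onDiag_content.2 ht))
  · simp only [key c h1 h2.le, key (c + 1) (by omega) (by omega)]
    obtain ⟨m1, n1⟩ := hf c h1 h2.le
    obtain ⟨m2, n2⟩ := hf (c + 1) (by omega) (by omega)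
    have a1 := m1.row_nonneg; have a2 := m1.col_nonneg
    have a3 := m2.row_nonneg; have a4 := m2.col_nonneg
    have b1 : f (c + 1) ≤ f c := by
      by_contra hlt
      have := n1 _ (m2.of_le (r' := f (c + 1)) a3 (by omega) le_rfl (by omega))
      omega
    have b2 : f c - 1 ≤ f (c + 1) := by
      by_contra hlt
      have := n2 _ (m1.of_le (r' := f c - 1) (by omega) (by omega) (by omega) (by omega))
      omega
    omega
  · simp only [key c h1 h2]; exact (hf c h1 h2).1
  · simp only [key c h1 h2]; exact (hf c h1 h2).2 r hr

/-- The pleasant diagrams of a lowest path are counted by valleys of paths: if there is a path from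
`s` to `t`, the lowest one is a segment of the rim and forms a path system with one member. -/
theorem lowestPathPleasantCount_eq (hs : s ∈ lam) (ht : t ∈ lam) (hs' : (s.1 + 1, s.2) ∉ lam)
    (ht' : (t.1, t.2 + 1) ∉ lam) :
    (lowestPathPleasantCount lam s t : ℚ) =
      2 ^ (content t + 1 - content s) * valleyGF lam s t (1 / 2 : ℚ) := by
  classical
  by_cases hlow : ∃ L, IsLowestPath lam s t L
  · rw [lowestPathPleasantCount, dif_pos hlow]
    obtain ⟨hP, hlowest⟩ := hlow.choose_spec
    set P := hlow.choose
    rw [mem_dyckPaths] at hP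
    have hle := hP.isPath.le
    obtain ⟨g, hg, hgmax⟩ := exists_rim hs ht hs' ht' hle
    obtain ⟨E, hE, rfl⟩ := hg.exists_list
    have hmax : ∀ c r, content s ≤ c → c ≤ content t → OnDiag lam c r → r ≤ rowFn P c :=
      fun c r h1 h2 hr => (hgmax c h1 h2 r hr).trans
        (((diagonallyBelow_iff hP hE).1 (hlowest E (mem_dyckPaths.2 hE))) c h1 h2).2.2
    have hL : IsPathSystem lam (fun _ : Unit => rowFn P) (fun _ => s) fun _ => t :=
      ⟨fun _ => hP.isPath, fun _ => hs', fun _ => ht', fun i j hij => absurd rfl hij,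
        fun _ c r h1 h2 h3 h4 => absurd h3 (hmax c r h1 h2 h4).not_gt⟩
    have hcells : lam.cells \ P.toFinset =
        lam.cells \ familyCells lam (fun _ : Unit => s) (fun _ => t) fun _ => rowFn P := by
      ext u
      simp only [Finset.mem_sdiff, List.mem_toFinset, mem_familyCells, Occupied,
        hP.mem_iff_rowFn u, YoungDiagram.mem_cells, exists_const]
      tauto
    have hdet := det_valleyGF (r := fun _ => 0) hL (fun _ _ h => absurd h Nested.irrefl)
      (fun _ _ => rfl) (fun _ _ h => absurd h.1 Nested.irrefl) (q := (1 / 2 : ℚ)) (by norm_num)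
    rw [Matrix.det_unique, Finset.sum_const_zero, pow_zero, one_mul] at hdet
    rw [hcells, pleasantCount_eq hL, ← hdet]
    congr 1
    simp only [Finset.univ_unique, Finset.sum_singleton]
    rw [← zpow_natCast]
    congr 1
    omega
  · rw [lowestPathPleasantCount, dif_neg hlow, valleyGF, Finset.sum_eq_zero]
    · simp
    · intro D hD
      rw [mem_dyckPaths] at hD
      obtain ⟨g, hg, hgmax⟩ := exists_rim hs ht hs' ht' hD.isPath.le
      obtain ⟨E, hE, rfl⟩ := hg.exists_list
      refine absurd ⟨E, mem_dyckPaths.2 hE, fun D' hD' => ?_⟩ hlow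
      rw [mem_dyckPaths] at hD'
      exact (diagonallyBelow_iff hE hD').2 fun c h1 h2 =>
        ⟨h1, h2, hgmax c h1 h2 _ (hD'.isPath.mem c h1 h2)⟩

end Rim

/-! ### The Kreiman outer decomposition as a path system -/

section Kreiman

variable {lam mu : YoungDiagram} {k : ℕ} {L : Fin k → List Cell} {s t : Fin k → Cell}

theorem IsKreimanDecomposition.start_mem (hL : IsKreimanDecomposition lam mu L s t) (i : Fin k) :
    s i ∈ lam := (hL.path i).1.1 _ (List.mem_of_head? (hL.path i).2.1)

theorem IsKreimanDecomposition.finish_mem (hL : IsKreimanDecomposition lam mu L s t) (i : Fin k) :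
    t i ∈ lam := (hL.path i).1.1 _ (List.mem_of_getLast? (hL.path i).2.2)

theorem IsKreimanDecomposition.isPathSystem (hL : IsKreimanDecomposition lam mu L s t) :
    IsPathSystem lam (fun i => rowFn (L i)) s t := by
  refine ⟨fun i => (hL.path i).isPath, hL.south, hL.east, fun i j hij c h1 h2 h3 h4 he => ?_,
    fun i c r h1 h2 h3 h4 => ?_⟩
  · obtain ⟨u, hu, rfl, hr⟩ := (hL.path i).exists_mem h1 h2
    exact hL.disjoint i j hij hu
      (((hL.path j).mem_iff_rowFn u).2 ⟨h3, h4, he.symm.trans hr.symm⟩)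
  · obtain ⟨u, hu, rfl, rfl⟩ := h4
    -- A cell below a cell outside of `mu` is not in `mu`.
    obtain ⟨v, hv, hvu, hvr⟩ := (hL.path i).exists_mem h1 h2
    have hvmu := ((hL.cover v).1 ⟨i, hv⟩).2
    have humu : u ∉ mu := fun humu => by
      refine hvmu (onDiag_content.1 ((onDiag_content.2 humu).of_le ?_ ?_ ?_ ?_)) <;>
        simp only [content] at * <;> omega
    obtain ⟨j, hj⟩ := (hL.cover u).2 ⟨hu, humu⟩
    exact ⟨j, ((hL.path j).mem_iff_rowFn u).1 hj⟩

/-- The order of the decomposition is the order of the content intervals by inclusion. -/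
theorem IsKreimanDecomposition.strictlyBelow_iff (hL : IsKreimanDecomposition lam mu L s t)
    {i j : Fin k} : StrictlyBelow (L i) (L j) ↔ Nested s t i j := by
  have hP := hL.isPathSystem
  rw [SkewDyck.strictlyBelow_iff (hL.path i) (hL.path j)]
  constructor
  · intro H
    have h1 := H _ le_rfl (hP.le i)
    exact hP.isStrictFamily.nested_of_lt hP le_rfl (hP.le i) h1.1 h1.2.1 h1.2.2
  · intro h c h1 h2
    have hm := h.mem h1 h2
    exact ⟨hm.1.le, hm.2.le, hP.lt_of_nested h h1 h2⟩

theorem IsKreimanDecomposition.cells_eq (hL : IsKreimanDecomposition lam mu L s t)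
    (hmu : mu ≤ lam) :
    mu.cells = lam.cells \ familyCells lam s t fun i => rowFn (L i) := by
  ext u
  have h1 : Occupied s t (fun i => rowFn (L i)) (content u) u.1 ↔ ∃ i, u ∈ L i :=
    exists_congr fun i => ((hL.path i).mem_iff_rowFn u).symm
  have h2 : u ∈ mu → u ∈ lam := fun h => hmu h
  rw [mem_sdiff_familyCells, h1, hL.cover, YoungDiagram.mem_cells]
  tauto

theorem isHighPath_rowFn {s t : Cell} {D : List Cell} (hD : IsDyckPathFromTo lam s t D)
    (h1 : FirstStepUp D) (h2 : LastStepDown D) (h3 : AllPeaksHigh lam D) :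
    IsHighPath lam s t (rowFn D) := by
  obtain ⟨h4, h5⟩ := hD.firstStepUp h1
  refine ⟨h4, h5, (hD.lastStepDown h2).2, fun c hc => ?_⟩
  have hm := hD.isPath.mem c hc.1.le hc.2.1.le
  have h6 := hm.row_nonneg
  have h7 := hm.col_nonneg
  refine ⟨_, h3 _ (hD.isPeak_cellAt hc), ?_, ?_⟩ <;> simp only [content, cellAt] <;> push_cast <;>
    omega

theorem IsKreimanDecomposition.sum_nonintersectingTuples
    (hL : IsKreimanDecomposition lam mu L s t) {K : Type*} [Field K] (q : K) :
    ∑ D ∈ nonintersectingTuples lam L s t, q ^ (∑ i, (valleys (D i)).card) =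
      ∑ h ∈ strictFamilies lam s t, q ^ valleyCount s t h := by
  classical
  have hmem : ∀ D : Fin k → List Cell, D ∈ nonintersectingTuples lam L s t ↔
      (∀ i, IsDyckPathFromTo lam (s i) (t i) (D i)) ∧
        IsStrictFamily s t fun i => rowFn (D i) := by
    intro D
    rw [nonintersectingTuples, Finset.mem_filter, Fintype.mem_piFinset]
    simp only [mem_dyckPaths, hL.strictlyBelow_iff]
    refine and_congr_right fun hD => forall_congr' fun i => forall_congr' fun j =>
      forall_congr' fun hij => ?_
    rw [SkewDyck.strictlyBelow_iff (hD i) (hD j)]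
    refine forall_congr' fun c => forall_congr' fun h1 => forall_congr' fun h2 => ?_
    have hm := hij.mem h1 h2
    exact ⟨fun h => h.2.2, fun h => ⟨hm.1.le, hm.2.le, h⟩⟩
  refine Finset.sum_bij (fun D _ i => rowFn (D i)) ?_ ?_ ?_ ?_
  · intro D hD
    obtain ⟨h1, h2⟩ := (hmem D).1 hD
    exact mem_strictFamilies.2 ⟨fun i => (h1 i).isPath, h2⟩
  · intro D hD E hE h
    funext i
    exact rowFn_injOn (((hmem D).1 hD).1 i) (((hmem E).1 hE).1 i) (congrFun h i)
  · intro h hh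
    obtain ⟨p, hs⟩ := mem_strictFamilies.1 hh
    choose D hD hDh using fun i => (p i).exists_list
    obtain rfl : (fun i => rowFn (D i)) = h := funext hDh
    exact ⟨D, (hmem D).2 ⟨hD, hs⟩, rfl⟩
  · intro D hD
    obtain ⟨h1, -⟩ := (hmem D).1 hD
    rw [valleyCount, Finset.sum_congr rfl fun i _ => (h1 i).card_valleys]

/-- The determinant of the counts of pleasant diagrams of lowest paths, as a value of the
determinant of valley generating functions. -/
theorem IsKreimanDecomposition.det_lowestPathPleasantCount
    (hL : IsKreimanDecomposition lam mu L s t) :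
    Matrix.det (Matrix.of fun i j : Fin k => (lowestPathPleasantCount lam (s i) (t j) : ℚ)) =
      2 ^ (∑ i, (content (t i) + 1 - content (s i)).toNat) *
        Matrix.det (Matrix.of fun i j : Fin k => valleyGF lam (s i) (t j) (1 / 2 : ℚ)) := by
  -- The power of `2` in the entry `(i, j)` is a product of a factor of the row and one of the
  -- column, also where there are no paths and the entry is `0`.
  have h1 : (Matrix.of fun i j : Fin k => (lowestPathPleasantCount lam (s i) (t j) : ℚ)) =
      Matrix.of fun i j => (2 : ℚ) ^ (-content (s i)) *
        (Matrix.of fun i j => (2 : ℚ) ^ (content (t j) + 1) *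
          (Matrix.of fun i j : Fin k => valleyGF lam (s i) (t j) (1 / 2 : ℚ)) i j) i j := by
    ext i j
    simp only [Matrix.of_apply]
    rw [lowestPathPleasantCount_eq (hL.start_mem i) (hL.finish_mem j) (hL.south i) (hL.east j),
      ← mul_assoc, ← zpow_add₀ two_ne_zero]
    congr 2
    ring
  rw [h1, Matrix.det_mul_column, Matrix.det_mul_row, ← mul_assoc, ← Finset.prod_mul_distrib,
    ← Finset.prod_pow_eq_pow_sum]
  congr 1
  refine Finset.prod_congr rfl fun i _ => ?_
  have := hL.isPathSystem.le i
  rw [← zpow_add₀ two_ne_zero, ← zpow_natCast]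
  congr 1
  omega

end Kreiman

end SkewDyck

theorem mainTheorem6 (lam mu : YoungDiagram) (hmu : mu ≤ lam) (k : ℕ)
    (L : Fin k → List SkewDyck.Cell) (s t : Fin k → SkewDyck.Cell)
    (hL : SkewDyck.IsKreimanDecomposition lam mu L s t)
    (r : Fin k → ℕ)
    (hr : SkewDyck.IsRankFunction (fun i j => SkewDyck.StrictlyBelow (L i) (L j)) r)
    (hcond : ∀ i j, SkewDyck.StrictlyBelow (L i) (L j) →
      SkewDyck.FirstStepUp (L j) ∧ SkewDyck.LastStepDown (L j) ∧
        SkewDyck.AllPeaksHigh lam (L j)) :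
    (∀ (K : Type*) [Field K] (q : K), q ≠ 0 →
      ∑ D ∈ SkewDyck.nonintersectingTuples lam L s t,
          q ^ (∑ i, (SkewDyck.valleys (D i)).card) =
        q ^ (-∑ i, (r i : ℤ)) *
          Matrix.det (Matrix.of fun i j : Fin k => SkewDyck.valleyGF lam (s i) (t j) q)) ∧
    (SkewDyck.pleasantCount lam mu.cells : ℤ) =
      2 ^ (∑ i, r i) *
        Matrix.det (Matrix.of fun i j : Fin k =>
          (SkewDyck.lowestPathPleasantCount lam (s i) (t j) : ℤ)) := by
  have hP := hL.isPathSystem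
  have hN : ∀ i j, SkewDyck.Nested s t i j →
      SkewDyck.IsHighPath lam (s j) (t j) (SkewDyck.rowFn (L j)) := fun i j hij => by
    obtain ⟨h1, h2, h3⟩ := hcond i j (hL.strictlyBelow_iff.2 hij)
    exact SkewDyck.isHighPath_rowFn (hL.path j) h1 h2 h3
  simp only [hL.strictlyBelow_iff] at hr
  have hr' : ∀ i j, SkewDyck.Covers s t i j → r j = r i + 1 := fun i j hij => hr.2 i j hij.1 hij.2
  refine ⟨fun K _ q hq => ?_, ?_⟩
  · rw [hL.sum_nonintersectingTuples, SkewDyck.det_valleyGF hP hN hr.1 hr' hq, zpow_neg,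
      ← Nat.cast_sum, zpow_natCast, inv_mul_cancel_left₀ (pow_ne_zero _ hq)]
  -- Up to powers of `2`, the sides are the values at `q = 1 / 2` of those of the first identity.
  · have hdet := hL.det_lowestPathPleasantCount
    rw [SkewDyck.det_valleyGF hP hN hr.1 hr' (by norm_num : (1 / 2 : ℚ) ≠ 0)] at hdet
    have hcount := SkewDyck.pleasantCount_eq hP
    rw [← hL.cells_eq hmu] at hcount
    have key : (SkewDyck.pleasantCount lam mu.cells : ℚ) = 2 ^ (∑ i, r i) *
        Matrix.det (Matrix.of fun i j : Fin k =>
          (SkewDyck.lowestPathPleasantCount lam (s i) (t j) : ℚ)) := by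
      rw [hdet, hcount, one_div, inv_pow]
      field_simp
    have hcast : (((Matrix.det (Matrix.of fun i j : Fin k =>
        (SkewDyck.lowestPathPleasantCount lam (s i) (t j) : ℤ)) : ℤ)) : ℚ) =
        Matrix.det (Matrix.of fun i j : Fin k =>
          (SkewDyck.lowestPathPleasantCount lam (s i) (t j) : ℚ)) := by
      rw [Int.cast_det]
      congr 1
    rw [← hcast] at key
    exact_mod_cast key
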